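/- Let $n\ge 0$ and equip $\mathbb{C}^{2n}$, with coordinates $(q,p)=(q_1,\dots,q_n,p_1,\dots,p_n)$, with the symplectic form $\omega=\sum_i dq_i\wedge dp_i$. Let $\mathcal{O}=\mathcal{O}_{\mathbb{C}^{2n},0}$ be the $\mathbb{C}$-algebra of germs at $0$ of holomorphic functions, with Poisson bracket $\{f,g\}=\sum_i(\partial_{q_i}f\,\partial_{p_i}g-\partial_{p_i}f\,\partial_{q_i}g)$, let $\mathcal{M}\subset\mathcal{O}$ be the ideal of germs vanishing at $0$, and let $I\subset\mathcal{O}$ be the ideal generated by $q_1p_1,\dots,q_np_n$. Let $\lambda=(\lambda_1,\dots,\lambda_n)\in\mathbb{C}^n$ be Diophantine: there are $C>0$ and $\tau\in\mathbb{N}$ such that $$\Bigl|\sum_j\lambda_j i_j\Bigr|\ \ge\ \frac{C}{(|i_1|+\dots+|i_n|)^{\tau}}\qquad\text{for all } i\in\mathbb{Z}^n\setminus\{0\}.$$ Put $H=\sum_{i=1}^n\lambda_iq_ip_i$ and let $R\in\mathcal{M}^3$. Then there is a symplectic automorphism $\varphi$ of $\mathcal{O}$ (a $\mathbb{C}$-algebra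 automorphism preserving the Poisson bracket) such that $$\varphi(H+R)=H\pmod{I^2}.$$ Moreover, the Hamiltonian flow of $H+R$ is linearized by a symplectomorphism on a (possibly singular) complex Lagrangian variety symplectomorphic to $V(I)=\{q_1p_1=\dots=q_np_n=0\}$. Precisely, for every function $F$ that is holomorphic near $0$ and has germ $H+R$, there are open neighbourhoods $U,V$ of $0$ in $\mathbb{C}^{2n}$ and a biholomorphic symplectic map $\Phi:U\to V$ with $\Phi(0)=0$ that induces $\varphi$ (that is, $\varphi(f)=f\circ\Phi$ for all $f\in\mathcal{O}$), such that $F$ is holomorphic on $V$, the set $L=\Phi(V(I)\cap U)$ is an analytic subset of $V$ which is a Lagrangian complex submanifold near each point of a dense subset of $L$, and, for every $z=(q,p)\in V(I)\cap U$, every connected open $D\subset\mathbb{C}$ containing $0$ and every $\gamma:D\to\mathbb{C}^{2n}$ with $\gamma(0)=\Phi(z)$, the following are equivalent: (a) $\gamma$ takes values in $V$ and solves Hamilton's equations $\dot q_i=\partial F/\partial p_i$, $\dot p_i=-\partial F/\partial q_i$ on $D$; (b) for all $t\in D$, the point $\psi_t(z)=(e^{\lambda_it}q_i,\;e^{-\lambda_it}p_i)_{i}$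 lies in $U$ and $\gamma(t)=\Phi(\psi_t(z))$. -/

import Mathlib

open Filter Topology

noncomputable section

/-- The phase space `ℂ²ⁿ`, with coordinates `z = (q, p)`. -/
abbrev PhaseSpace (n : ℕ) : Type := (Fin n → ℂ) × (Fin n → ℂ)

/-- Germs at the origin of arbitrary functions `ℂ²ⁿ → ℂ` form a `ℂ`-algebra. -/
instance germAlgebra (n : ℕ) : Algebra ℂ (Germ (𝓝 (0 : PhaseSpace n)) ℂ) :=
  Algebra.ofModule
    (fun c f g => by
      induction f using Germ.inductionOn with | _ f =>
      induction g using Germ.inductionOn with | _ g =>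
      exact congrArg (Germ.ofFun (l := 𝓝 (0 : PhaseSpace n))) (smul_mul_assoc c f g))
    (fun c f g => by
      induction f using Germ.inductionOn with | _ f =>
      induction g using Germ.inductionOn with | _ g =>
      exact congrArg (Germ.ofFun (l := 𝓝 (0 : PhaseSpace n))) (mul_smul_comm c f g))

/-- The germ at the origin of an arbitrary function. -/
abbrev germOf {n : ℕ} (f : PhaseSpace n → ℂ) : Germ (𝓝 (0 : PhaseSpace n)) ℂ :=
  Germ.ofFun f

/-- The algebra `𝓞_{ℂ²ⁿ,0}` of germs at the origin of holomorphic functions. -/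
def holGerm (n : ℕ) : Subalgebra ℂ (Germ (𝓝 (0 : PhaseSpace n)) ℂ) where
  carrier := {g | ∃ f : PhaseSpace n → ℂ, AnalyticAt ℂ f 0 ∧ germOf f = g}
  mul_mem' := by
    rintro _ _ ⟨f, hf, rfl⟩ ⟨g, hg, rfl⟩
    exact ⟨f * g, hf.mul hg, rfl⟩
  add_mem' := by
    rintro _ _ ⟨f, hf, rfl⟩ ⟨g, hg, rfl⟩
    exact ⟨f + g, hf.add hg, rfl⟩
  algebraMap_mem' c := by
    refine ⟨fun _ => c, analyticAt_const, ?_⟩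
    rw [Algebra.algebraMap_eq_smul_one]
    refine congrArg (Germ.ofFun (l := 𝓝 (0 : PhaseSpace n))) (funext fun z => ?_)
    simp

/-- The germ at the origin of a function that is holomorphic there. -/
def toGerm {n : ℕ} (f : PhaseSpace n → ℂ) (hf : AnalyticAt ℂ f 0) : holGerm n :=
  ⟨germOf f, f, hf, rfl⟩

/-- The maximal ideal `𝓜` of germs that vanish at the origin. -/
def maxIdeal (n : ℕ) : Ideal (holGerm n) :=
  RingHom.ker ((Germ.valueRingHom (x := (0 : PhaseSpace n)) (E := ℂ)).comp
    (holGerm n).val.toRingHom)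

/-- The germ of the coordinate function `q i`. -/
def qGerm {n : ℕ} (i : Fin n) : holGerm n :=
  toGerm (fun z => z.1 i)
    (((ContinuousLinearMap.proj (R := ℂ) (φ := fun _ : Fin n => ℂ) i).comp
      (ContinuousLinearMap.fst ℂ (Fin n → ℂ) (Fin n → ℂ))).analyticAt 0)

/-- The germ of the coordinate function `p i`. -/
def pGerm {n : ℕ} (i : Fin n) : holGerm n :=
  toGerm (fun z => z.2 i)
    (((ContinuousLinearMap.proj (R := ℂ) (φ := fun _ : Fin n => ℂ) i).comp
      (ContinuousLinearMap.snd ℂ (Fin n → ℂ) (Fin n → ℂ))).analyticAt 0)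

/-- The ideal `I` generated by the products `q i * p i`. -/
def qpIdeal (n : ℕ) : Ideal (holGerm n) :=
  Ideal.span (Set.range fun i : Fin n => qGerm i * pGerm i)

/-- The quadratic Hamiltonian `H = ∑ λ_i q_i p_i`. -/
def quadH {n : ℕ} (lam : Fin n → ℂ) : holGerm n :=
  ∑ i, lam i • (qGerm i * pGerm i)

/-- Directional derivative of a holomorphic germ in the constant direction `v`. -/
def germDeriv {n : ℕ} (v : PhaseSpace n) (g : holGerm n) : holGerm n :=
  ⟨Germ.liftOn g.1 (fun f => germOf fun z => fderiv ℂ f z v) fun _ _ h =>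
      Germ.coe_eq.2 ((h.fderiv (𝕜 := ℂ)).mono fun _ hz => by simp only [hz]), by
    obtain ⟨_, f, hf, rfl⟩ := g
    exact ⟨fun z => fderiv ℂ f z v,
      ((ContinuousLinearMap.apply ℂ ℂ v).analyticAt _).comp (AnalyticAt.fderiv hf), rfl⟩⟩

/-- The vector `∂/∂q_i`. -/
def dq {n : ℕ} (i : Fin n) : PhaseSpace n := (Pi.single i 1, 0)

/-- The vector `∂/∂p_i`. -/
def dp {n : ℕ} (i : Fin n) : PhaseSpace n := (0, Pi.single i 1)

/-- The standard Poisson bracket on holomorphic germs, normalised by `{q_i, p_i} = 1`. -/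
def poisson {n : ℕ} (f g : holGerm n) : holGerm n :=
  ∑ i, (germDeriv (dq i) f * germDeriv (dp i) g - germDeriv (dp i) f * germDeriv (dq i) g)

/-- A symplectic automorphism of the algebra of holomorphic germs: it preserves the Poisson
bracket. -/
def IsSymplecticAut {n : ℕ} (φ : holGerm n ≃ₐ[ℂ] holGerm n) : Prop :=
  ∀ f g, φ (poisson f g) = poisson (φ f) (φ g)

/-- The vector `lam` is Diophantine: there are `C > 0` and `τ ∈ ℕ` such that
`|(lam, i)| ≥ C / (|i_1| + ⋯ + |i_n|) ^ τ` for all non-zero integer vectors `i`. -/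
def IsDiophantine {n : ℕ} (lam : Fin n → ℂ) : Prop :=
  ∃ C : ℝ, 0 < C ∧ ∃ τ : ℕ, ∀ i : Fin n → ℤ, i ≠ 0 →
    C / (∑ j, |(i j : ℝ)|) ^ τ ≤ ‖∑ j, lam j * (i j : ℂ)‖

/-- The standard symplectic form `∑ dq_i ∧ dp_i`. -/
def sympForm {n : ℕ} (u v : PhaseSpace n) : ℂ :=
  ∑ i, (u.1 i * v.2 i - u.2 i * v.1 i)

/-- The Hamiltonian vector field `q_i' = ∂F/∂p_i`, `p_i' = -∂F/∂q_i`. -/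
def hamField {n : ℕ} (F : PhaseSpace n → ℂ) (z : PhaseSpace n) : PhaseSpace n :=
  (fun i => fderiv ℂ F z (dp i), fun i => -fderiv ℂ F z (dq i))

/-- The flow at complex time `t` of the linear vector field `q_i' = λ_i q_i`, `p_i' = -λ_i p_i`,
which is the Hamiltonian vector field of `∑ λ_i q_i p_i`. -/
def linFlow {n : ℕ} (lam : Fin n → ℂ) (t : ℂ) (z : PhaseSpace n) : PhaseSpace n :=
  (fun i => Complex.exp (t * lam i) * z.1 i, fun i => Complex.exp (-(t * lam i)) * z.2 i)

/-- The variety of the ideal `I`: the union of the `2 ^ n` coordinate planes `q_i p_i = 0`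
for all `i`. -/
def qpVariety (n : ℕ) : Set (PhaseSpace n) := {z | ∀ i, z.1 i * z.2 i = 0}

/-- A complex analytic subset of the open set `V`. -/
def IsAnalyticSubset {n : ℕ} (V L : Set (PhaseSpace n)) : Prop :=
  L ⊆ V ∧ ∀ a ∈ V, ∃ (k : ℕ) (g : PhaseSpace n → Fin k → ℂ),
    AnalyticAt ℂ g a ∧ ∀ᶠ z in 𝓝 a, (z ∈ L ↔ g z = 0)

/-- Near its point `a`, the set `L` is a Lagrangian complex submanifold: the zero set of a
submersion to `ℂⁿ` whose tangent space at each zero is isotropic. -/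
def IsLagrangianAt {n : ℕ} (L : Set (PhaseSpace n)) (a : PhaseSpace n) : Prop :=
  a ∈ L ∧ ∃ g : PhaseSpace n → Fin n → ℂ, AnalyticAt ℂ g a ∧
    Function.Surjective (fderiv ℂ g a) ∧
    ∀ᶠ z in 𝓝 a, (z ∈ L ↔ g z = 0) ∧
      (z ∈ L → ∀ u v, fderiv ℂ g z u = 0 → fderiv ℂ g z v = 0 → sympForm u v = 0)

/-- A (possibly singular) Lagrangian complex variety in the open set `V`: an analytic subset
of `V` that is a Lagrangian submanifold near each point of a dense subset. -/
def IsLagrangianVariety {n : ℕ} (V L : Set (PhaseSpace n)) : Prop :=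
  IsAnalyticSubset V L ∧ L ⊆ closure {a | IsLagrangianAt L a}

/-- `Φ` is a biholomorphic symplectomorphism between its (open) source and target. -/
def IsSymplectomorphism {n : ℕ} (Φ : OpenPartialHomeomorph (PhaseSpace n) (PhaseSpace n)) :
    Prop :=
  AnalyticOnNhd ℂ Φ Φ.source ∧ AnalyticOnNhd ℂ Φ.symm Φ.target ∧
    ∀ z ∈ Φ.source, ∀ u v, sympForm (fderiv ℂ Φ z u) (fderiv ℂ Φ z v) = sympForm u v

/-- `Φ` is a representative, defined near the origin and fixing it, of the automorphism `φ`,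
that is, `φ f = f ∘ Φ` for all germs `f`. -/
def Represents {n : ℕ} (Φ : OpenPartialHomeomorph (PhaseSpace n) (PhaseSpace n))
    (φ : holGerm n ≃ₐ[ℂ] holGerm n) : Prop :=
  0 ∈ Φ.source ∧ Φ 0 = 0 ∧ ∀ (f : PhaseSpace n → ℂ) (hf : AnalyticAt ℂ f 0),
    (φ (toGerm f hf) : Germ (𝓝 (0 : PhaseSpace n)) ℂ) = germOf fun z => f (Φ z)

/-- On the image under `Φ` of `S`, the flow of the vector field `X` in the target of `Φ` is
conjugate by `Φ` to the flow `ψ`: for `z ∈ S`, a curve `γ` over a connected open set of complex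
times that starts at `Φ z` is a solution of `γ' = X γ` inside the target if and only if it is
the image by `Φ` of the curve `t ↦ ψ t z` (the latter staying in the source). -/
def ConjugatesFlow {n : ℕ} (Φ : OpenPartialHomeomorph (PhaseSpace n) (PhaseSpace n))
    (S : Set (PhaseSpace n)) (X : PhaseSpace n → PhaseSpace n)
    (ψ : ℂ → PhaseSpace n → PhaseSpace n) : Prop :=
  ∀ z ∈ S ∩ Φ.source, ∀ D : Set ℂ, IsOpen D → IsPreconnected D → 0 ∈ D →
    ∀ γ : ℂ → PhaseSpace n, γ 0 = Φ z →
      ((∀ t ∈ D, γ t ∈ Φ.target ∧ HasDerivAt γ (X (γ t)) t) ↔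
        ∀ t ∈ D, ψ t z ∈ Φ.source ∧ γ t = Φ (ψ t z))

end

/-! The flow of a Hamiltonian G acts on functions by the Lie series exp {·, G}. Bracketing with H is
diagonal on monomials: q^a p^b has eigenvalue Σ λ_i (b_i - a_i), which for Diophantine λ vanishes
only if a = b. A monomial outside I² has Σ min(a_i, b_i) ≤ 1, so in degree at least 3 it is never
resonant, and its eigenvalue is bounded below by a power of its degree (`exists_divisor_bound`).
Everything of order at least 3 outside I² can thus be removed.

During the iteration the Hamiltonian is H + T + R with T in I² and R the error. Since {I^a, I^b} ⊆
I^(a+b-1) (`bracket_mem_pairGE`), the equation {H + T, G} + R ∈ I² is triangular: it is solved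
modulo I first, then modulo I² (`stepG`, `stepT_mem`). Hence T need only stay bounded, not small.

Convergence is measured in weighted ℓ¹ norms of coefficients. A derivative costs the reciprocal of
the loss d of radius, a small divisor costs d^(-τ), and one step turns an error ε into η ε as soon
as A ε ≤ η d^p (`exists_kam_step`). Along radii decreasing from 1 to 1/2 the errors decrease
geometrically, fast enough to pay for these losses. The order of R also grows at each step, so the
composed Lie series converge coefficient by coefficient (`exists_formal_normal_form`). Smallness of
the initial R comes from a dilation.

The limit is multiplicative and bounded, hence a substitution f ↦ f ∘ Φ (`evalS_map`), and Φ is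
symplectic because its components have canonical brackets (`sympForm_fderiv_mapOf`).

Finally F ∘ Φ = H + N with N in I², so dN = 0 on V(I), and there F ∘ Φ has the Hamiltonian field of
H. As the linear flow preserves V(I), Φ carries it to the flow of F; uniqueness for differential
equations and connectedness of the time domain give the converse (`conjugatesFlow`). At points where
exactly one coordinate of each pair vanishes, V(I) is locally a Lagrangian coordinate plane, and
such points are dense in it. -/

noncomputable section

/-! ### Formal power series in the canonical coordinates -/

/-- Exponents of monomials in the canonical coordinates. -/
abbrev Expo (n : ℕ) : Type := (Fin n ⊕ Fin n) →₀ ℕ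

/-- Formal power series in the canonical coordinates. -/
abbrev FPS (n : ℕ) : Type := MvPowerSeries (Fin n ⊕ Fin n) ℂ

namespace FPS

open MvPowerSeries Finset.HasAntidiagonal

variable {n : ℕ}

/-- The largest power of the ideal `(q_1 p_1, …, q_n p_n)` that contains a given monomial. -/
def pairCount (m : Expo n) : ℕ := ∑ i, min (m (.inl i)) (m (.inr i))

/-- The series all of whose monomials have weight at least `k`. -/
def weightGE (W : Expo n → ℕ) (k : ℕ) : Submodule ℂ (FPS n) where
  carrier := {f | ∀ m, W m < k → coeff m f = 0}
  add_mem' hf hg m hm := by rw [map_add, hf m hm, hg m hm, add_zero]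
  zero_mem' m _ := coeff_zero m
  smul_mem' c f hf m hm := by rw [coeff_smul, hf m hm, mul_zero]

/-- The series of order at least `k`. -/
abbrev ordGE (k : ℕ) : Submodule ℂ (FPS n) := weightGE Finsupp.degree k

/-- The series in the `k`-th power of the ideal generated by the products `q_i p_i`. -/
abbrev pairGE (k : ℕ) : Submodule ℂ (FPS n) := weightGE pairCount k

theorem weightGE_mono {W : Expo n → ℕ} {k l : ℕ} (h : k ≤ l) {f : FPS n}
    (hf : f ∈ weightGE W l) : f ∈ weightGE W k := fun m hm => hf m (hm.trans_le h)

theorem mem_weightGE_zero {W : Expo n → ℕ} (f : FPS n) : f ∈ weightGE W 0 :=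
  fun _ hm => absurd hm (Nat.not_lt_zero _)

theorem eq_zero_of_forall_mem_ordGE {f : FPS n} (h : ∀ k, f ∈ ordGE k) : f = 0 :=
  MvPowerSeries.ext fun m => h (m.degree + 1) m (Nat.lt_succ_self _)

theorem pairCount_add_le (x y : Expo n) : pairCount x + pairCount y ≤ pairCount (x + y) := by
  simp only [pairCount, ← Finset.sum_add_distrib, Finsupp.add_apply]
  exact Finset.sum_le_sum fun i _ => by omega

/-- Only the i-th minimum changes, and by one. A bracket differentiates once in q_i and once in p_i,
so this is why it lowers the power of the ideal by one only, although it lowers the degree by two.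
-/
theorem pairCount_add_pair (m : Expo n) (i : Fin n) :
    pairCount (m + Finsupp.single (Sum.inl i) 1 + Finsupp.single (Sum.inr i) 1) ≤ pairCount m + 1 := by
  classical
  have : pairCount m + 1 = ∑ j, (min (m (.inl j)) (m (.inr j)) + if i = j then 1 else 0) := by
    simp [pairCount, Finset.sum_add_distrib]
  rw [this]
  refine Finset.sum_le_sum fun j _ => ?_
  simp only [Finsupp.add_apply, Finsupp.single_apply, Sum.inl.injEq, Sum.inr.injEq, reduceCtorEq,
    if_false]
  split_ifs <;> omega

theorem degree_add_pair (m : Expo n) (i : Fin n) :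
    (m + Finsupp.single (Sum.inl i) 1 + Finsupp.single (Sum.inr i) 1).degree ≤ m.degree + 2 := by
  simp [map_add, Finsupp.degree_single]

theorem two_mul_pairCount_le (m : Expo n) : 2 * pairCount m ≤ m.degree := by
  rw [Finsupp.degree_eq_sum, Fintype.sum_sum_type, pairCount, Finset.mul_sum,
    ← Finset.sum_add_distrib]
  exact Finset.sum_le_sum fun i _ => by omega

theorem pairGE_le_ordGE {k : ℕ} {f : FPS n} (hf : f ∈ pairGE k) : f ∈ ordGE (2 * k) :=
  fun m hm => hf m (by have := two_mul_pairCount_le m; omega)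

theorem mul_mem_weightGE {W : Expo n → ℕ} (hW : ∀ x y, W x + W y ≤ W (x + y)) {a b : ℕ}
    {f g : FPS n} (hf : f ∈ weightGE W a) (hg : g ∈ weightGE W b) :
    f * g ∈ weightGE W (a + b) := by
  classical
  intro m hm
  rw [coeff_mul]
  refine Finset.sum_eq_zero fun p hp => ?_
  have h1 := hW p.1 p.2
  rw [mem_antidiagonal.1 hp] at h1
  by_cases h : W p.1 < a
  · rw [hf _ h, zero_mul]
  · rw [hg _ (by omega), mul_zero]

theorem mul_mem_ordGE {a b : ℕ} {f g : FPS n} (hf : f ∈ ordGE a) (hg : g ∈ ordGE b) :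
    f * g ∈ ordGE (a + b) :=
  mul_mem_weightGE (fun x y => (map_add Finsupp.degree x y).ge) hf hg

/-- The Poisson bracket of formal power series. -/
def bracket : FPS n →ₗ[ℂ] FPS n →ₗ[ℂ] FPS n :=
  LinearMap.mk₂ ℂ (fun f g => ∑ i, (pderiv ℂ (.inl i) f * pderiv ℂ (.inr i) g
      - pderiv ℂ (.inr i) f * pderiv ℂ (.inl i) g))
    (fun f f' g => by
      rw [← Finset.sum_add_distrib]; exact Finset.sum_congr rfl fun i _ => by simp only [map_add]; ring)
    (fun c f g => by
      rw [Finset.smul_sum]; exact Finset.sum_congr rfl fun i _ => by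
        simp only [Derivation.map_smul, smul_mul_assoc, smul_sub])
    (fun f g g' => by
      rw [← Finset.sum_add_distrib]; exact Finset.sum_congr rfl fun i _ => by simp only [map_add]; ring)
    (fun c f g => by
      rw [Finset.smul_sum]; exact Finset.sum_congr rfl fun i _ => by
        simp only [Derivation.map_smul, mul_smul_comm, smul_sub])

theorem bracket_apply (f g : FPS n) : bracket f g = ∑ i, (pderiv ℂ (.inl i) f * pderiv ℂ (.inr i) g
      - pderiv ℂ (.inr i) f * pderiv ℂ (.inl i) g) := rfl

/-- The coefficient at `m` pairs coefficients of `f` and `g` at exponents with sum `m + q_i + p_i`,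
of total weight at most `W m + c`; one of the two is therefore below its threshold. Used with `c =
2` for the degree and `c = 1` for `pairCount`. -/
theorem bracket_mem_weightGE {W : Expo n → ℕ} (hW : ∀ x y, W x + W y ≤ W (x + y)) {c : ℕ}
    (hc : ∀ m i, W (m + Finsupp.single (Sum.inl i) 1 + Finsupp.single (Sum.inr i) 1) ≤ W m + c)
    {a b : ℕ} {f g : FPS n} (hf : f ∈ weightGE W a) (hg : g ∈ weightGE W b) :
    bracket f g ∈ weightGE W (a + b - c) := by
  classical
  intro m hm
  have key : ∀ (i : Fin n) (u v : Fin n ⊕ Fin n),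
      (u = .inl i ∧ v = .inr i) ∨ (u = .inr i ∧ v = .inl i) →
      coeff m (pderiv ℂ u f * pderiv ℂ v g) = 0 := by
    intro i u v huv
    rw [coeff_mul]
    refine Finset.sum_eq_zero fun p hp => ?_
    have hp' := mem_antidiagonal.1 hp
    have h1 := hW (p.1 + Finsupp.single u 1) (p.2 + Finsupp.single v 1)
    have h2 : p.1 + Finsupp.single u 1 + (p.2 + Finsupp.single v 1) =
        m + Finsupp.single (Sum.inl i) 1 + Finsupp.single (Sum.inr i) 1 := by
      rw [← hp']; rcases huv with ⟨rfl, rfl⟩ | ⟨rfl, rfl⟩ <;> abel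
    rw [h2] at h1
    have h3 := hc m i
    rw [coeff_pderiv, coeff_pderiv]
    by_cases h : W (p.1 + Finsupp.single u 1) < a
    · rw [hf _ h, zero_mul, zero_mul]
    · rw [hg (p.2 + Finsupp.single v 1) (by omega), zero_mul, mul_zero]
  rw [bracket_apply, map_sum]
  refine Finset.sum_eq_zero fun i _ => ?_
  rw [map_sub, key i _ _ (.inl ⟨rfl, rfl⟩), key i _ _ (.inr ⟨rfl, rfl⟩), sub_zero]

theorem bracket_mem_ordGE {a b : ℕ} {f g : FPS n} (hf : f ∈ ordGE a) (hg : g ∈ ordGE b) :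
    bracket f g ∈ ordGE (a + b - 2) :=
  bracket_mem_weightGE (fun x y => (map_add Finsupp.degree x y).ge) degree_add_pair hf hg

theorem bracket_mem_pairGE {a b : ℕ} {f g : FPS n} (hf : f ∈ pairGE a) (hg : g ∈ pairGE b) :
    bracket f g ∈ pairGE (a + b - 1) :=
  bracket_mem_weightGE pairCount_add_le pairCount_add_pair hf hg

theorem pderiv_comm (u v : Fin n ⊕ Fin n) (f : FPS n) :
    pderiv ℂ u (pderiv ℂ v f) = pderiv ℂ v (pderiv ℂ u f) := by
  ext m
  simp only [coeff_pderiv, Finsupp.add_apply]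
  by_cases h : u = v
  · rw [h]
  · rw [Finsupp.single_eq_of_ne h, Finsupp.single_eq_of_ne (Ne.symm h), add_right_comm]
    push_cast; ring

theorem bracket_mul (f g G : FPS n) :
    bracket (f * g) G = bracket f G * g + f * bracket g G := by
  simp only [bracket_apply, Finset.sum_mul, Finset.mul_sum, ← Finset.sum_add_distrib]
  refine Finset.sum_congr rfl fun i _ => ?_
  simp only [Derivation.leibniz, smul_eq_mul]
  ring

/-- In the Jacobi identity the summands over (i, j) match only up to exchanging i and j;
symmetrizing and dividing by two reduces it to a pointwise identity. -/
theorem sum_sum_eq_of_add_swap_eq {ι : Type*} [Fintype ι] (A B : ι → ι → FPS n)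
    (h : ∀ i j, A i j + A j i = B i j + B j i) : ∑ i, ∑ j, A i j = ∑ i, ∑ j, B i j := by
  have h2 : ∀ C : ι → ι → FPS n, (2 : ℂ) • ∑ i, ∑ j, C i j = ∑ i, ∑ j, (C i j + C j i) := by
    intro C
    simp only [Finset.sum_add_distrib]
    rw [Finset.sum_comm (f := fun i j => C j i), two_smul]
  refine smul_right_injective (FPS n) (two_ne_zero (α := ℂ)) ?_
  simp only [h2, h]

theorem bracket_bracket (f g G : FPS n) :
    bracket (bracket f g) G = bracket (bracket f G) g + bracket f (bracket g G) := by
  simp only [bracket_apply]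
  simp only [map_sum, Finset.sum_mul, Finset.mul_sum, ← Finset.sum_add_distrib,
    ← Finset.sum_sub_distrib, map_sub, Derivation.leibniz, smul_eq_mul]
  refine sum_sum_eq_of_add_swap_eq (ι := Fin n) _ _ fun i j => ?_
  simp only [pderiv_comm (Sum.inr j) (.inl i), pderiv_comm (Sum.inr i) (.inl j),
    pderiv_comm (Sum.inr j) (.inr i), pderiv_comm (Sum.inl j) (.inl i)]
  ring

/-! ### Limits of linear maps in the order topology -/

/-- The limit of a sequence of linear maps whose consecutive terms agree to increasing order. -/
def limMap (S : ℕ → FPS n →ₗ[ℂ] FPS n) : FPS n →ₗ[ℂ] FPS n where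
  toFun f := fun m => coeff m (S (m.degree + 1) f)
  map_add' f g := by ext m; simp only [map_add]; rfl
  map_smul' c f := by ext m; simp only [map_smul]; rfl

/-- Consecutive terms of the sequence agree to increasing order. -/
def OrdCauchy (S : ℕ → FPS n →ₗ[ℂ] FPS n) : Prop := ∀ N f, S (N + 1) f - S N f ∈ ordGE N

theorem OrdCauchy.coeff_eq {S : ℕ → FPS n →ₗ[ℂ] FPS n} (hS : OrdCauchy S) (f : FPS n)
    {m : Expo n} {N : ℕ} (h : m.degree < N) : coeff m (limMap S f) = coeff m (S N f) := by
  induction N, h using Nat.le_induction with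
  | base => rfl
  | succ N hN ih =>
    have := hS N f m hN
    rw [map_sub, sub_eq_zero] at this
    rw [ih, this]

theorem OrdCauchy.sub_mem {S : ℕ → FPS n →ₗ[ℂ] FPS n} (hS : OrdCauchy S) (f : FPS n) (N : ℕ) :
    limMap S f - S N f ∈ ordGE N := fun m hm => by
  rw [map_sub, hS.coeff_eq f hm, sub_self]

/-- A bilinear operation that lowers the total order by at most two. -/
def OrdBilin (B : FPS n →ₗ[ℂ] FPS n →ₗ[ℂ] FPS n) : Prop :=
  ∀ a b f g, f ∈ ordGE a → g ∈ ordGE b → B f g ∈ ordGE (a + b - 2)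

theorem ordBilin_bracket : OrdBilin (bracket (n := n)) := fun _ _ _ _ hf hg =>
  bracket_mem_ordGE hf hg

theorem ordBilin_mul : OrdBilin (LinearMap.mul ℂ (FPS n)) := fun _ _ _ _ hf hg =>
  weightGE_mono (Nat.sub_le _ _) (mul_mem_ordGE hf hg)

/-- The truncation errors and the defect of `S N` have orders growing with `N`, even after the loss
of two caused by `B`; with `N = k + 2` the difference has order at least `k`, for every `k`. -/
theorem OrdCauchy.map_bilin {S : ℕ → FPS n →ₗ[ℂ] FPS n} (hS : OrdCauchy S)
    {B : FPS n →ₗ[ℂ] FPS n →ₗ[ℂ] FPS n} (hB : OrdBilin B)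
    (h : ∀ N f g, S N (B f g) - B (S N f) (S N g) ∈ ordGE (N - 2)) (f g : FPS n) :
    limMap S (B f g) = B (limMap S f) (limMap S g) := by
  rw [← sub_eq_zero]
  refine eq_zero_of_forall_mem_ordGE fun k => ?_
  have e : limMap S (B f g) - B (limMap S f) (limMap S g) =
      (limMap S (B f g) - S (k + 2) (B f g))
      + (S (k + 2) (B f g) - B (S (k + 2) f) (S (k + 2) g))
      - (B (limMap S f - S (k + 2) f) (limMap S g)
        + B (S (k + 2) f) (limMap S g - S (k + 2) g)) := by
    simp only [map_sub, LinearMap.sub_apply]; abel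
  rw [e]
  refine Submodule.sub_mem _ (Submodule.add_mem _ ?_ (weightGE_mono (by omega) (h (k + 2) f g)))
    (Submodule.add_mem _ ?_ ?_)
  · exact weightGE_mono (by omega) (hS.sub_mem _ (k + 2))
  · exact hB (k + 2) 0 _ _ (hS.sub_mem _ _) (mem_weightGE_zero _)
  · exact weightGE_mono (by omega) (hB 0 (k + 2) _ _ (mem_weightGE_zero _) (hS.sub_mem _ _))

/-! ### Lie series -/

/-- Bracket with a fixed Hamiltonian on the right. -/
def ad (G : FPS n) : Module.End ℂ (FPS n) := bracket.flip G

theorem ad_apply (G f : FPS n) : ad G f = bracket f G := rfl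

/-- Partial sums of the Lie series of `G`. -/
def lieSum (G : FPS n) (N : ℕ) : FPS n →ₗ[ℂ] FPS n :=
  ∑ k ∈ Finset.range N, ((k.factorial : ℂ)⁻¹) • (ad G ^ k)

theorem lieSum_apply (G : FPS n) (N : ℕ) (f : FPS n) :
    lieSum G N f = ∑ k ∈ Finset.range N, ((k.factorial : ℂ)⁻¹) • (ad G ^ k) f := by
  simp [lieSum, LinearMap.sum_apply]

/-- The Lie series of `G`. -/
def lieExp (G : FPS n) : FPS n →ₗ[ℂ] FPS n := limMap (lieSum G)

theorem ad_pow_mem {G : FPS n} {l : ℕ} (hG : G ∈ ordGE (l + 2)) {a : ℕ} {f : FPS n}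
    (hf : f ∈ ordGE a) (k : ℕ) : (ad G ^ k) f ∈ ordGE (a + k * l) := by
  induction k with
  | zero => simpa using hf
  | succ k ih =>
    rw [pow_succ', Module.End.mul_apply, ad_apply]
    exact weightGE_mono (by rw [Nat.succ_mul]; omega) (bracket_mem_ordGE ih hG)

theorem ordCauchy_lieSum {G : FPS n} (hG : G ∈ ordGE 3) : OrdCauchy (lieSum G) := by
  intro N f
  rw [lieSum_apply, lieSum_apply, Finset.sum_range_succ, add_sub_cancel_left]
  refine Submodule.smul_mem _ _ ?_
  simpa using ad_pow_mem (l := 1) hG (mem_weightGE_zero f) N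

/-- Leibniz rule for divided powers: the factorials absorb the binomial coefficients, which is why
the exponential of a derivation respects `B`. It serves for both the product and the bracket. -/
theorem ad_pow_bilin {G : FPS n} {B : FPS n →ₗ[ℂ] FPS n →ₗ[ℂ] FPS n}
    (hD : ∀ f g, ad G (B f g) = B (ad G f) g + B f (ad G g)) (k : ℕ) (f g : FPS n) :
    ((k.factorial : ℂ)⁻¹) • (ad G ^ k) (B f g) = ∑ p ∈ antidiagonal k,
      B (((p.1.factorial : ℂ)⁻¹) • (ad G ^ p.1) f) (((p.2.factorial : ℂ)⁻¹) • (ad G ^ p.2) g) := by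
  have h1 : (ad G ^ k) (B f g) = ∑ p ∈ antidiagonal k,
      (k.choose p.1 : ℂ) • B ((ad G ^ p.1) f) ((ad G ^ p.2) g) := by
    induction k with
    | zero => simp
    | succ k ih =>
      rw [pow_succ', Module.End.mul_apply, ih, map_sum]
      have hs : ∀ i (x : FPS n), ad G ((ad G ^ i) x) = (ad G ^ (i + 1)) x := fun i x => by
        rw [pow_succ', Module.End.mul_apply]
      simp only [map_smul, hD, hs, smul_add]
      have := Finset.sum_antidiagonal_choose_succ_nsmul
        (fun i j => B ((ad G ^ i) f) ((ad G ^ j) g)) k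
      simp only [← Nat.cast_smul_eq_nsmul ℂ] at this
      rw [this, Finset.sum_add_distrib, add_comm]
      congr 1
      refine Finset.sum_congr rfl fun p hp => ?_
      rw [← mem_antidiagonal.1 hp, Nat.choose_symm_add]
  rw [h1, Finset.smul_sum]
  refine Finset.sum_congr rfl fun p hp => ?_
  simp only [map_smul, LinearMap.smul_apply, smul_smul]
  congr 1
  rw [← mem_antidiagonal.1 hp, ← Nat.add_choose_mul_factorial_mul_factorial p.1 p.2]
  have := Nat.factorial_ne_zero p.1
  have := Nat.factorial_ne_zero p.2
  have := (Nat.choose_pos (Nat.le_add_left p.2 p.1)).ne'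
  push_cast
  field_simp
  rw [Nat.choose_symm_add]

/-- At level N the left side sums `t i j` over the triangle i + j < N, the right side over the
square i, j < N. The remaining terms have i + j ≥ N, hence order at least N - 2, because each
bracket with `G` raises the order by one. -/
theorem lieExp_bilin {G : FPS n} (hG : G ∈ ordGE 3) {B : FPS n →ₗ[ℂ] FPS n →ₗ[ℂ] FPS n}
    (hB : OrdBilin B) (hD : ∀ f g, ad G (B f g) = B (ad G f) g + B f (ad G g)) (f g : FPS n) :
    lieExp G (B f g) = B (lieExp G f) (lieExp G g) := by
  refine (ordCauchy_lieSum hG).map_bilin hB (fun N f g => ?_) f g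
  set t : ℕ → ℕ → FPS n := fun i j =>
    B (((i.factorial : ℂ)⁻¹) • (ad G ^ i) f) (((j.factorial : ℂ)⁻¹) • (ad G ^ j) g) with ht
  have h1 : lieSum G N (B f g) =
      ∑ p ∈ (Finset.range N ×ˢ Finset.range N).filter (fun p => p.1 + p.2 < N), t p.1 p.2 := by
    rw [lieSum_apply]
    simp only [ad_pow_bilin hD]
    rw [Finset.sum_sigma']
    refine Finset.sum_bij' (fun x _ => x.2) (fun p _ => ⟨p.1 + p.2, p⟩) ?_ ?_ ?_ ?_ ?_
    · rintro ⟨k, p⟩ h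
      simp only [Finset.mem_sigma, Finset.mem_range, mem_antidiagonal] at h
      simp only [Finset.mem_filter, Finset.mem_product, Finset.mem_range]; omega
    · rintro p h
      simp only [Finset.mem_filter, Finset.mem_product, Finset.mem_range] at h
      simp only [Finset.mem_sigma, Finset.mem_range, mem_antidiagonal, and_true]; omega
    · rintro ⟨k, p⟩ h
      simp only [Finset.mem_sigma, Finset.mem_range, mem_antidiagonal] at h
      obtain ⟨-, rfl⟩ := h; rfl
    · intros; rfl
    · intros; rfl
  have h2 : B (lieSum G N f) (lieSum G N g) =
      ∑ p ∈ Finset.range N ×ˢ Finset.range N, t p.1 p.2 := by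
    rw [lieSum_apply, lieSum_apply, Finset.sum_product, LinearMap.map_sum₂]
    exact Finset.sum_congr rfl fun i _ => map_sum _ _ _
  rw [h1, h2, ← Finset.sum_filter_add_sum_filter_not (Finset.range N ×ˢ Finset.range N)
    (fun p => p.1 + p.2 < N), sub_add_cancel_left]
  refine neg_mem (sum_mem fun p hp => ?_)
  have hp2 := (Finset.mem_filter.1 hp).2
  refine weightGE_mono (by omega) (hB p.1 p.2 _ _ (Submodule.smul_mem _ _ ?_)
    (Submodule.smul_mem _ _ ?_))
  · simpa using ad_pow_mem (l := 1) hG (mem_weightGE_zero f) p.1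
  · simpa using ad_pow_mem (l := 1) hG (mem_weightGE_zero g) p.2

theorem lieExp_mul {G : FPS n} (hG : G ∈ ordGE 3) (f g : FPS n) :
    lieExp G (f * g) = lieExp G f * lieExp G g :=
  lieExp_bilin hG ordBilin_mul (fun f g => bracket_mul f g G) f g

theorem lieExp_bracket {G : FPS n} (hG : G ∈ ordGE 3) (f g : FPS n) :
    lieExp G (bracket f g) = bracket (lieExp G f) (lieExp G g) :=
  lieExp_bilin hG ordBilin_bracket (fun f g => bracket_bracket f g G) f g

end FPS

end

noncomputable section

namespace FPS

open MvPowerSeries Finset.HasAntidiagonal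
open scoped NNReal ENNReal

variable {n : ℕ}

/-! ### Weighted `ℓ¹` norms -/

/-- The `ℓ¹` norm of the coefficients, weighted by powers of a radius. -/
def wnorm (r : ℝ≥0) (f : FPS n) : ℝ≥0∞ := ∑' m, ‖coeff m f‖ₑ * (r : ℝ≥0∞) ^ m.degree

theorem wnorm_le_of_coeff {r s : ℝ≥0} {f g : FPS n} {c d : ℝ≥0}
    (h : ∀ m, ‖coeff m f‖₊ * r ^ m.degree * c ≤ d * (‖coeff m g‖₊ * s ^ m.degree)) :
    wnorm r f * c ≤ d * wnorm s g := by
  rw [wnorm, wnorm, ← ENNReal.tsum_mul_right, ← ENNReal.tsum_mul_left]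
  refine ENNReal.tsum_le_tsum fun m => ?_
  have := ENNReal.coe_le_coe.2 (h m)
  push_cast at this
  exact this

theorem wnorm_mono {r s : ℝ≥0} (h : r ≤ s) (f : FPS n) : wnorm r f ≤ wnorm s f :=
  ENNReal.tsum_le_tsum fun m => by gcongr

theorem wnorm_zero (r : ℝ≥0) : wnorm r (0 : FPS n) = 0 := by simp [wnorm]

theorem wnorm_neg (r : ℝ≥0) (f : FPS n) : wnorm r (-f) = wnorm r f := by simp [wnorm]

theorem wnorm_add_le (r : ℝ≥0) (f g : FPS n) : wnorm r (f + g) ≤ wnorm r f + wnorm r g := by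
  rw [wnorm, wnorm, wnorm, ← ENNReal.tsum_add]
  refine ENNReal.tsum_le_tsum fun m => ?_
  rw [map_add, ← add_mul]
  gcongr
  exact enorm_add_le _ _

theorem wnorm_sub_le (r : ℝ≥0) (f g : FPS n) : wnorm r (f - g) ≤ wnorm r f + wnorm r g := by
  rw [sub_eq_add_neg, ← wnorm_neg r g]; exact wnorm_add_le r f (-g)

theorem wnorm_sum_le {ι : Type*} (r : ℝ≥0) (s : Finset ι) (f : ι → FPS n) :
    wnorm r (∑ i ∈ s, f i) ≤ ∑ i ∈ s, wnorm r (f i) :=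
  Finset.le_sum_of_subadditive _ (wnorm_zero r).le (wnorm_add_le r) s f

theorem wnorm_smul (r : ℝ≥0) (c : ℂ) (f : FPS n) : wnorm r (c • f) = ‖c‖ₑ * wnorm r f := by
  rw [wnorm, wnorm, ← ENNReal.tsum_mul_left]
  simp only [coeff_smul, enorm_mul, mul_assoc]

theorem wnorm_mul_le (r : ℝ≥0) (f g : FPS n) : wnorm r (f * g) ≤ wnorm r f * wnorm r g := by
  classical
  have h : wnorm r f * wnorm r g = ∑' m : Expo n, ∑ p ∈ antidiagonal m,
      (‖coeff p.1 f‖ₑ * (r : ℝ≥0∞) ^ p.1.degree) * (‖coeff p.2 g‖ₑ * (r : ℝ≥0∞) ^ p.2.degree) := by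
    rw [wnorm, wnorm, ← ENNReal.tsum_mul_right]
    simp only [← ENNReal.tsum_mul_left]
    rw [← ENNReal.tsum_prod' (f := fun p : Expo n × Expo n =>
      (‖coeff p.1 f‖ₑ * (r : ℝ≥0∞) ^ p.1.degree) * (‖coeff p.2 g‖ₑ * (r : ℝ≥0∞) ^ p.2.degree)),
      ← Finset.HasAntidiagonal.sigmaAntidiagonalEquivProd.tsum_eq, ENNReal.tsum_sigma']
    refine tsum_congr fun m => ?_
    rw [tsum_fintype, Finset.univ_eq_attach, ← Finset.sum_attach (antidiagonal m)]
    rfl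
  rw [h]
  refine ENNReal.tsum_le_tsum fun m => ?_
  rw [coeff_mul]
  refine (mul_le_mul_left (enorm_sum_le _ _) _).trans ?_
  rw [Finset.sum_mul]
  refine Finset.sum_le_sum fun p hp => le_of_eq ?_
  rw [← mem_antidiagonal.1 hp, map_add, pow_add, enorm_mul]
  ring

/-- The left side is a single term of the binomial expansion of the right side. It gives the Cauchy
estimate for derivatives with constant one. -/
theorem succ_mul_pow_mul_le (r d : ℝ≥0) (k : ℕ) :
    ((k : ℝ≥0) + 1) * r ^ k * d ≤ (r + d) ^ (k + 1) := by
  induction k with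
  | zero => simp
  | succ k ih =>
    have h1 : r ^ (k + 1) ≤ (r + d) ^ (k + 1) := by gcongr; exact le_self_add
    calc (((k + 1 : ℕ) : ℝ≥0) + 1) * r ^ (k + 1) * d
        = (((k : ℝ≥0) + 1) * r ^ k * d) * r + r ^ (k + 1) * d := by push_cast; ring
      _ ≤ (r + d) ^ (k + 1) * r + (r + d) ^ (k + 1) * d := by gcongr
      _ = _ := by ring

theorem wnorm_pderiv_mul_le (r d : ℝ≥0) (u : Fin n ⊕ Fin n) (f : FPS n) :
    wnorm r (pderiv ℂ u f) * d ≤ wnorm (r + d) f := by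
  have hinj : Function.Injective fun m : Expo n => m + Finsupp.single u 1 :=
    add_left_injective _
  refine le_trans ?_ (ENNReal.tsum_comp_le_tsum_of_injective hinj _)
  rw [wnorm, ← ENNReal.tsum_mul_right]
  refine ENNReal.tsum_le_tsum fun m => ?_
  rw [coeff_pderiv, map_add, Finsupp.degree_single, enorm_mul]
  have h1 : ‖((m u : ℂ) + 1)‖ₑ ≤ ((m.degree : ℝ≥0) + 1 : ℝ≥0) := by
    have : ((m u : ℂ) + 1) = ((m u + 1 : ℕ) : ℂ) := by push_cast; ring
    rw [this, enorm_eq_nnnorm, ENNReal.coe_le_coe, Complex.nnnorm_natCast]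
    push_cast
    gcongr
    exact Finsupp.le_degree u m
  have h2 := ENNReal.coe_le_coe.2 (succ_mul_pow_mul_le r d m.degree)
  calc _ ≤ ‖coeff (m + Finsupp.single u 1) f‖ₑ * ((m.degree : ℝ≥0) + 1 : ℝ≥0)
        * (r : ℝ≥0∞) ^ m.degree * d := by gcongr
    _ = ‖coeff (m + Finsupp.single u 1) f‖ₑ *
        ((((m.degree : ℝ≥0) + 1) * r ^ m.degree * d : ℝ≥0) : ℝ≥0∞) := by push_cast; ring
    _ ≤ _ := by push_cast at h2 ⊢; gcongr

theorem wnorm_bracket_mul_le {r h M : ℝ≥0} {G : FPS n} (hG : ∀ u, wnorm r (pderiv ℂ u G) ≤ M)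
    (f : FPS n) : wnorm r (bracket f G) * h ≤ (2 * n * M : ℝ≥0) * wnorm (r + h) f := by
  have key : ∀ u v, wnorm r (pderiv ℂ u f * pderiv ℂ v G) * h ≤ wnorm (r + h) f * M := by
    intro u v
    calc _ ≤ wnorm r (pderiv ℂ u f) * wnorm r (pderiv ℂ v G) * h := by
            gcongr; exact wnorm_mul_le _ _ _
      _ = (wnorm r (pderiv ℂ u f) * h) * wnorm r (pderiv ℂ v G) := by ring
      _ ≤ _ := by gcongr; exacts [wnorm_pderiv_mul_le _ _ _ _, hG v]
  rw [bracket_apply]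
  calc _ ≤ (∑ i : Fin n, (wnorm r (pderiv ℂ (.inl i) f * pderiv ℂ (.inr i) G)
            + wnorm r (pderiv ℂ (.inr i) f * pderiv ℂ (.inl i) G))) * h := by
          gcongr
          refine (wnorm_sum_le _ _ _).trans (Finset.sum_le_sum fun i _ => wnorm_sub_le _ _ _)
    _ ≤ ∑ i : Fin n, (wnorm (r + h) f * M + wnorm (r + h) f * M) := by
          rw [Finset.sum_mul]
          refine Finset.sum_le_sum fun i _ => ?_
          rw [add_mul]
          exact add_le_add (key _ _) (key _ _)
    _ = _ := by
          rw [Finset.sum_const, Finset.card_univ, Fintype.card_fin, nsmul_eq_mul]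
          push_cast; ring

/-! ### Estimates of Lie series -/

/-- Each bracket loses `h` of radius, the outermost one first. Only `f` is moved to larger radii;
the derivatives of `G` are bounded once and for all at `ρ`. The losses stay as factors on the left
to avoid division of extended reals. -/
theorem wnorm_ad_pow_mul_le {ρ h M : ℝ≥0} {G : FPS n} (hG : ∀ u, wnorm ρ (pderiv ℂ u G) ≤ M)
    (f : FPS n) (k : ℕ) (r : ℝ≥0) (hr : r + k * h ≤ ρ) :
    wnorm r ((ad G ^ k) f) * (h : ℝ≥0∞) ^ k ≤ ((2 * n * M : ℝ≥0) : ℝ≥0∞) ^ k * wnorm (r + k * h) f := by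
  induction k generalizing r with
  | zero => simp
  | succ k ih =>
    have e : r + h + k * h = r + (k + 1 : ℕ) * h := by push_cast; ring
    have hr' : r ≤ ρ := le_self_add.trans hr
    rw [pow_succ', Module.End.mul_apply, ad_apply]
    calc _ = (wnorm r (bracket ((ad G ^ k) f) G) * h) * (h : ℝ≥0∞) ^ k := by ring
      _ ≤ ((2 * n * M : ℝ≥0) * wnorm (r + h) ((ad G ^ k) f)) * (h : ℝ≥0∞) ^ k := by
          exact mul_le_mul_left
            (wnorm_bracket_mul_le (fun u => (wnorm_mono hr' _).trans (hG u)) _) _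
      _ = (2 * n * M : ℝ≥0) * (wnorm (r + h) ((ad G ^ k) f) * (h : ℝ≥0∞) ^ k) := by ring
      _ ≤ (2 * n * M : ℝ≥0) * (((2 * n * M : ℝ≥0) : ℝ≥0∞) ^ k * wnorm (r + h + k * h) f) := by
          exact mul_le_mul_right (ih (r + h) (e ▸ hr)) _
      _ = _ := by rw [e]; ring

theorem pow_self_le_three_pow_mul_factorial (k : ℕ) :
    (k : ℝ≥0) ^ k ≤ 3 ^ k * (k.factorial : ℝ≥0) := by
  have h1 := Real.pow_div_factorial_le_exp (k : ℝ) (Nat.cast_nonneg k) k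
  have h2 : Real.exp k ≤ 3 ^ k := by
    rw [← Real.exp_one_pow]
    exact pow_le_pow_left₀ (Real.exp_pos 1).le (Real.exp_one_lt_d9.le.trans (by norm_num)) k
  rw [div_le_iff₀ (by positivity)] at h1
  have h3 : (k : ℝ) ^ k ≤ 3 ^ k * (k.factorial : ℝ) := h1.trans (by gcongr)
  exact_mod_cast h3

/-- Sharing the loss `d` equally among the k brackets gives the factor (2nMk/d)^k / k!, and k^k ≤
3^k k! turns it into (6nM/d)^k. -/
theorem wnorm_lie_term_le {r d M θ : ℝ≥0} (hd : 0 < d) {G : FPS n}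
    (hG : ∀ u, wnorm (r + d) (pderiv ℂ u G) ≤ M) (hθ : 6 * n * M ≤ θ * d) (f : FPS n) (k : ℕ) :
    wnorm r (((k.factorial : ℂ)⁻¹) • (ad G ^ k) f) ≤ (θ : ℝ≥0∞) ^ k * wnorm (r + d) f := by
  -- For k = 0 the share `d / k` would be the default value 0.
  rcases Nat.eq_zero_or_pos k with rfl | hk
  · simpa using wnorm_mono le_self_add f
  have hk' : (k : ℝ≥0) ≠ 0 := by exact_mod_cast hk.ne'
  have hkd : (k : ℝ≥0) * (d / k) = d := by field_simp
  have h1 := wnorm_ad_pow_mul_le (h := d / k) hG f k r (by rw [hkd])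
  rw [hkd] at h1
  have hf : (k.factorial : ℝ≥0) ≠ 0 := by exact_mod_cast k.factorial_ne_zero
  have hdk : (d / k) ^ k ≠ 0 := pow_ne_zero _ (div_ne_zero hd.ne' hk')
  have h2 : (2 * n * M) ^ k ≤ θ ^ k * (k.factorial : ℝ≥0) * (d / k) ^ k := by
    have h3 : (2 * n * M) ^ k * (k : ℝ≥0) ^ k ≤ θ ^ k * (k.factorial : ℝ≥0) * d ^ k := by
      calc (2 * n * M) ^ k * (k : ℝ≥0) ^ k ≤ (2 * n * M) ^ k * (3 ^ k * (k.factorial : ℝ≥0)) := by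
            gcongr; exact pow_self_le_three_pow_mul_factorial k
        _ = (6 * n * M) ^ k * (k.factorial : ℝ≥0) := by
            rw [← mul_assoc, ← mul_pow]; congr 2; ring
        _ ≤ (θ * d) ^ k * (k.factorial : ℝ≥0) := by gcongr
        _ = _ := by rw [mul_pow]; ring
    rw [div_pow, ← mul_div_assoc, le_div_iff₀ (by positivity)]
    exact h3
  have e1 : ‖((k.factorial : ℂ)⁻¹)‖ₑ = (((k.factorial : ℝ≥0)⁻¹ : ℝ≥0) : ℝ≥0∞) := by
    rw [enorm_eq_nnnorm, nnnorm_inv, Complex.nnnorm_natCast]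
  rw [wnorm_smul, e1]
  have h4 : wnorm r ((ad G ^ k) f) * (((d / k) ^ k : ℝ≥0) : ℝ≥0∞) ≤
      ((θ ^ k * (k.factorial : ℝ≥0) : ℝ≥0) : ℝ≥0∞) * wnorm (r + d) f * (((d / k) ^ k : ℝ≥0) : ℝ≥0∞) := by
    have h2' := ENNReal.coe_le_coe.2 h2
    calc _ ≤ (((2 * n * M) ^ k : ℝ≥0) : ℝ≥0∞) * wnorm (r + d) f := by
          rw [ENNReal.coe_pow, ENNReal.coe_pow]; exact h1
      _ ≤ ((θ ^ k * (k.factorial : ℝ≥0) * (d / k) ^ k : ℝ≥0) : ℝ≥0∞) * wnorm (r + d) f := by gcongr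
      _ = _ := by rw [ENNReal.coe_mul (θ ^ k * (k.factorial : ℝ≥0))]; ring
  have h5 := (ENNReal.mul_le_mul_iff_left (ENNReal.coe_ne_zero.2 hdk) ENNReal.coe_ne_top).1 h4
  calc _ ≤ (((k.factorial : ℝ≥0)⁻¹ : ℝ≥0) : ℝ≥0∞) *
        (((θ ^ k * (k.factorial : ℝ≥0) : ℝ≥0) : ℝ≥0∞) * wnorm (r + d) f) := by gcongr
    _ = (((k.factorial : ℝ≥0)⁻¹ * (θ ^ k * (k.factorial : ℝ≥0)) : ℝ≥0) : ℝ≥0∞) * wnorm (r + d) f := by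
        rw [ENNReal.coe_mul (_⁻¹)]; ring
    _ = _ := by
        congr 1
        rw [mul_comm (θ ^ k), inv_mul_cancel_left₀ hf, ENNReal.coe_pow]

/-- A Fatou argument: any finite set of coefficients of the limit already occurs in some `S N f`, so
a uniform bound passes to the limit. -/
theorem OrdCauchy.wnorm_sub_le {S : ℕ → FPS n →ₗ[ℂ] FPS n} (hS : OrdCauchy S) {r : ℝ≥0}
    {f g : FPS n} {C : ℝ≥0∞} {N₀ : ℕ} (h : ∀ N, N₀ ≤ N → wnorm r (S N f - g) ≤ C) :
    wnorm r (limMap S f - g) ≤ C := by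
  rw [wnorm, ENNReal.tsum_eq_iSup_sum]
  refine iSup_le fun s => ?_
  obtain ⟨N, hN⟩ : ∃ N, N₀ ≤ N ∧ ∀ m ∈ s, m.degree < N :=
    ⟨max N₀ (s.sup (fun m => m.degree + 1)), le_max_left _ _, fun m hm =>
      (Nat.lt_succ_self _).trans_le (le_max_of_le_right (Finset.le_sup (f := fun m : Expo n => m.degree + 1) hm))⟩
  refine le_trans ?_ ((ENNReal.sum_le_tsum s).trans (h N hN.1))
  refine Finset.sum_le_sum fun m hm => ?_
  rw [map_sub, map_sub, hS.coeff_eq f (hN.2 m hm)]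

/-- The tail is dominated by a geometric series of ratio θ ≤ 1/2, whence the factor 2. -/
theorem wnorm_lieExp_sub_lieSum_le {r d M θ : ℝ≥0} (hd : 0 < d) {G : FPS n} (h3 : G ∈ ordGE 3)
    (hG : ∀ u, wnorm (r + d) (pderiv ℂ u G) ≤ M) (hθ : 6 * n * M ≤ θ * d) (hθ2 : 2 * θ ≤ 1)
    (f : FPS n) (j : ℕ) :
    wnorm r (lieExp G f - lieSum G j f) ≤ 2 * (θ : ℝ≥0∞) ^ j * wnorm (r + d) f := by
  refine (ordCauchy_lieSum h3).wnorm_sub_le (N₀ := j) fun N hN => ?_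
  have e : lieSum G N f - lieSum G j f =
      ∑ k ∈ Finset.range (N - j), (((j + k).factorial : ℂ)⁻¹) • (ad G ^ (j + k)) f := by
    rw [lieSum_apply, lieSum_apply, ← Finset.sum_range_add_sum_Ico _ hN, add_sub_cancel_left,
      Finset.sum_Ico_eq_sum_range]
  rw [e]
  refine (wnorm_sum_le _ _ _).trans ((Finset.sum_le_sum fun k _ =>
    wnorm_lie_term_le hd hG hθ f (j + k)).trans ?_)
  rw [← Finset.sum_mul]
  gcongr
  simp only [pow_add]
  rw [← Finset.mul_sum, mul_comm]
  gcongr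
  have h2 : ∀ K : ℕ, ∑ k ∈ Finset.range K, θ ^ k ≤ 2 := by
    intro K
    induction K with
    | zero => simp
    | succ K ih =>
      rw [Finset.sum_range_succ']
      simp only [pow_succ, ← Finset.sum_mul, pow_zero]
      calc (∑ k ∈ Finset.range K, θ ^ k) * θ + 1 ≤ 2 * θ + 1 := by gcongr
        _ ≤ 1 + 1 := by gcongr
        _ = 2 := by norm_num
  have := ENNReal.coe_le_coe.2 (h2 (N - j))
  push_cast at this
  exact this

/-! ### The homological equation -/

/-- The quadratic Hamiltonian as a formal power series. -/
def formalH (lam : Fin n → ℂ) : FPS n := ∑ i, lam i • (X (.inl i) * X (.inr i))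

/-- The eigenvalue of a monomial under the bracket with the quadratic Hamiltonian. -/
def divisor (lam : Fin n → ℂ) (m : Expo n) : ℂ :=
  ∑ i, lam i * ((m (.inr i) : ℂ) - (m (.inl i) : ℂ))

theorem coeff_X_mul_pderiv (u : Fin n ⊕ Fin n) (f : FPS n) (m : Expo n) :
    coeff m (X u * pderiv ℂ u f) = m u * coeff m f := by
  classical
  rw [X_def, coeff_monomial_mul]
  split_ifs with h
  · have h1 : 1 ≤ m u := by simpa using h u
    rw [one_mul, coeff_pderiv, tsub_add_cancel_of_le h, mul_comm]
    congr 1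
    rw [Finsupp.tsub_apply, Finsupp.single_eq_same, Nat.cast_sub h1]
    simp
  · have : m u = 0 := by
      by_contra h0
      refine h fun v => ?_
      rw [Finsupp.single_apply]
      split_ifs with hv
      · subst hv; omega
      · exact Nat.zero_le _
    simp [this]

theorem pderiv_inl_formalH (lam : Fin n → ℂ) (j : Fin n) :
    pderiv ℂ (.inl j) (formalH lam) = lam j • X (.inr j) := by
  classical
  simp only [formalH, map_sum, Derivation.map_smul, Derivation.leibniz, smul_eq_mul]
  rw [Finset.sum_eq_single j]
  · simp
  · intro i _ hi
    rw [pderiv_X_of_ne (by simp), pderiv_X_of_ne (fun h => hi (Sum.inl_injective h))]; simp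
  · simp

theorem pderiv_inr_formalH (lam : Fin n → ℂ) (j : Fin n) :
    pderiv ℂ (.inr j) (formalH lam) = lam j • X (.inl j) := by
  classical
  simp only [formalH, map_sum, Derivation.map_smul, Derivation.leibniz, smul_eq_mul]
  rw [Finset.sum_eq_single j]
  · simp
  · intro i _ hi
    rw [pderiv_X_of_ne (fun h => hi (Sum.inr_injective h)), pderiv_X_of_ne (by simp)]; simp
  · simp

theorem coeff_bracket_formalH (lam : Fin n → ℂ) (f : FPS n) (m : Expo n) :
    coeff m (bracket (formalH lam) f) = divisor lam m * coeff m f := by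
  simp only [bracket_apply, pderiv_inl_formalH, pderiv_inr_formalH, map_sum, map_sub,
    smul_mul_assoc, coeff_smul, coeff_X_mul_pderiv, divisor, Finset.sum_mul]
  exact Finset.sum_congr rfl fun i _ => by ring

theorem formalH_mem_ordGE (lam : Fin n → ℂ) : formalH lam ∈ ordGE 2 := by
  have hX : ∀ u : Fin n ⊕ Fin n, (X u : FPS n) ∈ ordGE 1 := by
    classical
    intro u m hm
    have : m = 0 := (Finsupp.degree_eq_zero_iff m).1 (by omega)
    rw [this, coeff_zero_X]
  exact Submodule.sum_mem _ fun i _ => Submodule.smul_mem _ _ (mul_mem_ordGE (hX _) (hX _))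

/-- Solution of the homological equation on the monomials `m` with `pairCount m = k`. -/
def hsolve (lam : Fin n → ℂ) (k : ℕ) (f : FPS n) : FPS n := fun m =>
  if pairCount m = k then -(coeff m f / divisor lam m) else 0

theorem coeff_hsolve (lam : Fin n → ℂ) (k : ℕ) (f : FPS n) (m : Expo n) :
    coeff m (hsolve lam k f) = if pairCount m = k then -(coeff m f / divisor lam m) else 0 := rfl

theorem hsolve_mem_pairGE (lam : Fin n → ℂ) (k : ℕ) (f : FPS n) : hsolve lam k f ∈ pairGE k :=
  fun m hm => by rw [coeff_hsolve, if_neg hm.ne]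

theorem hsolve_mem_ordGE (lam : Fin n → ℂ) (k l : ℕ) {f : FPS n} (hf : f ∈ ordGE l) :
    hsolve lam k f ∈ ordGE l := fun m hm => by
  rw [coeff_hsolve, hf m hm]; simp

/-- A monomial with equal exponents of q_i and p_i for all i has degree `2 * pairCount`, here at
most 2. The others give a non-zero integer vector of ℓ¹ norm at most the degree. -/
theorem exists_divisor_bound {lam : Fin n → ℂ} (hlam : IsDiophantine lam) :
    ∃ C : ℝ, 0 < C ∧ ∃ τ : ℕ, ∀ m : Expo n, 3 ≤ m.degree → pairCount m ≤ 1 →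
      C ≤ ‖divisor lam m‖ * (m.degree : ℝ) ^ τ := by
  obtain ⟨C, hC, τ, h⟩ := hlam
  refine ⟨C, hC, τ, fun m hm hp => ?_⟩
  set i : Fin n → ℤ := fun j => (m (.inr j) : ℤ) - (m (.inl j) : ℤ) with hi
  have hi0 : i ≠ 0 := by
    intro h0
    have h1 : ∀ j, m (.inr j) = m (.inl j) := fun j => by
      have := congrFun h0 j; simp only [hi, Pi.zero_apply] at this; omega
    have h2 : m.degree = 2 * pairCount m := by
      rw [Finsupp.degree_eq_sum, Fintype.sum_sum_type, pairCount]
      simp only [h1, min_self]; ring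
    omega
  have hd : divisor lam m = ∑ j, lam j * (i j : ℂ) := by simp [divisor, hi]
  have hs : ∑ j, |(i j : ℝ)| ≤ m.degree := by
    rw [Finsupp.degree_eq_sum, Fintype.sum_sum_type, Nat.cast_add, Nat.cast_sum, Nat.cast_sum,
      ← Finset.sum_add_distrib]
    refine Finset.sum_le_sum fun j _ => ?_
    simp only [hi]
    push_cast
    refine (abs_sub _ _).trans ?_
    simp [add_comm]
  have hs0 : 0 < ∑ j, |(i j : ℝ)| := by
    obtain ⟨j, hj⟩ := Function.ne_iff.1 hi0
    refine Finset.sum_pos' (fun _ _ => abs_nonneg _) ⟨j, Finset.mem_univ j, ?_⟩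
    exact abs_pos.2 (by exact_mod_cast hj)
  have := h i hi0
  rw [← hd, div_le_iff₀ (by positivity)] at this
  exact this.trans (by gcongr)

/-- A polynomial factor in the degree is paid for by shrinking the radius: (dk)^τ ≤ τ! e^(dk), while
r ≤ (r + d)(1 - d) ≤ (r + d) e^(-d) because r + d ≤ 1. -/
theorem pow_mul_pow_mul_le {r d : ℝ≥0} (h : r + d ≤ 1) (τ k : ℕ) :
    (k : ℝ≥0) ^ τ * r ^ k * d ^ τ ≤ (τ.factorial : ℝ≥0) * (r + d) ^ k := by
  have hd1 : (d : ℝ) ≤ 1 := by exact_mod_cast le_add_self.trans h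
  have h' : (r : ℝ) + d ≤ 1 := by exact_mod_cast h
  have h1 := Real.pow_div_factorial_le_exp ((d : ℝ) * k) (by positivity) τ
  rw [div_le_iff₀ (by positivity)] at h1
  have h2 : (r : ℝ) ≤ (r + d) * Real.exp (-d) := by
    have : (1 : ℝ) - d ≤ Real.exp (-d) := by linarith [Real.add_one_le_exp (-(d : ℝ))]
    calc (r : ℝ) ≤ (r + d) * (1 - d) := by nlinarith [d.coe_nonneg]
      _ ≤ _ := by gcongr
  have h3 : (r : ℝ) ^ k ≤ (r + d) ^ k * Real.exp (-(d * k)) := by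
    refine (pow_le_pow_left₀ r.coe_nonneg h2 k).trans (le_of_eq ?_)
    rw [mul_pow, ← Real.exp_nat_mul]; congr 2; ring
  have h4 : (k : ℝ) ^ τ * (r : ℝ) ^ k * (d : ℝ) ^ τ ≤ (τ.factorial : ℝ) * ((r : ℝ) + d) ^ k := by
    calc (k : ℝ) ^ τ * (r : ℝ) ^ k * (d : ℝ) ^ τ = ((d : ℝ) * k) ^ τ * (r : ℝ) ^ k := by
          rw [mul_pow]; ring
      _ ≤ (Real.exp (d * k) * τ.factorial) * ((r + d) ^ k * Real.exp (-(d * k))) := by gcongr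
      _ = (τ.factorial : ℝ) * ((r : ℝ) + d) ^ k * (Real.exp (d * k) * Real.exp (-(d * k))) := by ring
      _ = _ := by rw [← Real.exp_add]; simp
  exact_mod_cast h4

theorem exists_wnorm_hsolve_le {lam : Fin n → ℂ} (hlam : IsDiophantine lam) :
    ∃ A : ℝ≥0, ∃ τ : ℕ, ∀ (k : ℕ) (r d : ℝ≥0) (f : FPS n), k ≤ 1 → r + d ≤ 1 → f ∈ ordGE 3 →
      wnorm r (hsolve lam k f) * (d ^ τ : ℝ≥0) ≤ A * wnorm (r + d) f := by
  obtain ⟨C, hC, τ, h⟩ := exists_divisor_bound hlam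
  refine ⟨τ.factorial / ⟨C, hC.le⟩, τ, fun k r d f hk hrd hf => wnorm_le_of_coeff fun m => ?_⟩
  rw [coeff_hsolve]
  split_ifs with hm
  · by_cases h3 : m.degree < 3
    · rw [hf m h3]; simp
    have hb := h m (by omega) (by omega)
    set D : ℝ≥0 := ‖divisor lam m‖₊ with hD
    set C' : ℝ≥0 := ⟨C, hC.le⟩ with hC'
    have hC0 : C' ≠ 0 := fun h0 => hC.ne' (congrArg NNReal.toReal h0)
    have hb' : C' ≤ D * (m.degree : ℝ≥0) ^ τ := by exact_mod_cast hb
    have hD0 : D ≠ 0 := by rintro h0; rw [h0, zero_mul] at hb'; exact hC0 (le_zero_iff.1 hb')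
    rw [nnnorm_neg, nnnorm_div, ← hD]
    have hp := pow_mul_pow_mul_le hrd τ m.degree
    have hinv : D⁻¹ ≤ (m.degree : ℝ≥0) ^ τ / C' := by
      rw [le_div_iff₀ (pos_iff_ne_zero.2 hC0), inv_mul_le_iff₀ (pos_iff_ne_zero.2 hD0)]
      exact hb'
    calc ‖coeff m f‖₊ / D * r ^ m.degree * d ^ τ = ‖coeff m f‖₊ * D⁻¹ * r ^ m.degree * d ^ τ := by
          rw [div_eq_mul_inv]
      _ ≤ ‖coeff m f‖₊ * ((m.degree : ℝ≥0) ^ τ / C') * r ^ m.degree * d ^ τ := by gcongr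
      _ = ‖coeff m f‖₊ / C' * ((m.degree : ℝ≥0) ^ τ * r ^ m.degree * d ^ τ) := by
          rw [div_eq_mul_inv, div_eq_mul_inv]; ring
      _ ≤ ‖coeff m f‖₊ / C' * ((τ.factorial : ℝ≥0) * (r + d) ^ m.degree) := by gcongr
      _ = _ := by rw [div_eq_mul_inv, div_eq_mul_inv]; ring
  · simp

end FPS

end

noncomputable section

namespace FPS

open MvPowerSeries Finset.HasAntidiagonal
open scoped NNReal ENNReal

variable {n : ℕ}

/-! ### One step of the iteration -/

theorem le_coe_div_of_mul_le {x : ℝ≥0∞} {y d : ℝ≥0} (hd : 0 < d) (h : x * d ≤ y) :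
    x ≤ ((y / d : ℝ≥0) : ℝ≥0∞) := by
  rw [ENNReal.coe_div hd.ne']
  exact (ENNReal.le_div_iff_mul_le (.inl (ENNReal.coe_ne_zero.2 hd.ne'))
    (.inl ENNReal.coe_ne_top)).2 h

theorem wnorm_pderiv_le {r d g : ℝ≥0} (hd : 0 < d) {G : FPS n} (hG : wnorm (r + d) G ≤ g)
    (u : Fin n ⊕ Fin n) : wnorm r (pderiv ℂ u G) ≤ ((g / d : ℝ≥0) : ℝ≥0∞) :=
  le_coe_div_of_mul_le hd ((wnorm_pderiv_mul_le r d u G).trans hG)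

theorem wnorm_bracket_le {r d g a : ℝ≥0} (hd : 0 < d) {f G : FPS n} (hG : wnorm (r + d) G ≤ g)
    (hf : wnorm (r + d) f ≤ a) :
    wnorm r (bracket f G) ≤ ((2 * n * (g / d) * a / d : ℝ≥0) : ℝ≥0∞) := by
  refine le_coe_div_of_mul_le hd ((wnorm_bracket_mul_le (wnorm_pderiv_le hd hG) f).trans ?_)
  rw [ENNReal.coe_mul _ a]
  gcongr

theorem wnorm_coe_ne_top (r : ℝ≥0) (p : MvPolynomial (Fin n ⊕ Fin n) ℂ) :
    wnorm r (p : FPS n) ≠ ⊤ := by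
  rw [wnorm, tsum_eq_sum (s := p.support) fun m hm => by
    rw [MvPolynomial.coeff_coe, MvPolynomial.notMem_support_iff.1 hm]; simp]
  exact ENNReal.sum_ne_top.2 fun m _ => ENNReal.mul_ne_top enorm_ne_top
    (ENNReal.pow_ne_top ENNReal.coe_ne_top)

theorem wnorm_formalH_ne_top (r : ℝ≥0) (lam : Fin n → ℂ) : wnorm r (formalH lam) ≠ ⊤ := by
  have : formalH lam = ((∑ i, lam i • (MvPolynomial.X (Sum.inl i) * MvPolynomial.X (Sum.inr i)) :
      MvPolynomial (Fin n ⊕ Fin n) ℂ) : FPS n) := by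
    rw [← MvPolynomial.coeToMvPowerSeries.ringHom_apply, map_sum]
    simp [formalH]
  rw [this]
  exact wnorm_coe_ne_top r _

theorem lieExp_sub_lieSum_mem {G : FPS n} {l : ℕ} (hl : 1 ≤ l) (hG : G ∈ ordGE (l + 2)) {a : ℕ}
    {f : FPS n} (hf : f ∈ ordGE a) (j : ℕ) : lieExp G f - lieSum G j f ∈ ordGE (a + j * l) := by
  intro m hm
  rw [map_sub, lieExp, (ordCauchy_lieSum (weightGE_mono (by omega) hG)).coeff_eq f
    (lt_of_lt_of_le (Nat.lt_succ_self _) (le_max_left (m.degree + 1) j)), ← map_sub, lieSum_apply,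
    lieSum_apply, ← Finset.sum_range_add_sum_Ico _ (le_max_right (m.degree + 1) j),
    add_sub_cancel_left]
  refine (Submodule.sum_mem (ordGE (a + j * l)) fun k hk => ?_) m hm
  refine Submodule.smul_mem _ _ (weightGE_mono ?_ (ad_pow_mem hG hf k))
  have := Nat.mul_le_mul_right l (Finset.mem_Ico.1 hk).1
  omega

theorem lieSum_one (G f : FPS n) : lieSum G 1 f = f := by simp [lieSum_apply]

theorem lieSum_two (G f : FPS n) : lieSum G 2 f = f + bracket f G := by
  simp [lieSum_apply, Finset.sum_range_succ, ad_apply]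

/-- The Hamiltonian that removes, to first order, the part of a perturbation outside the
square of the ideal. -/
def stepG (lam : Fin n → ℂ) (T R : FPS n) : FPS n :=
  hsolve lam 0 R + hsolve lam 1 (R + bracket T (hsolve lam 0 R))

theorem hsolve_mem_bracket_mem {lam : Fin n → ℂ} {T R : FPS n} {k : ℕ} (hT : T ∈ pairGE 2)
    (hR : R ∈ ordGE k) : R + bracket T (hsolve lam 0 R) ∈ ordGE k :=
  Submodule.add_mem _ hR (weightGE_mono (by omega)
    (bracket_mem_ordGE (pairGE_le_ordGE hT) (hsolve_mem_ordGE lam 0 k hR)))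

theorem stepG_mem {lam : Fin n → ℂ} {T R : FPS n} {k : ℕ} (hT : T ∈ pairGE 2)
    (hR : R ∈ ordGE k) : stepG lam T R ∈ ordGE k :=
  Submodule.add_mem _ (hsolve_mem_ordGE lam 0 k hR)
    (hsolve_mem_ordGE lam 1 k (hsolve_mem_bracket_mem hT hR))

theorem coeff_bracket_hsolve {lam : Fin n → ℂ} {C : ℝ} (hC : 0 < C) {τ : ℕ}
    (h : ∀ m : Expo n, 3 ≤ m.degree → pairCount m ≤ 1 → C ≤ ‖divisor lam m‖ * (m.degree : ℝ) ^ τ)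
    {k : ℕ} (hk : k ≤ 1) {f : FPS n} (hf : f ∈ ordGE 3) (m : Expo n) :
    coeff m (bracket (formalH lam) (hsolve lam k f)) =
      if pairCount m = k then -coeff m f else 0 := by
  rw [coeff_bracket_formalH, coeff_hsolve]
  split_ifs with hm
  · by_cases h3 : m.degree < 3
    · rw [hf m h3]; simp
    · have hd : divisor lam m ≠ 0 := by
        intro h0
        have := h m (by omega) (by omega)
        rw [h0, norm_zero, zero_mul] at this
        linarith
      field_simp
  · simp

/-- Write G₀ and G₁ for the two summands of `stepG`. In weight 0, {H, G₀} cancels `R`, and {T, G₀}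
only starts in weight 2 + 0 - 1 = 1. In weight 1, {H, G₁} cancels `R` + {T, G₀}, and {T, G₁} starts
in weight 2 + 1 - 1 = 2, so no further correction arises. -/
theorem stepT_mem {lam : Fin n → ℂ} (hlam : IsDiophantine lam) {T R : FPS n}
    (hT : T ∈ pairGE 2) (hR : R ∈ ordGE 3) :
    T + (bracket (formalH lam) (stepG lam T R) + bracket T (stepG lam T R) + R) ∈ pairGE 2 := by
  obtain ⟨C, hC, τ, h⟩ := exists_divisor_bound hlam
  intro m hm
  have h0 := bracket_mem_pairGE hT (hsolve_mem_pairGE lam 0 R)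
  have h1 := bracket_mem_pairGE hT
    (hsolve_mem_pairGE lam 1 (R + bracket T (hsolve lam 0 R))) m hm
  simp only [stepG, map_add]
  rw [hT m hm, h1, coeff_bracket_hsolve hC h (by omega) hR,
    coeff_bracket_hsolve hC h le_rfl (hsolve_mem_bracket_mem hT hR), map_add]
  rcases Nat.lt_succ_iff.1 hm |>.lt_or_eq with hm0 | hm1
  · rw [h0 m hm0, if_pos (by omega), if_neg (by omega)]; ring
  · rw [if_neg (by omega), if_pos hm1]; ring

/-- Three of the five losses are used here: G₀ is bounded at r + 4d, {T, G₀} at r + 3d, G₁ at r +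
2d. The other two are left for the derivatives of G and for its Lie series; the factor `d ^ 2` is
set aside for the two divisions by d that these cause. -/
theorem exists_step_constants {lam : Fin n → ℂ} (hlam : IsDiophantine lam) :
    ∃ b : ℝ≥0, ∃ q : ℕ, ∀ (r d ε : ℝ≥0) (T R : FPS n), 0 < d → r + 5 * d ≤ 1 →
      T ∈ pairGE 2 → R ∈ ordGE 3 → wnorm (r + 5 * d) T ≤ 1 → wnorm (r + 5 * d) R ≤ ε →
      wnorm (r + 2 * d) (stepG lam T R) ≤ ((b * (ε / d ^ q) * d ^ 2 : ℝ≥0) : ℝ≥0∞) := by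
  obtain ⟨a, τ, ha⟩ := exists_wnorm_hsolve_le hlam
  -- Two small divisors and one bracket cost d^(2τ + 2); two more powers compensate the factor `d ^
  -- 2` in the statement.
  refine ⟨2 * a + 2 * n * a ^ 2, 2 * τ + 4, fun r d ε T R hd hrd hT hR hTn hRn => ?_⟩
  have hd1 : d ≤ 1 := le_trans (by rw [show 5 * d = d + 4 * d by ring, add_left_comm];
                                   exact le_self_add) hrd
  have hdp : 0 < d ^ τ := pow_pos hd τ
  have e4 : r + 4 * d + d = r + 5 * d := by ring
  have e3 : r + 3 * d + d = r + 4 * d := by ring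
  have e2 : r + 2 * d + d = r + 3 * d := by ring
  have l45 : r + 4 * d ≤ r + 5 * d := by rw [← e4]; exact le_self_add
  have l35 : r + 3 * d ≤ r + 5 * d := le_trans (by rw [← e3]; exact le_self_add) l45
  have hG0 : wnorm (r + 4 * d) (hsolve lam 0 R) ≤ ((a * ε / d ^ τ : ℝ≥0) : ℝ≥0∞) := by
    refine le_coe_div_of_mul_le hdp ((ha 0 (r + 4 * d) d R (by omega) (e4 ▸ hrd) hR).trans ?_)
    rw [e4, ENNReal.coe_mul]
    gcongr
  have hB : wnorm (r + 3 * d) (bracket T (hsolve lam 0 R)) ≤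
      ((2 * n * (a * ε / d ^ τ / d) * 1 / d : ℝ≥0) : ℝ≥0∞) :=
    wnorm_bracket_le hd (e3 ▸ hG0) (e3 ▸ (wnorm_mono l45 T).trans (by simpa using hTn))
  have hG1 : wnorm (r + 2 * d) (hsolve lam 1 (R + bracket T (hsolve lam 0 R))) ≤
      ((a * (ε + 2 * n * (a * ε / d ^ τ / d) * 1 / d) / d ^ τ : ℝ≥0) : ℝ≥0∞) := by
    refine le_coe_div_of_mul_le hdp ((ha 1 (r + 2 * d) d _ le_rfl
      (e2 ▸ l35.trans hrd) (hsolve_mem_bracket_mem hT hR)).trans ?_)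
    rw [e2, ENNReal.coe_mul, ENNReal.coe_add]
    gcongr
    exact (wnorm_add_le _ _ _).trans (add_le_add ((wnorm_mono l35 R).trans hRn) hB)
  refine (wnorm_add_le _ _ _).trans ((add_le_add ((wnorm_mono (by gcongr; norm_num) _).trans hG0)
    hG1).trans ?_)
  rw [← ENNReal.coe_add, ENNReal.coe_le_coe]
  have hd0 : d ≠ 0 := hd.ne'
  have h1 : 1 ≤ (d ^ (τ + 2))⁻¹ := (one_le_inv₀ (pow_pos hd _)).2 (pow_le_one₀ zero_le hd1)
  calc a * ε / d ^ τ + a * (ε + 2 * n * (a * ε / d ^ τ / d) * 1 / d) / d ^ τ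
      = 2 * a * ε / d ^ τ * 1 + 2 * n * a ^ 2 * ε / d ^ (2 * τ + 2) := by field_simp; ring
    _ ≤ 2 * a * ε / d ^ τ * (d ^ (τ + 2))⁻¹ + 2 * n * a ^ 2 * ε / d ^ (2 * τ + 2) := by gcongr
    _ = _ := by field_simp; ring

/-- The new error consists of terms of second order in G acting on H and T, and of first order
acting on `R`; it is therefore quadratic in x = ε / d^q. The order grows because G has order k ≥ 3.
-/
theorem exists_kam_step {lam : Fin n → ℂ} (hlam : IsDiophantine lam) :
    ∃ A : ℝ≥0, ∃ p : ℕ, ∀ (k : ℕ) (r d ε η : ℝ≥0) (T R : FPS n), 3 ≤ k → 0 < d → r + 5 * d ≤ 1 →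
      η ≤ 1 → A * ε ≤ η * d ^ p →
      T ∈ pairGE 2 → R ∈ ordGE k → wnorm (r + 5 * d) T ≤ 1 → wnorm (r + 5 * d) R ≤ ε →
      ∃ G ∈ ordGE (n := n) k, ∃ T' ∈ pairGE (n := n) 2, ∃ R' ∈ ordGE (n := n) (k + 1),
        lieExp G (formalH lam + T + R) = formalH lam + T' + R' ∧
        (∀ f, wnorm r (lieExp G f - f) ≤ η * wnorm (r + 5 * d) f) ∧
        wnorm r (T' - T) ≤ η ∧ wnorm r R' ≤ ((η * ε : ℝ≥0) : ℝ≥0∞) := by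
  obtain ⟨b, q, hb⟩ := exists_step_constants hlam
  set H := formalH lam with hH
  obtain ⟨h, hh⟩ := WithTop.ne_top_iff_exists.1 (wnorm_formalH_ne_top 1 lam)
  rw [← hH] at hh
  -- The first two summands bound `R'`, the second alone gives 2θ ≤ η, and the last two bound `T' -
  -- T`. The exponent 2q turns A ε ≤ η d^(2q) into A x ≤ η d^q, hence A x² ≤ η ε.
  refine ⟨72 * n ^ 2 * b ^ 2 * (h + 1) + 12 * n * b + 2 * n * b * (h + 1) + 1, 2 * q,
    fun k r d ε η T R hk hd hrd hη hA hT hR hTn hRn => ?_⟩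
  have hR3 := weightGE_mono hk hR
  have hG := hb r d ε T R hd hrd hT hR3 hTn hRn
  set G := stepG lam T R with hGdef
  have hGk : G ∈ ordGE k := stepG_mem hT hR
  have hd0 : d ≠ 0 := hd.ne'
  have hd1 : d ≤ 1 := le_trans (by rw [show 5 * d = d + 4 * d by ring, add_left_comm];
                                   exact le_self_add) hrd
  have hdq : d ^ q ≤ 1 := pow_le_one₀ zero_le hd1
  set x := ε / d ^ q with hx
  have hεx : ε ≤ x := by
    rw [hx, le_div_iff₀ (pow_pos hd q)]; exact mul_le_of_le_one_right zero_le hdq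
  have hxε : x * d ^ q = ε := div_mul_cancel₀ _ (pow_ne_zero q hd0)
  set A := 72 * (n : ℝ≥0) ^ 2 * b ^ 2 * (h + 1) + 12 * n * b + 2 * n * b * (h + 1) + 1 with hAdef
  have hAx : A * x ≤ η * d ^ q := by
    rw [hx, mul_div_assoc', div_le_iff₀ (pow_pos hd q)]
    exact hA.trans (by rw [two_mul, pow_add, mul_assoc])
  have hAxη : A * x ≤ η := hAx.trans (mul_le_of_le_one_right zero_le hdq)
  have hAxx : A * x * x ≤ η * ε := by
    calc A * x * x ≤ η * d ^ q * x := by gcongr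
      _ = η * ε := by rw [← hxε]; ring
  set θ := 6 * (n : ℝ≥0) * b * x with hθ
  have h2θ : 2 * θ ≤ η := by
    refine le_trans ?_ hAxη
    calc 2 * θ = 12 * n * b * x := by rw [hθ]; ring
      _ ≤ A * x := by
        gcongr
        rw [hAdef]
        exact le_add_right (le_add_right le_add_self)
  have e1 : r + d + d = r + 2 * d := by ring
  have l15 : r + d ≤ r + 5 * d := by
    rw [show r + 5 * d = r + d + 4 * d by ring]; exact le_self_add
  have l1 : r + d ≤ 1 := l15.trans hrd
  have hM : ∀ u, wnorm (r + d) (pderiv ℂ u G) ≤ ((b * x * d ^ 2 / d : ℝ≥0) : ℝ≥0∞) :=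
    wnorm_pderiv_le hd (e1 ▸ hG)
  have hMθ : 6 * n * (b * x * d ^ 2 / d) ≤ θ * d := le_of_eq (by rw [hθ]; field_simp)
  have hLie := fun f j => wnorm_lieExp_sub_lieSum_le hd (weightGE_mono hk hGk) hM hMθ
    (h2θ.trans hη) f j
  have hHn : wnorm (r + d) H ≤ h := (wnorm_mono l1 _).trans hh.ge
  have hTn' : wnorm (r + d) T ≤ (1 : ℝ≥0) := (wnorm_mono l15 _).trans (by simpa using hTn)
  have hRn' : wnorm (r + d) R ≤ ε := (wnorm_mono l15 _).trans hRn
  have hGr : wnorm (r + d) G ≤ ((b * x * d ^ 2 : ℝ≥0) : ℝ≥0∞) :=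
    (wnorm_mono (by gcongr; exact le_mul_of_one_le_left zero_le (by norm_num)) _).trans hG
  refine ⟨G, hGk, T + (bracket H G + bracket T G + R), stepT_mem hlam hT hR3,
    (lieExp G H - lieSum G 2 H) + (lieExp G T - lieSum G 2 T) + (lieExp G R - lieSum G 1 R),
    ?_, ?_, ?_, ?_, ?_⟩
  · obtain ⟨l, rfl⟩ : ∃ l, k = l + 2 := ⟨k - 2, by omega⟩
    refine Submodule.add_mem _ (Submodule.add_mem _ ?_ ?_) ?_
    · exact weightGE_mono (by omega)
        (lieExp_sub_lieSum_mem (by omega) hGk (formalH_mem_ordGE lam) 2)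
    · exact weightGE_mono (by omega) (lieExp_sub_lieSum_mem (by omega) hGk (pairGE_le_ordGE hT) 2)
    · exact weightGE_mono (by omega) (lieExp_sub_lieSum_mem (by omega) hGk hR 1)
  · rw [map_add, map_add, lieSum_two, lieSum_two, lieSum_one]; abel
  · intro f
    have := hLie f 1
    rw [lieSum_one, pow_one] at this
    refine this.trans ?_
    have h2 := ENNReal.coe_le_coe.2 h2θ
    push_cast at h2
    exact mul_le_mul' h2 (wnorm_mono l15 f)
  · rw [add_sub_cancel_left]
    refine (wnorm_add_le _ _ _).trans ((add_le_add ((wnorm_add_le _ _ _).trans (add_le_add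
      (wnorm_bracket_le hd hGr hHn) (wnorm_bracket_le hd hGr hTn')))
      ((wnorm_mono le_self_add R).trans hRn')).trans ?_)
    rw [← ENNReal.coe_add, ← ENNReal.coe_add, ENNReal.coe_le_coe]
    refine le_trans ?_ hAxη
    calc _ = 2 * n * b * (h + 1) * x + ε := by field_simp
      _ ≤ 2 * n * b * (h + 1) * x + 1 * x := by rw [one_mul]; gcongr
      _ = (2 * n * b * (h + 1) + 1) * x := by ring
      _ ≤ A * x := by
        gcongr
        rw [hAdef, add_assoc (_ + _) (2 * (n : ℝ≥0) * b * (h + 1)) 1]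
        exact le_add_self
  · have k1 := (hLie H 2).trans (mul_le_mul_right hHn _)
    have k2 := (hLie T 2).trans (mul_le_mul_right hTn' _)
    have k3 := (hLie R 1).trans (mul_le_mul_right hRn' _)
    refine (wnorm_add_le _ _ _).trans ((add_le_add ((wnorm_add_le _ _ _).trans
      (add_le_add k1 k2)) k3).trans ?_)
    have : 2 * θ ^ 2 * h + 2 * θ ^ 2 * 1 + 2 * θ ^ 1 * ε ≤ η * ε := by
      refine le_trans ?_ hAxx
      calc 2 * θ ^ 2 * h + 2 * θ ^ 2 * 1 + 2 * θ ^ 1 * ε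
          ≤ 2 * θ ^ 2 * h + 2 * θ ^ 2 * 1 + 2 * θ ^ 1 * x := by gcongr
        _ = (72 * (n : ℝ≥0) ^ 2 * b ^ 2 * (h + 1) + 12 * n * b) * x * x := by rw [hθ]; ring
        _ ≤ A * x * x := by
          gcongr
          rw [hAdef, add_assoc (_ + _) (2 * (n : ℝ≥0) * b * (h + 1)) 1]
          exact le_self_add
    exact_mod_cast ENNReal.coe_le_coe.2 this

end FPS

end

noncomputable section

namespace FPS

open MvPowerSeries Finset.HasAntidiagonal
open scoped NNReal ENNReal

variable {n : ℕ}

/-! ### The formal normal form, with estimates -/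

/-- Invariants of the iteration after `j` steps. -/
structure IsIterate (θ ε : ℝ≥0) (j : ℕ) (T R : FPS n) : Prop where
  pair : T ∈ pairGE 2
  ord : R ∈ ordGE (j + 3)
  bound_T : ∃ t : ℝ≥0, wnorm (1 / 2 + (1 / 2) ^ j / 2) T ≤ t ∧ t + (1 / 2) ^ j ≤ 1
  bound_R : wnorm (1 / 2 + (1 / 2) ^ j / 2) R ≤ ((ε * θ ^ j : ℝ≥0) : ℝ≥0∞)

/-- The radius drops by 2^(-j)/4, that is by five times 2^(-j)/20. Geometric decay of the errors
suffices; the factor 2^(-j) kept in η makes the changes of `T` and of the norms summable. -/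
theorem exists_iterate_step {lam : Fin n → ℂ} (hlam : IsDiophantine lam) :
    ∃ θ ε : ℝ≥0, 0 < ε ∧ θ ≤ 1 / 4 ∧ ∀ (j : ℕ) (T R : FPS n), IsIterate θ ε j T R →
      ∃ G T' R' : FPS n, G ∈ ordGE (j + 3) ∧ IsIterate θ ε (j + 1) T' R' ∧
        lieExp G (formalH lam + T + R) = formalH lam + T' + R' ∧
        ∀ f, wnorm (1 / 2 + (1 / 2) ^ (j + 1) / 2) (lieExp G f - f) ≤
          ((1 / 4 * (1 / 2) ^ j : ℝ≥0) : ℝ≥0∞) * wnorm (1 / 2 + (1 / 2) ^ j / 2) f := by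
  obtain ⟨A, p, hA⟩ := exists_kam_step hlam
  -- θ^j ≤ 2^(-j(p+1)) pays both for d^p with d = 2^(-j)/20 and for the factor 2^(-j) in η; the
  -- constant 20^(-p) and `A` are absorbed in ε.
  set θ : ℝ≥0 := (1 / 2) ^ (p + 2) with hθ
  set ε : ℝ≥0 := θ * (1 / 20) ^ p / (A + 1) with hε
  have hθ0 : 0 < θ := by positivity
  have hθ4 : θ ≤ 1 / 4 := by
    rw [hθ, pow_add]
    calc ((1 : ℝ≥0) / 2) ^ p * (1 / 2) ^ 2 ≤ 1 * (1 / 2) ^ 2 := by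
          gcongr
          exact pow_le_one₀ zero_le (by rw [div_le_one] <;> norm_num)
      _ = 1 / 4 := by norm_num
  refine ⟨θ, ε, by positivity, hθ4, fun j T R h => ?_⟩
  set x : ℝ≥0 := (1 / 2) ^ j with hx
  have hx0 : 0 < x := by positivity
  have hx1 : x ≤ 1 := pow_le_one₀ zero_le (by rw [div_le_one] <;> norm_num)
  have hx' : (1 / 2 : ℝ≥0) ^ (j + 1) = x / 2 := by rw [pow_succ, hx]; ring
  have es : 1 / 2 + x / 2 = 1 / 2 + x / 2 / 2 + 5 * (x / 20) := by
    rw [← NNReal.coe_inj]; push_cast; ring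
  obtain ⟨t, ht, htx⟩ := h.bound_T
  have hAε : A * ε ≤ θ * (1 / 20) ^ p := by
    rw [hε, mul_div_assoc', div_le_iff₀ (by positivity), mul_comm]
    gcongr
    exact le_self_add
  have hcond : A * (ε * θ ^ j) ≤ θ * x * (x / 20) ^ p := by
    calc A * (ε * θ ^ j) = (A * ε) * θ ^ j := by ring
      _ ≤ (θ * (1 / 20) ^ p) * θ ^ j := by gcongr
      _ ≤ (θ * (1 / 20) ^ p) * ((1 / 2) ^ (p + 1)) ^ j := by
          gcongr
          rw [hθ]
          exact pow_le_pow_of_le_one zero_le (by rw [div_le_one] <;> norm_num) (by omega)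
      _ = _ := by
          rw [hx, ← pow_mul, div_eq_mul_inv (_ ^ j) 20, mul_pow, ← pow_mul, one_div, one_div]; ring
  have hθx : θ * x ≤ 1 / 4 * x := by gcongr
  obtain ⟨G, hG, T', hT', R', hR', he, hf, hTT, hRR⟩ := hA (j + 3) (1 / 2 + x / 2 / 2) (x / 20)
    (ε * θ ^ j) (θ * x) T R (by omega) (by positivity) (by
      rw [← es, ← NNReal.coe_le_coe]; push_cast
      have : (x : ℝ) ≤ 1 := by exact_mod_cast hx1
      linarith) (hθx.trans (by
        rw [← NNReal.coe_le_coe]; push_cast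
        have : (x : ℝ) ≤ 1 := by exact_mod_cast hx1
        linarith)) hcond h.pair h.ord (es ▸ ht.trans (by
        have : t ≤ 1 := le_self_add.trans htx
        exact_mod_cast this)) (es ▸ h.bound_R)
  refine ⟨G, T', R', hG, ⟨hT', hR', ⟨t + θ * x, ?_, ?_⟩, ?_⟩, he, fun f => ?_⟩
  · rw [hx']
    have : T' = T + (T' - T) := by abel
    rw [this]
    refine (wnorm_add_le _ _ _).trans ?_
    rw [ENNReal.coe_add]
    refine add_le_add ((wnorm_mono ?_ T).trans ht) hTT
    rw [es]; exact le_self_add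
  · rw [hx', ← NNReal.coe_le_coe]
    push_cast
    have h1 : (θ : ℝ) * x ≤ 1 / 4 * x := by exact_mod_cast hθx
    have h2 : (t : ℝ) + x ≤ 1 := by exact_mod_cast htx
    have h3 : (0 : ℝ) < x := by exact_mod_cast hx0
    linarith
  · rw [hx']
    refine hRR.trans (ENNReal.coe_le_coe.2 ?_)
    calc θ * x * (ε * θ ^ j) ≤ θ * 1 * (ε * θ ^ j) := by gcongr
      _ = ε * θ ^ (j + 1) := by ring
  · rw [hx', es]
    refine (hf f).trans ?_
    gcongr

/-- Successive composition of Lie series. -/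
def lieComp (G : ℕ → FPS n) : ℕ → FPS n →ₗ[ℂ] FPS n
  | 0 => LinearMap.id
  | j + 1 => lieExp (G j) ∘ₗ lieComp G j

theorem lieComp_succ (G : ℕ → FPS n) (j : ℕ) (f : FPS n) :
    lieComp G (j + 1) f = lieExp (G j) (lieComp G j f) := rfl

theorem lieExp_sub_self_mem {G : FPS n} {l : ℕ} (hl : 1 ≤ l) (hG : G ∈ ordGE (l + 2)) {a : ℕ}
    {f : FPS n} (hf : f ∈ ordGE a) : lieExp G f - f ∈ ordGE (a + l) := by
  have := lieExp_sub_lieSum_mem hl hG hf 1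
  rwa [lieSum_one, one_mul] at this

theorem lieComp_sub_self_mem {G : ℕ → FPS n} (hG : ∀ j, G j ∈ ordGE (j + 3)) {a : ℕ} {f : FPS n}
    (hf : f ∈ ordGE a) (j : ℕ) : lieComp G j f - f ∈ ordGE (a + 1) := by
  induction j with
  | zero => simp [lieComp]
  | succ j ih =>
    have h1 : lieComp G j f ∈ ordGE a := by
      have := Submodule.add_mem _ (weightGE_mono (Nat.le_succ a) ih) hf
      rwa [sub_add_cancel] at this
    have h2 : lieExp (G j) (lieComp G j f) - lieComp G j f ∈ ordGE (a + 1) :=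
      weightGE_mono (by omega) (lieExp_sub_self_mem (l := j + 1) (by omega) (hG j) h1)
    have := Submodule.add_mem _ h2 ih
    rwa [sub_add_sub_cancel] at this

theorem ordCauchy_lieComp {G : ℕ → FPS n} (hG : ∀ j, G j ∈ ordGE (j + 3)) :
    OrdCauchy (lieComp G) := fun N f => by
  rw [lieComp_succ]
  exact weightGE_mono (by omega)
    (lieExp_sub_self_mem (l := N + 1) (by omega) (hG N) (mem_weightGE_zero _))

theorem limMap_lieComp_bilin {G : ℕ → FPS n} (hG : ∀ j, G j ∈ ordGE (j + 3))
    {B : FPS n →ₗ[ℂ] FPS n →ₗ[ℂ] FPS n} (hB : OrdBilin B)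
    (hE : ∀ G ∈ ordGE (n := n) 3, ∀ f g, lieExp G (B f g) = B (lieExp G f) (lieExp G g))
    (f g : FPS n) : limMap (lieComp G) (B f g) = B (limMap (lieComp G) f) (limMap (lieComp G) g) := by
  refine (ordCauchy_lieComp hG).map_bilin hB (fun N f g => ?_) f g
  have : lieComp G N (B f g) = B (lieComp G N f) (lieComp G N g) := by
    induction N with
    | zero => rfl
    | succ N ih => rw [lieComp_succ, ih, hE _ (weightGE_mono (by omega) (hG N))]; rfl
  rw [this, sub_self]
  exact Submodule.zero_mem _

/-- A coefficient of weight below 2 in the image of H + R, minus H, can be read off T_j + R_j for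
large j: it vanishes in T_j, which has weight at least 2, and in R_j, whose order exceeds its
degree. -/
theorem exists_formal_normal_form {lam : Fin n → ℂ} (hlam : IsDiophantine lam) :
    ∃ ε : ℝ≥0, 0 < ε ∧ ∀ R ∈ ordGE (n := n) 3, wnorm 1 R ≤ ε →
      ∃ φ : FPS n →ₗ[ℂ] FPS n, (∀ f g, φ (f * g) = φ f * φ g) ∧
        (∀ f g, φ (bracket f g) = bracket (φ f) (φ g)) ∧
        (∀ a f, f ∈ ordGE a → φ f - f ∈ ordGE (a + 1)) ∧
        (∀ f, wnorm (1 / 2) (φ f) ≤ 2 * wnorm 1 f) ∧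
        φ (formalH lam + R) - formalH lam ∈ pairGE 2 := by
  obtain ⟨θ, ε, hε, hθ, hstep⟩ := exists_iterate_step hlam
  refine ⟨ε, hε, fun R hR hRn => ?_⟩
  have h11 : (1 : ℝ≥0) / 2 + 1 / 2 = 1 := by rw [← NNReal.coe_inj]; push_cast; norm_num
  have h0 : IsIterate θ ε 0 0 R :=
    ⟨Submodule.zero_mem _, hR, ⟨0, by rw [wnorm_zero]; simp, by simp⟩, by
      rw [pow_zero, pow_zero, mul_one, h11]; exact hRn⟩
  choose! G T' R' hG hI hE hN using hstep
  let x : ∀ j : ℕ, {p : FPS n × FPS n // IsIterate θ ε j p.1 p.2} := fun j =>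
    Nat.rec ⟨(0, R), h0⟩ (fun j p => ⟨(T' j p.1.1 p.1.2, R' j p.1.1 p.1.2), hI j _ _ p.2⟩) j
  let Gs : ℕ → FPS n := fun j => G j (x j).1.1 (x j).1.2
  have hGs : ∀ j, Gs j ∈ ordGE (j + 3) := fun j => hG j _ _ (x j).2
  have hcomp : ∀ j, lieComp Gs j (formalH lam + R) = formalH lam + (x j).1.1 + (x j).1.2 := by
    intro j
    induction j with
    | zero => change formalH lam + R = formalH lam + 0 + R; rw [add_zero]
    | succ j ih => rw [lieComp_succ, ih]; exact hE j _ _ (x j).2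
  -- The invariant b + 2^(-j) ≤ 2 keeps the product of the factors 1 + 2^(-j)/4 below 2.
  have hnorm : ∀ j f, ∃ b : ℝ≥0, b + (1 / 2) ^ j ≤ 2 ∧
      wnorm (1 / 2 + (1 / 2) ^ j / 2) (lieComp Gs j f) ≤ b * wnorm 1 f := by
    intro j f
    induction j with
    | zero =>
      refine ⟨1, by norm_num, ?_⟩
      rw [pow_zero, h11, ENNReal.coe_one, one_mul]; rfl
    | succ j ih =>
      obtain ⟨b, hb, hbn⟩ := ih
      refine ⟨b + 1 / 4 * (1 / 2) ^ j * b, ?_, ?_⟩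
      · rw [← NNReal.coe_le_coe] at hb ⊢
        push_cast at hb ⊢
        have h1 : (0 : ℝ) < (1 / 2) ^ j := by positivity
        rw [pow_succ]
        nlinarith
      · have : lieComp Gs (j + 1) f =
            lieComp Gs j f + (lieExp (Gs j) (lieComp Gs j f) - lieComp Gs j f) := by
          rw [lieComp_succ]; abel
        rw [this]
        refine (wnorm_add_le _ _ _).trans ?_
        rw [ENNReal.coe_add, add_mul]
        refine add_le_add ((wnorm_mono ?_ _).trans hbn) ((hN j _ _ (x j).2 _).trans ?_)
        · rw [pow_succ]
          gcongr
          exact mul_le_of_le_one_right zero_le (by rw [div_le_one] <;> norm_num)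
        · rw [ENNReal.coe_mul _ b, mul_assoc]
          gcongr
  have hC := ordCauchy_lieComp hGs
  refine ⟨limMap (lieComp Gs), limMap_lieComp_bilin hGs ordBilin_mul fun G hG => lieExp_mul hG,
    limMap_lieComp_bilin hGs ordBilin_bracket fun G hG => lieExp_bracket hG,
    fun a f hf m hm => ?_, fun f => ?_, fun m hm => ?_⟩
  · rw [map_sub, hC.coeff_eq f (Nat.lt_succ_self m.degree), ← map_sub]
    exact lieComp_sub_self_mem hGs hf _ m hm
  · have := hC.wnorm_sub_le (r := 1 / 2) (f := f) (g := 0) (N₀ := 0) (C := 2 * wnorm 1 f)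
      fun N _ => by
        obtain ⟨b, hb, hbn⟩ := hnorm N f
        have hb2 : (b : ℝ≥0∞) ≤ 2 := by
          exact_mod_cast ENNReal.coe_le_coe.2 (le_self_add.trans hb)
        rw [sub_zero]
        exact (wnorm_mono le_self_add _).trans (hbn.trans (mul_le_mul_left hb2 _))
    rwa [sub_zero] at this
  · rw [map_sub, hC.coeff_eq (formalH lam + R) (Nat.lt_succ_self m.degree), hcomp, map_add,
      map_add, (x (m.degree + 1)).2.pair m hm, (x (m.degree + 1)).2.ord m (by omega)]
    ring

end FPS

end

noncomputable section

namespace FPS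

open MvPowerSeries Finset.HasAntidiagonal
open scoped NNReal ENNReal

variable {n : ℕ}

/-! ### Evaluation of convergent power series -/

/-- The coordinate functions of phase space. -/
def coord (u : Fin n ⊕ Fin n) : PhaseSpace n →L[ℂ] ℂ :=
  u.elim
    (fun i => (ContinuousLinearMap.proj (R := ℂ) (φ := fun _ : Fin n => ℂ) i).comp
      (ContinuousLinearMap.fst ℂ (Fin n → ℂ) (Fin n → ℂ)))
    (fun i => (ContinuousLinearMap.proj (R := ℂ) (φ := fun _ : Fin n => ℂ) i).comp
      (ContinuousLinearMap.snd ℂ (Fin n → ℂ) (Fin n → ℂ)))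

@[simp] theorem coord_inl (i : Fin n) (z : PhaseSpace n) : coord (.inl i) z = z.1 i := rfl

@[simp] theorem coord_inr (i : Fin n) (z : PhaseSpace n) : coord (.inr i) z = z.2 i := rfl

/-- The coordinate vectors of phase space. -/
def basisVec (u : Fin n ⊕ Fin n) : PhaseSpace n := u.elim dq dp

theorem coord_basisVec (u v : Fin n ⊕ Fin n) : coord u (basisVec v) = if u = v then 1 else 0 := by
  rcases u with i | i <;> rcases v with j | j <;>
    simp [basisVec, dq, dp, Pi.single_apply]

theorem ext_coord {z w : PhaseSpace n} (h : ∀ u, coord u z = coord u w) : z = w :=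
  Prod.ext (funext fun i => h (.inl i)) (funext fun i => h (.inr i))

theorem sum_coord_smul_basisVec (z : PhaseSpace n) : ∑ u, coord u z • basisVec u = z := by
  refine ext_coord fun v => ?_
  rw [map_sum]
  simp [coord_basisVec]

theorem norm_coord_le (u : Fin n ⊕ Fin n) (z : PhaseSpace n) : ‖coord u z‖ ≤ ‖z‖ := by
  rcases u with i | i
  · exact (norm_le_pi_norm z.1 i).trans (norm_fst_le z)
  · exact (norm_le_pi_norm z.2 i).trans (norm_snd_le z)

theorem norm_le_of_coord_le {z : PhaseSpace n} {c : ℝ} (hc : 0 ≤ c) (h : ∀ u, ‖coord u z‖ ≤ c) :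
    ‖z‖ ≤ c :=
  norm_prod_le_iff.2 ⟨(pi_norm_le_iff_of_nonneg hc).2 fun i => h (.inl i),
    (pi_norm_le_iff_of_nonneg hc).2 fun i => h (.inr i)⟩

theorem norm_basisVec_le (u : Fin n ⊕ Fin n) : ‖basisVec u‖ ≤ 1 :=
  norm_le_of_coord_le zero_le_one fun v => by rw [coord_basisVec]; split_ifs <;> simp

/-- The monomial with a given exponent, as a function on phase space. -/
def mono (m : Expo n) (z : PhaseSpace n) : ℂ := ∏ u, coord u z ^ m u

theorem mono_add (m m' : Expo n) (z : PhaseSpace n) : mono (m + m') z = mono m z * mono m' z := by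
  simp [mono, pow_add, Finset.prod_mul_distrib]

theorem mono_zero (z : PhaseSpace n) : mono 0 z = 1 := by simp [mono]

theorem mono_single (u : Fin n ⊕ Fin n) (z : PhaseSpace n) :
    mono (Finsupp.single u 1) z = coord u z := by
  classical
  rw [mono, Finset.prod_eq_single u]
  · simp
  · intro v _ hv
    rw [Finsupp.single_eq_of_ne hv, pow_zero]
  · simp

theorem mono_smul (m : Expo n) (c : ℂ) (z : PhaseSpace n) :
    mono m (c • z) = c ^ m.degree * mono m z := by
  simp only [mono, map_smul, smul_eq_mul, mul_pow, Finset.prod_mul_distrib,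
    Finset.prod_pow_eq_pow_sum, Finsupp.degree_eq_sum]

theorem norm_mono_le (m : Expo n) (z : PhaseSpace n) : ‖mono m z‖ ≤ ‖z‖ ^ m.degree := by
  rw [mono, norm_prod, Finsupp.degree_eq_sum, ← Finset.prod_pow_eq_pow_sum]
  refine Finset.prod_le_prod (fun _ _ => norm_nonneg _) fun u _ => ?_
  rw [norm_pow]
  exact pow_le_pow_left₀ (norm_nonneg _) (norm_coord_le u z) _

/-- The sum of a power series. -/
def evalS (f : FPS n) (z : PhaseSpace n) : ℂ := ∑' m, coeff m f * mono m z

theorem enorm_term_le {r : ℝ≥0} {z : PhaseSpace n} (hz : ‖z‖ ≤ r) (f : FPS n) (m : Expo n) :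
    ‖coeff m f * mono m z‖ₑ ≤ ‖coeff m f‖ₑ * (r : ℝ≥0∞) ^ m.degree := by
  rw [enorm_mul]
  gcongr
  have h1 : ‖mono m z‖₊ ≤ r ^ m.degree := by
    have : (‖mono m z‖ : ℝ) ≤ (r : ℝ) ^ m.degree :=
      (norm_mono_le m z).trans (pow_le_pow_left₀ (norm_nonneg _) hz _)
    exact_mod_cast this
  have := ENNReal.coe_le_coe.2 h1
  rwa [ENNReal.coe_pow] at this

theorem summable_norm_term {r : ℝ≥0} {z : PhaseSpace n} (hz : ‖z‖ ≤ r) {f : FPS n}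
    (hf : wnorm r f ≠ ⊤) : Summable fun m => ‖coeff m f * mono m z‖ :=
  tsum_enorm_ne_top_iff_summable_norm.1
    (ne_top_of_le_ne_top hf (ENNReal.tsum_le_tsum (enorm_term_le hz f)))

theorem enorm_evalS_le {r : ℝ≥0} {z : PhaseSpace n} (hz : ‖z‖ ≤ r) (f : FPS n) :
    ‖evalS f z‖ₑ ≤ wnorm r f :=
  enorm_tsum_le_tsum_enorm.trans (ENNReal.tsum_le_tsum (enorm_term_le hz f))

theorem hasSum_evalS {r : ℝ≥0} {z : PhaseSpace n} (hz : ‖z‖ ≤ r) {f : FPS n}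
    (hf : wnorm r f ≠ ⊤) : HasSum (fun m => coeff m f * mono m z) (evalS f z) :=
  (summable_norm_term hz hf).of_norm.hasSum

theorem evalS_add {r : ℝ≥0} {z : PhaseSpace n} (hz : ‖z‖ ≤ r) {f g : FPS n}
    (hf : wnorm r f ≠ ⊤) (hg : wnorm r g ≠ ⊤) : evalS (f + g) z = evalS f z + evalS g z := by
  rw [← ((hasSum_evalS hz hf).add (hasSum_evalS hz hg)).tsum_eq, evalS]
  simp only [map_add, add_mul]

theorem evalS_smul (c : ℂ) (f : FPS n) (z : PhaseSpace n) : evalS (c • f) z = c * evalS f z := by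
  simp only [evalS, coeff_smul, mul_assoc, tsum_mul_left]

theorem evalS_neg (f : FPS n) (z : PhaseSpace n) : evalS (-f) z = -evalS f z := by
  rw [← neg_one_smul ℂ f, evalS_smul, neg_one_mul]

theorem wnorm_add_ne_top {r : ℝ≥0} {f g : FPS n} (hf : wnorm r f ≠ ⊤) (hg : wnorm r g ≠ ⊤) :
    wnorm r (f + g) ≠ ⊤ :=
  ne_top_of_le_ne_top (ENNReal.add_ne_top.2 ⟨hf, hg⟩) (wnorm_add_le r f g)

theorem wnorm_neg_ne_top {r : ℝ≥0} {f : FPS n} (hf : wnorm r f ≠ ⊤) : wnorm r (-f) ≠ ⊤ := by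
  rwa [wnorm_neg]

theorem wnorm_sub_ne_top {r : ℝ≥0} {f g : FPS n} (hf : wnorm r f ≠ ⊤) (hg : wnorm r g ≠ ⊤) :
    wnorm r (f - g) ≠ ⊤ := by
  rw [sub_eq_add_neg]; exact wnorm_add_ne_top hf (wnorm_neg_ne_top hg)

theorem wnorm_mul_ne_top {r : ℝ≥0} {f g : FPS n} (hf : wnorm r f ≠ ⊤) (hg : wnorm r g ≠ ⊤) :
    wnorm r (f * g) ≠ ⊤ :=
  ne_top_of_le_ne_top (ENNReal.mul_ne_top hf hg) (wnorm_mul_le r f g)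

theorem wnorm_sum_ne_top {ι : Type*} {r : ℝ≥0} {s : Finset ι} {f : ι → FPS n}
    (h : ∀ i ∈ s, wnorm r (f i) ≠ ⊤) : wnorm r (∑ i ∈ s, f i) ≠ ⊤ :=
  ne_top_of_le_ne_top (ENNReal.sum_ne_top.2 h) (wnorm_sum_le r s f)

theorem wnorm_smul_ne_top {r : ℝ≥0} (c : ℂ) {f : FPS n} (hf : wnorm r f ≠ ⊤) :
    wnorm r (c • f) ≠ ⊤ := by
  rw [wnorm_smul]; exact ENNReal.mul_ne_top enorm_ne_top hf

theorem wnorm_pderiv_ne_top {r s : ℝ≥0} (h : r < s) {f : FPS n} (hf : wnorm s f ≠ ⊤)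
    (u : Fin n ⊕ Fin n) : wnorm r (pderiv ℂ u f) ≠ ⊤ := by
  obtain ⟨g, hg⟩ := WithTop.ne_top_iff_exists.1 hf
  have e : r + (s - r) = s := add_tsub_cancel_of_le h.le
  exact ne_top_of_le_ne_top ENNReal.coe_ne_top
    (wnorm_pderiv_le (r := r) (g := g) (tsub_pos_of_lt h) (by rw [e]; exact hg.ge) u)

theorem wnorm_X_ne_top (r : ℝ≥0) (u : Fin n ⊕ Fin n) : wnorm r (X u : FPS n) ≠ ⊤ := by
  rw [← MvPolynomial.coe_X]; exact wnorm_coe_ne_top r _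

theorem evalS_sub {r : ℝ≥0} {z : PhaseSpace n} (hz : ‖z‖ ≤ r) {f g : FPS n}
    (hf : wnorm r f ≠ ⊤) (hg : wnorm r g ≠ ⊤) : evalS (f - g) z = evalS f z - evalS g z := by
  rw [sub_eq_add_neg, evalS_add hz hf (wnorm_neg_ne_top hg), evalS_neg, sub_eq_add_neg]

theorem evalS_zero (z : PhaseSpace n) : evalS (0 : FPS n) z = 0 := by simp [evalS]

theorem evalS_sum {ι : Type*} {r : ℝ≥0} {z : PhaseSpace n} (hz : ‖z‖ ≤ r) {s : Finset ι}
    {f : ι → FPS n} (h : ∀ i ∈ s, wnorm r (f i) ≠ ⊤) :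
    evalS (∑ i ∈ s, f i) z = ∑ i ∈ s, evalS (f i) z := by
  classical
  induction s using Finset.induction_on with
  | empty => simp [evalS_zero]
  | insert i s hi ih =>
    rw [Finset.sum_insert hi, Finset.sum_insert hi, evalS_add hz (h i (Finset.mem_insert_self i s))
      (wnorm_sum_ne_top fun j hj => h j (Finset.mem_insert_of_mem hj)),
      ih fun j hj => h j (Finset.mem_insert_of_mem hj)]

theorem evalS_mul {r : ℝ≥0} {z : PhaseSpace n} (hz : ‖z‖ ≤ r) {f g : FPS n}
    (hf : wnorm r f ≠ ⊤) (hg : wnorm r g ≠ ⊤) : evalS (f * g) z = evalS f z * evalS g z := by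
  classical
  have h := Summable.tsum_mul_tsum_eq_tsum_sum_antidiagonal
    (f := fun m => coeff m f * mono m z) (g := fun m => coeff m g * mono m z)
    (summable_norm_term hz hf).of_norm (summable_norm_term hz hg).of_norm
    (summable_mul_of_summable_norm (f := fun m => coeff m f * mono m z)
      (g := fun m => coeff m g * mono m z) (summable_norm_term hz hf) (summable_norm_term hz hg))
  refine Eq.trans ?_ h.symm
  refine tsum_congr fun m => ?_
  rw [coeff_mul, Finset.sum_mul]
  refine Finset.sum_congr rfl fun p hp => ?_
  rw [← mem_antidiagonal.1 hp, mono_add]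
  ring

theorem evalS_monomial (m : Expo n) (c : ℂ) (z : PhaseSpace n) :
    evalS (monomial m c) z = c * mono m z := by
  classical
  rw [evalS, tsum_eq_single m]
  · rw [coeff_monomial_same]
  · intro m' hm'
    rw [coeff_monomial_ne hm', zero_mul]

theorem evalS_X (u : Fin n ⊕ Fin n) (z : PhaseSpace n) : evalS (X u : FPS n) z = coord u z := by
  rw [X_def, evalS_monomial, one_mul, mono_single]

theorem evalS_C (c : ℂ) (z : PhaseSpace n) : evalS (C c : FPS n) z = c := by
  rw [← monomial_zero_eq_C_apply, evalS_monomial, mono_zero, mul_one]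

theorem evalS_at_zero (f : FPS n) : evalS f 0 = coeff 0 f := by
  rw [evalS, tsum_eq_single 0]
  · rw [mono_zero, mul_one]
  · intro m hm
    have : ‖mono m (0 : PhaseSpace n)‖ ≤ 0 := by
      refine (norm_mono_le m 0).trans ?_
      rw [norm_zero, zero_pow (fun h => hm ((Finsupp.degree_eq_zero_iff m).1 h))]
    rw [norm_le_zero_iff.1 this, mul_zero]

/-- Spelling a monomial as a word makes it a product of linear forms, hence the diagonal of a
multilinear map; no symmetry is required of that map. -/
theorem exists_word {k : ℕ} (m : Expo n) (hm : m.degree = k) :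
    ∃ w : Fin k → Fin n ⊕ Fin n, ∀ z, ∏ j, coord (w j) z = mono m z := by
  induction k generalizing m with
  | zero =>
    have := (Finsupp.degree_eq_zero_iff m).1 hm
    subst this
    exact ⟨Fin.elim0, fun z => by simp [mono]⟩
  | succ k ih =>
    obtain ⟨u, hu⟩ : ∃ u, m u ≠ 0 := by
      by_contra! h
      have : m = 0 := Finsupp.ext h
      rw [this] at hm; simp at hm
    have hle : Finsupp.single u 1 ≤ m := Finsupp.single_le_iff.2 (Nat.one_le_iff_ne_zero.2 hu)
    have hsum := tsub_add_cancel_of_le hle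
    obtain ⟨w, hw⟩ := ih (m - Finsupp.single u 1) (by
      have := congrArg Finsupp.degree hsum
      rw [map_add, Finsupp.degree_single] at this; omega)
    refine ⟨Fin.cons u w, fun z => ?_⟩
    rw [Fin.prod_univ_succ, ← hsum, mono_add, mono_single, mul_comm]
    simp [hw]

/-- A multilinear map whose restriction to the diagonal is a given monomial. -/
def monoMulti (k : ℕ) (m : Expo n) : ContinuousMultilinearMap ℂ (fun _ : Fin k => PhaseSpace n) ℂ :=
  if h : m.degree = k then
    (ContinuousMultilinearMap.mkPiAlgebra ℂ (Fin k) ℂ).compContinuousLinearMap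
      fun j => coord ((exists_word m h).choose j)
  else 0

theorem monoMulti_apply {k : ℕ} {m : Expo n} (h : m.degree = k) (z : PhaseSpace n) :
    monoMulti k m (fun _ => z) = mono m z := by
  rw [monoMulti, dif_pos h]
  simpa using (exists_word m h).choose_spec z

theorem norm_monoMulti_le (k : ℕ) (m : Expo n) : ‖monoMulti k m‖ ≤ 1 := by
  rw [monoMulti]
  split_ifs with h
  · refine (ContinuousMultilinearMap.norm_compContinuousLinearMap_le _ _).trans ?_
    rw [ContinuousMultilinearMap.norm_mkPiAlgebra, one_mul]
    refine Finset.prod_le_one (fun _ _ => norm_nonneg _) fun j _ => ?_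
    exact ContinuousLinearMap.opNorm_le_bound _ zero_le_one fun z => by
      rw [one_mul]; exact norm_coord_le _ z
  · simp

theorem degree_finite (k : ℕ) : {m : Expo n | m.degree = k}.Finite := Finsupp.finite_of_degree_eq k

/-- The homogeneous parts of a power series as multilinear maps. -/
def multi (f : FPS n) : FormalMultilinearSeries ℂ (PhaseSpace n) ℂ := fun k =>
  ∑ m ∈ (degree_finite (n := n) k).toFinset, coeff m f • monoMulti k m

theorem hasFPowerSeriesOnBall_evalS {r : ℝ≥0} (hr : 0 < r) {f : FPS n} (hf : wnorm r f ≠ ⊤) :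
    HasFPowerSeriesOnBall (evalS f) (multi f) 0 r where
  r_pos := ENNReal.coe_pos.2 hr
  r_le := by
    refine (multi f).le_radius_of_bound (wnorm r f).toReal fun k => ?_
    have h1 : ‖multi f k‖ ≤ ∑ m ∈ (degree_finite (n := n) k).toFinset, ‖coeff m f‖ := by
      refine (norm_sum_le _ _).trans (Finset.sum_le_sum fun m _ => ?_)
      rw [norm_smul]
      exact mul_le_of_le_one_right (norm_nonneg _) (norm_monoMulti_le k m)
    refine (mul_le_mul_of_nonneg_right h1 (by positivity)).trans ?_
    rw [Finset.sum_mul, ← ENNReal.ofReal_le_iff_le_toReal hf, ENNReal.ofReal_sum_of_nonneg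
      (fun _ _ => by positivity)]
    refine le_trans (Finset.sum_le_sum fun m hm => ?_)
      (ENNReal.sum_le_tsum (degree_finite (n := n) k).toFinset)
    have : m.degree = k := by simpa using hm
    rw [this, ENNReal.ofReal_mul (norm_nonneg _), ofReal_norm, ENNReal.ofReal_pow r.coe_nonneg,
      ENNReal.ofReal_coe_nnreal]
  hasSum := by
    intro y hy
    have hy' : ‖y‖ ≤ r := by
      have : dist y 0 < r := by simpa [edist_lt_coe] using hy
      rw [dist_zero_right] at this; exact this.le
    rw [zero_add]
    convert (hasSum_evalS hy' hf).tsum_fiberwise (fun m : Expo n => m.degree) using 2 with k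
    have e : ((fun m : Expo n => m.degree) ⁻¹' {k}) = ↑((degree_finite (n := n) k).toFinset) := by
      ext m; simp
    rw [e, Finset.tsum_subtype' (degree_finite (n := n) k).toFinset
      (fun m : Expo n => coeff m f * mono m y), multi, _root_.sum_apply]
    refine Finset.sum_congr rfl fun m hm => ?_
    rw [_root_.smul_apply, monoMulti_apply (by simpa using hm), smul_eq_mul]

theorem analyticAt_evalS {r : ℝ≥0} {f : FPS n} (hf : wnorm r f ≠ ⊤) {z : PhaseSpace n}
    (hz : ‖z‖ < r) : AnalyticAt ℂ (evalS f) z := by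
  have hr : 0 < r := by
    have : (0 : ℝ) < r := (norm_nonneg z).trans_lt hz
    exact_mod_cast this
  refine (hasFPowerSeriesOnBall_evalS hr hf).analyticOnNhd z ?_
  simpa [edist_lt_coe, Metric.mem_eball, edist_zero_right, enorm_lt_coe] using hz

theorem hasDerivAt_mono (m : Expo n) (u : Fin n ⊕ Fin n) (z : PhaseSpace n) :
    HasDerivAt (fun t : ℂ => mono m (z + t • basisVec u))
      (m u * mono (m - Finsupp.single u 1) z) 0 := by
  classical
  have h1 : ∀ t : ℂ, mono m (z + t • basisVec u) =
      (coord u z + t) ^ m u * ∏ v ∈ Finset.univ.erase u, coord v z ^ m v := by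
    intro t
    rw [mono, ← Finset.mul_prod_erase _ _ (Finset.mem_univ u)]
    congr 1
    · simp [coord_basisVec]
    · refine Finset.prod_congr rfl fun v hv => ?_
      simp [coord_basisVec, Finset.ne_of_mem_erase hv]
  have h2 : mono (m - Finsupp.single u 1) z =
      coord u z ^ (m u - 1) * ∏ v ∈ Finset.univ.erase u, coord v z ^ m v := by
    rw [mono, ← Finset.mul_prod_erase _ _ (Finset.mem_univ u)]
    congr 1
    · simp
    · refine Finset.prod_congr rfl fun v hv => ?_
      simp [Finsupp.single_eq_of_ne (Finset.ne_of_mem_erase hv)]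
  simp only [h1, h2, ← mul_assoc]
  refine HasDerivAt.mul_const ?_ _
  have := ((hasDerivAt_id (0 : ℂ)).const_add (coord u z)).fun_pow (m u)
  simpa using this

theorem hasDerivAt_mono_line (m : Expo n) (u : Fin n ⊕ Fin n) (z : PhaseSpace n) (t : ℂ) :
    HasDerivAt (fun t : ℂ => mono m (z + t • basisVec u))
      (m u * mono (m - Finsupp.single u 1) (z + t • basisVec u)) t := by
  have h := hasDerivAt_mono m u (z + t • basisVec u)
  rw [← sub_self t] at h
  refine (HasDerivAt.comp_sub_const t t h).congr_of_eventuallyEq (Eventually.of_forall fun s => ?_)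
  dsimp only
  congr 1
  rw [add_assoc, ← add_smul]; congr 2; ring

theorem tsum_deriv_term (f : FPS n) (u : Fin n ⊕ Fin n) (z : PhaseSpace n) :
    ∑' m, coeff m f * (m u * mono (m - Finsupp.single u 1) z) = evalS (pderiv ℂ u f) z := by
  have hinj : Function.Injective fun m : Expo n => m + Finsupp.single u 1 := add_left_injective _
  rw [evalS, ← hinj.tsum_eq]
  · refine tsum_congr fun m => ?_
    rw [coeff_pderiv, add_tsub_cancel_right]
    simp; ring
  · intro m hm
    have hu : m u ≠ 0 := fun h0 => hm (by simp [h0])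
    exact ⟨m - Finsupp.single u 1,
      tsub_add_cancel_of_le (Finsupp.single_le_iff.2 (Nat.one_le_iff_ne_zero.2 hu))⟩

/-- Termwise differentiation along a coordinate line through z: on a disc of radius ρ - ‖z‖ the
derivatives are dominated by the terms of the norm of `pderiv ℂ u f` at an intermediate radius ρ. -/
theorem fderiv_evalS {r : ℝ≥0} {f : FPS n} (hf : wnorm r f ≠ ⊤) {z : PhaseSpace n}
    (hz : ‖z‖ < r) (u : Fin n ⊕ Fin n) :
    fderiv ℂ (evalS f) z (basisVec u) = evalS (pderiv ℂ u f) z := by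
  obtain ⟨ρ, hzρ, hρr⟩ := exists_between hz
  lift ρ to ℝ≥0 using (norm_nonneg z).trans hzρ.le
  have hρ : wnorm ρ (pderiv ℂ u f) ≠ ⊤ := wnorm_pderiv_ne_top (by exact_mod_cast hρr) hf u
  set b : Expo n → ℝ := fun m => ‖coeff m f‖ * (m u * (ρ : ℝ) ^ (m - Finsupp.single u 1).degree)
  have hb : Summable b := by
    have hinj : Function.Injective fun m : Expo n => m + Finsupp.single u 1 := add_left_injective _
    rw [← hinj.summable_iff]
    · have : Summable fun m : Expo n => ‖coeff m (pderiv ℂ u f) * (ρ : ℂ) ^ m.degree‖ := by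
        refine tsum_enorm_ne_top_iff_summable_norm.1 (ne_top_of_le_ne_top hρ (le_of_eq ?_))
        refine tsum_congr fun m => ?_
        rw [enorm_mul, enorm_pow]
        congr 2
        simp [enorm_eq_nnnorm]
      refine this.congr fun m => ?_
      rw [norm_mul, coeff_pderiv, norm_mul]
      have : ‖((m u : ℂ) + 1)‖ = (m u : ℝ) + 1 := by
        have : ((m u : ℂ) + 1) = ((m u + 1 : ℕ) : ℂ) := by push_cast; ring
        rw [this, Complex.norm_natCast]; push_cast; ring
      rw [this]
      simp only [b, Function.comp_apply, add_tsub_cancel_right]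
      simp; ring
    · intro m hm
      have hu : m u = 0 := by
        by_contra hu
        exact hm ⟨m - Finsupp.single u 1,
          tsub_add_cancel_of_le (Finsupp.single_le_iff.2 (Nat.one_le_iff_ne_zero.2 hu))⟩
      simp [b, hu]
  set δ : ℝ := ρ - ‖z‖ with hδ
  have hδ0 : 0 < δ := sub_pos.2 hzρ
  have hball : ∀ t ∈ Metric.ball (0 : ℂ) δ, ‖z + t • basisVec u‖ ≤ ρ := by
    intro t ht
    rw [mem_ball_zero_iff] at ht
    refine (norm_add_le _ _).trans ?_
    rw [norm_smul]
    have := mul_le_of_le_one_right (norm_nonneg t) (norm_basisVec_le (n := n) u)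
    linarith
  have hD := hasDerivAt_tsum_of_isPreconnected hb Metric.isOpen_ball
    (convex_ball (0 : ℂ) δ).isPreconnected
    (g := fun m t => coeff m f * mono m (z + t • basisVec u))
    (g' := fun m t => coeff m f * (m u * mono (m - Finsupp.single u 1) (z + t • basisVec u)))
    (fun m t _ => (hasDerivAt_mono_line m u z t).const_mul _) (fun m t ht => by
      rw [norm_mul, norm_mul, Complex.norm_natCast]
      simp only [b]
      gcongr
      exact (norm_mono_le _ _).trans (pow_le_pow_left₀ (norm_nonneg _) (hball t ht) _))
    (Metric.mem_ball_self hδ0) (by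
      simpa using (summable_norm_term hz.le hf).of_norm) (Metric.mem_ball_self hδ0)
  rw [tsum_deriv_term, zero_smul, add_zero] at hD
  have hF : HasFDerivAt (evalS f) (fderiv ℂ (evalS f) z) (z + (0 : ℂ) • basisVec u) := by
    rw [zero_smul, add_zero]; exact (analyticAt_evalS hf hz).differentiableAt.hasFDerivAt
  have hL : HasDerivAt (fun t : ℂ => z + t • basisVec u) (basisVec u) 0 := by
    simpa using ((hasDerivAt_id (0 : ℂ)).smul_const (basisVec u)).const_add z
  have hC : HasDerivAt (fun t : ℂ => evalS f (z + t • basisVec u))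
      (fderiv ℂ (evalS f) z (basisVec u)) 0 :=
    HasFDerivAt.comp_hasDerivAt (f := fun t : ℂ => z + t • basisVec u) (0 : ℂ) hF hL
  exact hC.unique hD

/-! ### Substitution -/

/-- The image of 1 is idempotent and has constant term 1, so it can be cancelled in a domain. -/
theorem map_one_of_mul {φ : FPS n →ₗ[ℂ] FPS n} (hmul : ∀ f g, φ (f * g) = φ f * φ g)
    (hord : ∀ a f, f ∈ ordGE a → φ f - f ∈ ordGE (a + 1)) : φ 1 = 1 := by
  have h0 : φ 1 ≠ 0 := by
    intro h
    have := hord 0 1 (mem_weightGE_zero _) 0 (by simp)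
    rw [h, map_sub, map_zero, zero_sub, neg_eq_zero, coeff_zero_one] at this
    exact one_ne_zero this
  refine mul_left_cancel₀ h0 ?_
  rw [← hmul, mul_one, mul_one]

theorem evalS_map_polynomial {φ : FPS n →ₗ[ℂ] FPS n} (hmul : ∀ f g, φ (f * g) = φ f * φ g)
    (h1 : φ 1 = 1) {r : ℝ≥0} (hφ : ∀ p : MvPolynomial (Fin n ⊕ Fin n) ℂ, wnorm r (φ p) ≠ ⊤)
    {z w : PhaseSpace n} (hz : ‖z‖ ≤ r) (hw : ∀ u, coord u w = evalS (φ (X u)) z)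
    (p : MvPolynomial (Fin n ⊕ Fin n) ℂ) :
    evalS (φ p) z = MvPolynomial.eval (fun u => coord u w) p := by
  induction p using MvPolynomial.induction_on with
  | C a =>
    rw [MvPolynomial.coe_C, MvPolynomial.eval_C, ← mul_one (C a), ← smul_eq_C_mul, map_smul, h1,
      smul_eq_C_mul, mul_one, evalS_C]
  | add p q hp hq =>
    rw [MvPolynomial.coe_add, map_add, evalS_add hz (hφ p) (hφ q), hp, hq, map_add]
  | mul_X p u hp =>
    have hX : wnorm r (φ (X u)) ≠ ⊤ := by rw [← MvPolynomial.coe_X]; exact hφ _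
    rw [MvPolynomial.coe_mul, MvPolynomial.coe_X, hmul, evalS_mul hz (hφ p) hX, hp, map_mul,
      MvPolynomial.eval_X, hw]

/-- A bounded multiplicative linear map is the substitution of the images of the variables: this is
algebra for polynomials, which are dense for `wnorm s`, and both sides are continuous in `f` for
that norm. -/
theorem evalS_map {φ : FPS n →ₗ[ℂ] FPS n} (hmul : ∀ f g, φ (f * g) = φ f * φ g) (h1 : φ 1 = 1)
    {r s : ℝ≥0} (hφ : ∀ f, wnorm r (φ f) ≤ 2 * wnorm s f)
    {z w : PhaseSpace n} (hz : ‖z‖ ≤ r) (hws : ‖w‖ ≤ s) (hw : ∀ u, coord u w = evalS (φ (X u)) z)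
    {f : FPS n} (hf : wnorm s f ≠ ⊤) : evalS (φ f) z = evalS f w := by
  classical
  have hfin : ∀ g, wnorm s g ≠ ⊤ → wnorm r (φ g) ≠ ⊤ := fun g hg =>
    ne_top_of_le_ne_top (ENNReal.mul_ne_top (by norm_num) hg) (hφ g)
  have hpoly : ∀ p : MvPolynomial (Fin n ⊕ Fin n) ℂ, evalS (φ p) z = evalS (p : FPS n) w := by
    intro p
    rw [evalS_map_polynomial hmul h1 (fun p => hfin _ (wnorm_coe_ne_top s p)) hz hw p]
    exact (evalS_map_polynomial (φ := LinearMap.id) (fun _ _ => rfl) rfl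
      (fun p => wnorm_coe_ne_top s p) hws (fun u => (evalS_X u w).symm) p).symm
  let P : Finset (Expo n) → MvPolynomial (Fin n ⊕ Fin n) ℂ := fun t =>
    ∑ m ∈ t, MvPolynomial.monomial m (coeff m f)
  have hPcoeff : ∀ t m, coeff m (P t : FPS n) = if m ∈ t then coeff m f else 0 := by
    intro t m
    rw [MvPolynomial.coeff_coe]
    simp only [P, MvPolynomial.coeff_sum, MvPolynomial.coeff_monomial]
    rw [Finset.sum_ite_eq']
  -- The constant 3 is the bound 2 of φ plus 1 for the evaluation at w.
  have hb : ∀ t : Finset (Expo n), ‖evalS (φ f) z - evalS f w‖ₑ ≤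
      3 * ∑' m : {m : Expo n // m ∉ t}, ‖coeff (m : Expo n) f‖ₑ * (s : ℝ≥0∞) ^ (m : Expo n).degree := by
    intro t
    have hP := wnorm_coe_ne_top s (P t)
    have e : evalS (φ f) z - evalS f w = evalS (φ (f - (P t : FPS n))) z - evalS (f - (P t : FPS n)) w := by
      rw [map_sub, evalS_sub hz (hfin f hf) (hfin _ hP), evalS_sub hws hf hP, hpoly]; ring
    have hn : wnorm s (f - (P t : FPS n)) =
        ∑' m : {m : Expo n // m ∉ t}, ‖coeff (m : Expo n) f‖ₑ * (s : ℝ≥0∞) ^ (m : Expo n).degree := by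
      rw [wnorm]
      have := tsum_subtype {m : Expo n | ¬ m ∈ t}
        fun m : Expo n => ‖coeff m f‖ₑ * (s : ℝ≥0∞) ^ m.degree
      refine Eq.trans (tsum_congr fun m => ?_) this.symm
      rw [map_sub, hPcoeff]
      by_cases hm : m ∈ t <;> simp [hm]
    rw [e, ← hn]
    calc _ ≤ ‖evalS (φ (f - (P t : FPS n))) z‖ₑ + ‖evalS (f - (P t : FPS n)) w‖ₑ := enorm_sub_le
      _ ≤ 2 * wnorm s (f - (P t : FPS n)) + wnorm s (f - (P t : FPS n)) :=
          add_le_add ((enorm_evalS_le hz _).trans (hφ _)) (enorm_evalS_le hws _)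
      _ = _ := by ring
  have hlim := ENNReal.Tendsto.const_mul (ENNReal.tendsto_tsum_compl_atTop_zero hf)
    (.inr (by norm_num : (3 : ℝ≥0∞) ≠ ⊤))
  rw [mul_zero] at hlim
  have := ge_of_tendsto' hlim hb
  rwa [nonpos_iff_eq_zero, enorm_eq_zero, sub_eq_zero] at this

end FPS

end

noncomputable section

namespace FPS

open MvPowerSeries Finset.HasAntidiagonal
open scoped NNReal ENNReal

variable {n : ℕ}

/-! ### Power series of analytic functions -/

/-- The exponent of the monomial given by a word of coordinates. -/
def content (w : Σ k : ℕ, (Fin k → Fin n ⊕ Fin n)) : Expo n := ∑ j, Finsupp.single (w.2 j) 1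

theorem degree_content (w : Σ k : ℕ, (Fin k → Fin n ⊕ Fin n)) : (content w).degree = w.1 := by
  simp [content, map_sum, Finsupp.degree_single]

theorem mono_content (w : Σ k : ℕ, (Fin k → Fin n ⊕ Fin n)) (z : PhaseSpace n) :
    mono (content w) z = ∏ j, coord (w.2 j) z := by
  have h : ∀ s : Finset (Fin w.1), mono (∑ j ∈ s, Finsupp.single (w.2 j) 1) z =
      ∏ j ∈ s, coord (w.2 j) z := by
    classical
    intro s
    induction s using Finset.induction_on with
    | empty => simp [mono_zero]
    | insert i s hi ih => rw [Finset.sum_insert hi, Finset.prod_insert hi, mono_add, mono_single, ih]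
  exact h Finset.univ

/-- The coefficient of a word in a formal multilinear series. -/
def wordCoeff (p : FormalMultilinearSeries ℂ (PhaseSpace n) ℂ)
    (w : Σ k : ℕ, (Fin k → Fin n ⊕ Fin n)) : ℂ := p w.1 fun j => basisVec (w.2 j)

theorem norm_wordCoeff_le (p : FormalMultilinearSeries ℂ (PhaseSpace n) ℂ)
    (w : Σ k : ℕ, (Fin k → Fin n ⊕ Fin n)) : ‖wordCoeff p w‖ ≤ ‖p w.1‖ := by
  refine ((p w.1).le_opNorm _).trans (mul_le_of_le_one_right (norm_nonneg _) ?_)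
  exact Finset.prod_le_one (fun _ _ => norm_nonneg _) fun j _ => norm_basisVec_le _

theorem apply_diag_eq_sum (p : FormalMultilinearSeries ℂ (PhaseSpace n) ℂ) (k : ℕ)
    (z : PhaseSpace n) : p k (fun _ => z) =
      ∑ w : Fin k → Fin n ⊕ Fin n, wordCoeff p ⟨k, w⟩ * mono (content ⟨k, w⟩) z := by
  classical
  have h1 := (p k).toMultilinearMap.map_sum
    (fun (_ : Fin k) (u : Fin n ⊕ Fin n) => coord u z • basisVec u)
  simp only [sum_coord_smul_basisVec] at h1
  refine h1.trans (Finset.sum_congr rfl fun w _ => ?_)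
  rw [MultilinearMap.map_smul_univ, mono_content, smul_eq_mul, mul_comm]
  rfl

/-- The power series in the coordinates of a formal multilinear series. -/
def ofMulti (p : FormalMultilinearSeries ℂ (PhaseSpace n) ℂ) : FPS n := fun m =>
  ∑' w : content (n := n) ⁻¹' {m}, wordCoeff p w

/-- There are (2n)^k words of length k, each with coefficient at most `‖p k‖`; hence the factor 2n
on the radius. -/
theorem tsum_words_ne_top {p : FormalMultilinearSeries ℂ (PhaseSpace n) ℂ} {r : ℝ≥0}
    (hr : (((2 * n) * r : ℝ≥0) : ℝ≥0∞) < p.radius) :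
    ∑' w, ‖wordCoeff p w‖ₑ * (r : ℝ≥0∞) ^ w.1 ≠ ⊤ := by
  rw [ENNReal.tsum_sigma']
  have h1 : ∀ k, ∑' w : Fin k → Fin n ⊕ Fin n, ‖wordCoeff p ⟨k, w⟩‖ₑ * (r : ℝ≥0∞) ^ k ≤
      ‖‖p k‖ * (((2 * n) * r : ℝ≥0) : ℝ) ^ k‖ₑ := by
    intro k
    rw [tsum_fintype]
    refine (Finset.sum_le_sum (g := fun _ => ‖p k‖ₑ * (r : ℝ≥0∞) ^ k) fun w _ => ?_).trans ?_
    · gcongr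
      exact enorm_le_iff_norm_le.2 (norm_wordCoeff_le p ⟨k, w⟩)
    · rw [Finset.sum_const, Finset.card_univ, nsmul_eq_mul, enorm_mul, enorm_norm]
      have : ‖((2 * (n : ℝ≥0) * r : ℝ≥0) : ℝ) ^ k‖ₑ = (((2 * n * r) ^ k : ℝ≥0) : ℝ≥0∞) := by
        rw [enorm_pow, ENNReal.coe_pow]; congr 1
        rw [enorm_eq_nnnorm]; simp
      rw [this]
      simp only [Fintype.card_fun, Fintype.card_sum, Fintype.card_fin]
      refine le_of_eq ?_
      push_cast
      rw [mul_pow]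
      ring
  refine ne_top_of_le_ne_top ?_ (ENNReal.tsum_le_tsum h1)
  exact tsum_enorm_ne_top_iff_summable_norm.2 (p.summable_norm_mul_pow hr).norm

theorem wnorm_ofMulti_ne_top {p : FormalMultilinearSeries ℂ (PhaseSpace n) ℂ} {r : ℝ≥0}
    (hr : (((2 * n) * r : ℝ≥0) : ℝ≥0∞) < p.radius) : wnorm r (ofMulti p) ≠ ⊤ := by
  refine ne_top_of_le_ne_top (tsum_words_ne_top hr) ?_
  rw [← (Equiv.sigmaFiberEquiv (content (n := n))).tsum_eq, ENNReal.tsum_sigma', wnorm]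
  refine ENNReal.tsum_le_tsum fun m => ?_
  refine (mul_le_mul_left (enorm_tsum_le_tsum_enorm (f := fun w : content (n := n) ⁻¹' {m} =>
    wordCoeff p w)) _).trans ?_
  rw [← ENNReal.tsum_mul_right]
  refine le_of_eq (tsum_congr fun w => ?_)
  have h : content (w : Σ k : ℕ, (Fin k → Fin n ⊕ Fin n)) = m := w.2
  have hd : m.degree = (w : Σ k : ℕ, (Fin k → Fin n ⊕ Fin n)).1 :=
    (congrArg Finsupp.degree h).symm.trans (degree_content _)
  rw [hd]
  rfl

theorem hasSum_words {f : PhaseSpace n → ℂ} {p : FormalMultilinearSeries ℂ (PhaseSpace n) ℂ}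
    {R : ℝ≥0∞} (hf : HasFPowerSeriesOnBall f p 0 R) {r : ℝ≥0}
    (hr : (((2 * n) * r : ℝ≥0) : ℝ≥0∞) < p.radius) {z : PhaseSpace n} (hz : ‖z‖ ≤ r)
    (hzR : z ∈ Metric.eball 0 R) :
    HasSum (fun w => wordCoeff p w * mono (content w) z) (f z) := by
  have h1 := hf.hasSum hzR
  rw [zero_add] at h1
  refine HasSum.sigma_of_hasSum h1 (fun k => ?_) ?_
  · rw [apply_diag_eq_sum]
    exact hasSum_fintype _
  · refine Summable.of_norm (tsum_enorm_ne_top_iff_summable_norm.1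
      (ne_top_of_le_ne_top (tsum_words_ne_top hr) (ENNReal.tsum_le_tsum fun w => ?_)))
    rw [enorm_mul]
    gcongr
    have h2 : ‖mono (content w) z‖₊ ≤ r ^ w.1 := by
      have : (‖mono (content w) z‖ : ℝ) ≤ (r : ℝ) ^ w.1 := by
        refine (norm_mono_le _ z).trans ?_
        rw [degree_content]
        exact pow_le_pow_left₀ (norm_nonneg _) hz _
      exact_mod_cast this
    have := ENNReal.coe_le_coe.2 h2
    rwa [ENNReal.coe_pow] at this

/-- Multilinearity expands each homogeneous part over words of basis vectors; by absolute
convergence the words may be regrouped according to their monomial. -/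
theorem exists_series {f : PhaseSpace n → ℂ} (hf : AnalyticAt ℂ f 0) :
    ∃ (P : FPS n) (r : ℝ≥0), 0 < r ∧ wnorm r P ≠ ⊤ ∧ ∀ᶠ z in 𝓝 0, f z = evalS P z := by
  obtain ⟨p, R, hp⟩ := hf
  obtain ⟨s, hs0, hsR⟩ := ENNReal.lt_iff_exists_nnreal_btwn.1 hp.r_pos
  have hs0' : 0 < s := by exact_mod_cast hs0
  -- The summand 1 keeps the radius positive when n = 0 and ensures r ≤ s.
  set r : ℝ≥0 := s / (2 * n + 1) with hrdef
  have hr0 : 0 < r := by positivity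
  have hle : 2 * n * r ≤ s := by
    rw [hrdef, mul_div_assoc', div_le_iff₀ (by positivity), mul_comm]
    gcongr
    exact le_self_add
  have hrs : r ≤ s := div_le_self zero_le le_add_self
  have hr : (((2 * n) * r : ℝ≥0) : ℝ≥0∞) < p.radius :=
    (ENNReal.coe_le_coe.2 hle).trans_lt (hsR.trans_le hp.r_le)
  refine ⟨ofMulti p, r, hr0, wnorm_ofMulti_ne_top hr, ?_⟩
  filter_upwards [Metric.ball_mem_nhds (0 : PhaseSpace n) (NNReal.coe_pos.2 hr0)] with z hz
  rw [mem_ball_zero_iff] at hz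
  have hzR : z ∈ Metric.eball 0 R := by
    have h1 : ‖z‖ₑ < (r : ℝ≥0∞) := by
      rw [enorm_lt_coe]; exact_mod_cast hz
    rw [Metric.mem_eball, edist_zero_right]
    exact h1.trans ((ENNReal.coe_le_coe.2 hrs).trans_lt hsR)
  have h := (hasSum_words hp hr hz.le hzR).tsum_fiberwise (content (n := n))
  rw [← h.tsum_eq, evalS]
  refine tsum_congr fun m => ?_
  change _ = (∑' w : content (n := n) ⁻¹' {m}, wordCoeff p w) * mono m z
  rw [← tsum_mul_right]
  refine tsum_congr fun w => ?_
  have h : content (w : Σ k : ℕ, (Fin k → Fin n ⊕ Fin n)) = m := w.2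
  rw [h]

/-! ### Germs -/

theorem analyticAt_evalS_zero {r : ℝ≥0} (hr : 0 < r) {P : FPS n} (hP : wnorm r P ≠ ⊤) :
    AnalyticAt ℂ (evalS P) 0 := analyticAt_evalS hP (by rw [norm_zero]; exact_mod_cast hr)

/-- A germ is the sum of a convergent power series of order at least `k`. -/
def HasSeries (k : ℕ) (g : holGerm n) : Prop :=
  ∃ (P : FPS n) (r : ℝ≥0), 0 < r ∧ wnorm r P ≠ ⊤ ∧ P ∈ ordGE k ∧
    (g : Germ (𝓝 (0 : PhaseSpace n)) ℂ) = germOf (evalS P)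

theorem eventually_norm_le {r : ℝ≥0} (hr : 0 < r) : ∀ᶠ z : PhaseSpace n in 𝓝 0, ‖z‖ ≤ r := by
  filter_upwards [Metric.ball_mem_nhds (0 : PhaseSpace n) (NNReal.coe_pos.2 hr)] with z hz
  exact (mem_ball_zero_iff.1 hz).le

theorem HasSeries.add {k : ℕ} {g h : holGerm n} (hg : HasSeries k g) (hh : HasSeries k h) :
    HasSeries k (g + h) := by
  obtain ⟨P, r, hr, hP, hPk, hgP⟩ := hg
  obtain ⟨Q, s, hs, hQ, hQk, hhQ⟩ := hh
  have hP' := ne_top_of_le_ne_top hP (wnorm_mono (min_le_left r s) P)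
  have hQ' := ne_top_of_le_ne_top hQ (wnorm_mono (min_le_right r s) Q)
  refine ⟨P + Q, min r s, lt_min hr hs, wnorm_add_ne_top hP' hQ', Submodule.add_mem _ hPk hQk, ?_⟩
  rw [Subalgebra.coe_add, hgP, hhQ]
  refine Germ.coe_eq.2 ?_
  filter_upwards [eventually_norm_le (lt_min hr hs)] with z hz
  exact (evalS_add hz hP' hQ').symm

theorem HasSeries.mul {a b : ℕ} {g h : holGerm n} (hg : HasSeries a g) (hh : HasSeries b h) :
    HasSeries (a + b) (g * h) := by
  obtain ⟨P, r, hr, hP, hPk, hgP⟩ := hg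
  obtain ⟨Q, s, hs, hQ, hQk, hhQ⟩ := hh
  have hP' := ne_top_of_le_ne_top hP (wnorm_mono (min_le_left r s) P)
  have hQ' := ne_top_of_le_ne_top hQ (wnorm_mono (min_le_right r s) Q)
  refine ⟨P * Q, min r s, lt_min hr hs, wnorm_mul_ne_top hP' hQ', mul_mem_ordGE hPk hQk, ?_⟩
  rw [Subalgebra.coe_mul, hgP, hhQ]
  refine Germ.coe_eq.2 ?_
  filter_upwards [eventually_norm_le (lt_min hr hs)] with z hz
  exact (evalS_mul hz hP' hQ').symm

theorem hasSeries_of_mem_maxIdeal {g : holGerm n} (hg : g ∈ maxIdeal n) : HasSeries 1 g := by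
  obtain ⟨g, f, hf, rfl⟩ := g
  have h0 : f 0 = 0 := hg
  obtain ⟨P, r, hr, hP, he⟩ := exists_series hf
  refine ⟨P, r, hr, hP, fun m hm => ?_, Germ.coe_eq.2 he⟩
  have : m = 0 := (Finsupp.degree_eq_zero_iff m).1 (by omega)
  rw [this, ← evalS_at_zero, ← he.self_of_nhds, h0]

theorem hasSeries_of_mem_mul {a b : ℕ} {I J : Ideal (holGerm n)} (hI : ∀ g ∈ I, HasSeries a g)
    (hJ : ∀ g ∈ J, HasSeries b g) : ∀ g ∈ I * J, HasSeries (a + b) g := fun _ hg =>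
  Submodule.mul_induction_on hg (fun x hx y hy => (hI x hx).mul (hJ y hy)) fun _ _ hx hy => hx.add hy

theorem hasSeries_of_mem_maxIdeal_pow {g : holGerm n} (hg : g ∈ maxIdeal n ^ 3) :
    HasSeries 3 g := by
  rw [pow_succ, pow_two] at hg
  have h1 : ∀ g ∈ maxIdeal n, HasSeries 1 g := fun g => hasSeries_of_mem_maxIdeal
  exact hasSeries_of_mem_mul (hasSeries_of_mem_mul h1 h1) h1 g hg

/-! ### Division by the products `q_i p_i q_j p_j` -/

/-- The exponent of `q_i p_i`. -/
def pairExpo (i : Fin n) : Expo n := Finsupp.single (.inl i) 1 + Finsupp.single (.inr i) 1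

theorem degree_pairExpo (i : Fin n) : (pairExpo i).degree = 2 := by
  simp [pairExpo, map_add, Finsupp.degree_single]

theorem exists_pairExpo_le {m : Expo n} (h : 1 ≤ pairCount m) :
    ∃ i, pairExpo i ≤ m ∧ pairCount m ≤ pairCount (m - pairExpo i) + 1 := by
  classical
  obtain ⟨i, hi⟩ : ∃ i, 1 ≤ min (m (.inl i)) (m (.inr i)) := by
    by_contra! hc
    have : pairCount m = 0 := Finset.sum_eq_zero fun i _ => Nat.lt_one_iff.1 (hc i)
    omega
  have hle : pairExpo i ≤ m := by
    intro u
    rcases u with j | j <;> simp only [pairExpo, Finsupp.add_apply, Finsupp.single_apply,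
      Sum.inl.injEq, Sum.inr.injEq, reduceCtorEq, if_false] <;> split_ifs with hj
    · subst hj; omega
    · omega
    · subst hj; omega
    · omega
  refine ⟨i, hle, ?_⟩
  have := pairCount_add_pair (m - pairExpo i) i
  rwa [add_assoc, ← pairExpo, tsub_add_cancel_of_le hle] at this

theorem exists_pairExpo_add_le {m : Expo n} (h : 2 ≤ pairCount m) :
    ∃ p : Fin n × Fin n, pairExpo p.1 + pairExpo p.2 ≤ m := by
  obtain ⟨i, hi, hi'⟩ := exists_pairExpo_le (m := m) (by omega)
  obtain ⟨j, hj, -⟩ := exists_pairExpo_le (m := m - pairExpo i) (by omega)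
  refine ⟨(i, j), ?_⟩
  have := add_le_add_right hj (pairExpo i)
  rwa [add_tsub_cancel_of_le hi] at this

/-- Each monomial of `P` is assigned to one pair (i, j) for which it is divisible by q_i p_i q_j
p_j. The quotients share out the coefficients of `P` with degrees lowered by four, so their norms
grow at most by r^(-4) and convergence is kept. -/
theorem exists_factor {P : FPS n} (hP : P ∈ pairGE 2) {r : ℝ≥0} (hr : 0 < r)
    (hPr : wnorm r P ≠ ⊤) : ∃ Q : Fin n × Fin n → FPS n, (∀ p, wnorm r (Q p) ≠ ⊤) ∧
      P = ∑ p, monomial (pairExpo p.1 + pairExpo p.2) 1 * Q p := by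
  classical
  -- For n = 0 there are no pairs to choose from, but then `pairCount` is always 0 and `P` vanishes.
  rcases isEmpty_or_nonempty (Fin n) with he | he
  · refine ⟨fun _ => 0, fun p => he.elim p.1, ?_⟩
    rw [Finset.univ_eq_empty, Finset.sum_empty]
    ext m
    exact hP m (by simp [pairCount])
  choose! c hc using fun m (h : 2 ≤ pairCount (n := n) m) => exists_pairExpo_add_le h
  let Q : Fin n × Fin n → FPS n := fun p m =>
    if c (m + (pairExpo p.1 + pairExpo p.2)) = p then coeff (m + (pairExpo p.1 + pairExpo p.2)) P
    else 0
  have hQ : ∀ p m, coeff m (Q p) = if c (m + (pairExpo p.1 + pairExpo p.2)) = p then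
    coeff (m + (pairExpo p.1 + pairExpo p.2)) P else 0 := fun _ _ => rfl
  refine ⟨Q, fun p => ?_, ?_⟩
  · have h1 : wnorm r (Q p) * ((r ^ 4 : ℝ≥0) : ℝ≥0∞) ≤ wnorm r P := by
      have hinj : Function.Injective fun m : Expo n => m + (pairExpo p.1 + pairExpo p.2) :=
        add_left_injective _
      refine le_trans ?_ (ENNReal.tsum_comp_le_tsum_of_injective hinj _)
      rw [wnorm, ← ENNReal.tsum_mul_right]
      refine ENNReal.tsum_le_tsum fun m => ?_
      rw [map_add, map_add, degree_pairExpo, degree_pairExpo, pow_add, mul_assoc, ENNReal.coe_pow]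
      gcongr
      rw [hQ]
      split_ifs <;> simp
    intro h
    rw [h, ENNReal.top_mul (ENNReal.coe_ne_zero.2 (pow_pos hr 4).ne'), top_le_iff] at h1
    exact hPr h1
  · ext m
    rw [map_sum]
    simp only [coeff_monomial_mul, one_mul]
    by_cases hm : 2 ≤ pairCount m
    · rw [Finset.sum_eq_single (c m)]
      · rw [if_pos (hc m hm), hQ, tsub_add_cancel_of_le (hc m hm), if_pos rfl]
      · intro p _ hp
        split_ifs with h
        · rw [hQ, tsub_add_cancel_of_le h, if_neg (Ne.symm hp)]
        · rfl
      · simp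
    · rw [hP m (by omega), Finset.sum_eq_zero]
      intro p _
      split_ifs with h
      · rw [hQ, tsub_add_cancel_of_le h, hP m (by omega)]; simp
      · rfl

end FPS

end

noncomputable section

namespace FPS

open MvPowerSeries Finset.HasAntidiagonal
open scoped NNReal ENNReal

variable {n : ℕ}

/-! ### Symplectic maps given by power series -/

/-- The map with given power series as its coordinates. -/
def mapOf (y : Fin n ⊕ Fin n → FPS n) (z : PhaseSpace n) : PhaseSpace n :=
  (fun i => evalS (y (.inl i)) z, fun i => evalS (y (.inr i)) z)

theorem coord_mapOf (y : Fin n ⊕ Fin n → FPS n) (u : Fin n ⊕ Fin n) (z : PhaseSpace n) :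
    coord u (mapOf y z) = evalS (y u) z := by rcases u with i | i <;> rfl

theorem analyticAt_mapOf {y : Fin n ⊕ Fin n → FPS n} {r : ℝ≥0} (hy : ∀ u, wnorm r (y u) ≠ ⊤)
    {z : PhaseSpace n} (hz : ‖z‖ < r) : AnalyticAt ℂ (mapOf y) z :=
  AnalyticAt.prod (analyticAt_pi_iff.2 fun i => analyticAt_evalS (hy (.inl i)) hz)
    (analyticAt_pi_iff.2 fun i => analyticAt_evalS (hy (.inr i)) hz)

theorem coord_fderiv_mapOf {y : Fin n ⊕ Fin n → FPS n} {r : ℝ≥0} (hy : ∀ u, wnorm r (y u) ≠ ⊤)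
    {z : PhaseSpace n} (hz : ‖z‖ < r) (u v : Fin n ⊕ Fin n) :
    coord u (fderiv ℂ (mapOf y) z (basisVec v)) = evalS (pderiv ℂ v (y u)) z := by
  have h1 : HasFDerivAt (fun w => coord u (mapOf y w)) ((coord u).comp (fderiv ℂ (mapOf y) z)) z :=
    (coord u).hasFDerivAt.comp z (analyticAt_mapOf hy hz).differentiableAt.hasFDerivAt
  simp only [coord_mapOf] at h1
  rw [← fderiv_evalS (hy u) hz v, h1.fderiv]
  rfl

/-- The coordinate vector of a point of phase space. -/
def coordVec (z : PhaseSpace n) : Fin n ⊕ Fin n → ℂ := fun u => coord u z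

open Matrix in
theorem sympForm_eq (u v : PhaseSpace n) :
    sympForm u v = -(coordVec u ⬝ᵥ (J (Fin n) ℂ) *ᵥ coordVec v) := by
  simp [sympForm, J, coordVec, dotProduct, mulVec, Fintype.sum_sum_type, Matrix.one_apply,
    Finset.sum_sub_distrib]
  ring

open Matrix in
theorem mul_J_mul_transpose_apply (M : Matrix (Fin n ⊕ Fin n) (Fin n ⊕ Fin n) ℂ)
    (a b : Fin n ⊕ Fin n) : (M * J (Fin n) ℂ * Mᵀ) a b =
      -∑ i, (M a (.inl i) * M b (.inr i) - M a (.inr i) * M b (.inl i)) := by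
  simp [Matrix.mul_apply, J, Fintype.sum_sum_type, Matrix.one_apply, Finset.sum_sub_distrib]
  ring

open Matrix in
theorem bracket_X (a b : Fin n ⊕ Fin n) :
    bracket (X a : FPS n) (X b) = C (-(J (Fin n) ℂ) a b) := by
  classical
  rw [bracket_apply]
  rcases a with i | i <;> rcases b with j | j <;>
    simp [pderiv_X, Pi.single_apply, J, Matrix.one_apply]

open Matrix in
-- The canonical brackets of the components say M J Mᵀ = J for the Jacobian matrix M, whereas
-- preserving the form means Mᵀ J M = J; the symplectic group is stable under transposition.
theorem sympForm_fderiv_mapOf {y : Fin n ⊕ Fin n → FPS n} {r : ℝ≥0}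
    (hy : ∀ u, wnorm r (y u) ≠ ⊤) (hb : ∀ a b, bracket (y a) (y b) = bracket (X a) (X b))
    {z : PhaseSpace n} (hz : ‖z‖ < r) (u v : PhaseSpace n) :
    sympForm (fderiv ℂ (mapOf y) z u) (fderiv ℂ (mapOf y) z v) = sympForm u v := by
  classical
  obtain ⟨ρ, hzρ, hρr⟩ := exists_between hz
  lift ρ to ℝ≥0 using (norm_nonneg z).trans hzρ.le
  have hd : ∀ a c, wnorm ρ (pderiv ℂ a (y c)) ≠ ⊤ := fun a c =>
    wnorm_pderiv_ne_top (by exact_mod_cast hρr) (hy c) a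
  set M : Matrix (Fin n ⊕ Fin n) (Fin n ⊕ Fin n) ℂ := fun a c => evalS (pderiv ℂ c (y a)) z with hM
  have hMv : ∀ w, coordVec (fderiv ℂ (mapOf y) z w) = M *ᵥ coordVec w := by
    intro w
    ext a
    conv_lhs => rw [← sum_coord_smul_basisVec w]
    simp only [coordVec, map_sum, map_smul, coord_fderiv_mapOf hy hz, mulVec, dotProduct, hM,
      smul_eq_mul]
    exact Finset.sum_congr rfl fun c _ => mul_comm _ _
  have hMJ : M * J (Fin n) ℂ * Mᵀ = J (Fin n) ℂ := by
    ext a b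
    rw [mul_J_mul_transpose_apply, neg_eq_iff_eq_neg, ← evalS_C (-J (Fin n) ℂ a b) z, ← bracket_X,
      ← hb, bracket_apply, evalS_sum hzρ.le fun i _ => wnorm_sub_ne_top
        (wnorm_mul_ne_top (hd _ _) (hd _ _)) (wnorm_mul_ne_top (hd _ _) (hd _ _))]
    refine Finset.sum_congr rfl fun i _ => ?_
    rw [evalS_sub hzρ.le (wnorm_mul_ne_top (hd _ _) (hd _ _)) (wnorm_mul_ne_top (hd _ _) (hd _ _)),
      evalS_mul hzρ.le (hd _ _) (hd _ _), evalS_mul hzρ.le (hd _ _) (hd _ _)]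
  have hMJ' := SymplecticGroup.mem_iff'.1 (SymplecticGroup.mem_iff.2 hMJ)
  rw [sympForm_eq, sympForm_eq, hMv, hMv, ← vecMul_transpose M (coordVec u),
    ← dotProduct_mulVec, mulVec_mulVec, mulVec_mulVec, hMJ']

/-! ### Dilations -/

/-- The series of `z ↦ f (σ z)`. -/
def dil (σ : ℝ≥0) (f : FPS n) : FPS n := fun m => coeff m f * ((σ : ℝ) : ℂ) ^ m.degree

theorem coeff_dil (σ : ℝ≥0) (f : FPS n) (m : Expo n) :
    coeff m (dil σ f) = coeff m f * ((σ : ℝ) : ℂ) ^ m.degree := rfl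

theorem evalS_dil (σ : ℝ≥0) (f : FPS n) (z : PhaseSpace n) :
    evalS (dil σ f) z = evalS f (((σ : ℝ) : ℂ) • z) :=
  tsum_congr fun m => by rw [coeff_dil, mono_smul, mul_assoc]

theorem wnorm_dil (σ r : ℝ≥0) (f : FPS n) : wnorm r (dil σ f) = wnorm (σ * r) f := by
  refine tsum_congr fun m => ?_
  rw [coeff_dil, enorm_mul, enorm_pow, ENNReal.coe_mul, mul_pow, mul_assoc]
  congr 3
  rw [enorm_eq_nnnorm, ENNReal.coe_inj]
  ext; simp

theorem dil_mem_weightGE {W : Expo n → ℕ} {k : ℕ} {f : FPS n} (hf : f ∈ weightGE W k) (σ : ℝ≥0) :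
    dil σ f ∈ weightGE W k := fun m hm => by rw [coeff_dil, hf m hm, zero_mul]

/-- A Schwarz lemma: order k gains (σ/r)^k when the radius shrinks from r to σ. -/
theorem wnorm_mul_pow_le {σ r : ℝ≥0} (h : σ ≤ r) {k : ℕ} {f : FPS n} (hf : f ∈ ordGE k) :
    wnorm σ f * (r ^ k : ℝ≥0) ≤ (σ ^ k : ℝ≥0) * wnorm r f := by
  refine wnorm_le_of_coeff fun m => ?_
  by_cases hm : m.degree < k
  · rw [hf m hm]; simp
  · obtain ⟨d, hd⟩ := Nat.exists_eq_add_of_le (not_lt.1 hm)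
    rw [hd, pow_add, pow_add]
    calc ‖coeff m f‖₊ * (σ ^ k * σ ^ d) * r ^ k ≤ ‖coeff m f‖₊ * (σ ^ k * r ^ d) * r ^ k := by gcongr
      _ = _ := by ring

/-- The quadratic Hamiltonian as a function. -/
def quadFun (lam : Fin n → ℂ) (z : PhaseSpace n) : ℂ := ∑ i, lam i * (z.1 i * z.2 i)

theorem evalS_formalH (lam : Fin n → ℂ) (z : PhaseSpace n) :
    evalS (formalH lam) z = quadFun lam z := by
  have hz : ‖z‖ ≤ ‖z‖₊ := le_rfl
  rw [formalH, evalS_sum hz fun i _ => wnorm_smul_ne_top _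
    (wnorm_mul_ne_top (wnorm_X_ne_top _ _) (wnorm_X_ne_top _ _))]
  refine Finset.sum_congr rfl fun i _ => ?_
  rw [evalS_smul, evalS_mul hz (wnorm_X_ne_top _ _) (wnorm_X_ne_top _ _), evalS_X, evalS_X]
  rfl

theorem quadFun_smul (lam : Fin n → ℂ) (c : ℂ) (z : PhaseSpace n) :
    quadFun lam (c • z) = c ^ 2 * quadFun lam z := by
  simp only [quadFun, Finset.mul_sum, Prod.smul_fst, Prod.smul_snd, Pi.smul_apply, smul_eq_mul]
  exact Finset.sum_congr rfl fun i _ => by ring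

/-! ### The analytic normal form -/

/-- Smallness comes from the dilation by σ: H is quadratic, so σ^(-2) (H + P)(σ z) = H + P' with P'
of norm at most σ p / r³ at radius 1. Conjugating back by the dilation leaves the derivative of the
map unchanged up to its base point, so the map stays symplectic. -/
theorem exists_analytic_normal_form {lam : Fin n → ℂ} (hlam : IsDiophantine lam) {P : FPS n}
    (hP : P ∈ ordGE 3) {r : ℝ≥0} (hr : 0 < r) (hPr : wnorm r P ≠ ⊤) :
    ∃ (ρ : ℝ≥0) (Φ : PhaseSpace n → PhaseSpace n) (N : FPS n), 0 < ρ ∧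
      (∀ z, ‖z‖ < ρ → AnalyticAt ℂ Φ z) ∧ Φ 0 = 0 ∧ (∀ v, fderiv ℂ Φ 0 v = v) ∧
      (∀ z, ‖z‖ < ρ → ∀ u v, sympForm (fderiv ℂ Φ z u) (fderiv ℂ Φ z v) = sympForm u v) ∧
      N ∈ pairGE 2 ∧ wnorm ρ N ≠ ⊤ ∧
      ∀ z, ‖z‖ < ρ → quadFun lam (Φ z) + evalS P (Φ z) = quadFun lam z + evalS N z := by
  obtain ⟨ε, hε, hnf⟩ := exists_formal_normal_form hlam
  obtain ⟨p, hp⟩ := WithTop.ne_top_iff_exists.1 hPr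
  set σ : ℝ≥0 := min r (ε * r ^ 3 / (p + 1)) with hσ
  have hσ0 : 0 < σ := lt_min hr (by positivity)
  have hσp : σ * p / r ^ 3 ≤ ε := by
    rw [div_le_iff₀ (by positivity)]
    calc σ * p ≤ ε * r ^ 3 / (p + 1) * (p + 1) := by
          gcongr
          · exact min_le_right _ _
          · exact le_self_add
      _ = ε * r ^ 3 := div_mul_cancel₀ _ (by positivity)
  set s : ℂ := ((σ : ℝ) : ℂ) with hs
  have hs0 : s ≠ 0 := by rw [hs]; exact_mod_cast hσ0.ne'
  have hsn : ‖s‖₊ = σ := by ext; simp [hs]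
  set P' : FPS n := (s ^ 2)⁻¹ • dil σ P with hP'
  have hP'3 : P' ∈ ordGE 3 := Submodule.smul_mem _ _ (dil_mem_weightGE hP σ)
  have hP'n : wnorm 1 P' ≤ ε := by
    have h1 := wnorm_mul_pow_le (min_le_left r (ε * r ^ 3 / (p + 1))) hP
    have hp' : wnorm r P = (p : ℝ≥0∞) := hp.symm
    rw [← hσ, hp', ← ENNReal.coe_mul] at h1
    have h2 := le_coe_div_of_mul_le (pow_pos hr 3) h1
    rw [hP', wnorm_smul, wnorm_dil, mul_one, enorm_eq_nnnorm, nnnorm_inv, nnnorm_pow, hsn]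
    refine (mul_le_mul_right h2 _).trans ?_
    rw [← ENNReal.coe_mul, ENNReal.coe_le_coe]
    refine le_trans (le_of_eq ?_) hσp
    field_simp
  obtain ⟨φ, hmul, hbr, hord, hnorm, hI⟩ := hnf P' hP'3 hP'n
  have h1 := map_one_of_mul hmul hord
  set y : Fin n ⊕ Fin n → FPS n := fun u => φ (X u) with hy
  have hfin : ∀ f, wnorm 1 f ≠ ⊤ → wnorm (1 / 2) (φ f) ≠ ⊤ := fun f hf =>
    ne_top_of_le_ne_top (ENNReal.mul_ne_top (by norm_num) hf) (hnorm f)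
  have hyn : ∀ u, wnorm (1 / 2) (y u) ≠ ⊤ := fun u => hfin _ (wnorm_X_ne_top 1 u)
  have hyb : ∀ a b, bracket (y a) (y b) = bracket (X a) (X b) := by
    intro a b
    rw [hy, ← hbr, bracket_X, ← mul_one (C _), ← smul_eq_C_mul, map_smul, h1]
  have hyo : ∀ u, y u - X u ∈ ordGE 2 := by
    intro u
    refine hord 1 (X u) fun m hm => ?_
    rw [(Finsupp.degree_eq_zero_iff m).1 (by omega), coeff_zero_X]
  have hΨ0 : mapOf y 0 = 0 := by
    refine ext_coord fun u => ?_
    have := hyo u 0 (by simp)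
    rw [map_sub, coeff_zero_X, sub_zero] at this
    rw [coord_mapOf, evalS_at_zero, this, map_zero]
  have h12 : (0 : ℝ) < ((1 / 2 : ℝ≥0) : ℝ) := by positivity
  have hΨan0 : AnalyticAt ℂ (mapOf y) 0 := analyticAt_mapOf hyn (by rw [norm_zero]; exact h12)
  have hΨ'0 : ∀ v, fderiv ℂ (mapOf y) 0 v = v := by
    intro v
    refine ext_coord fun u => ?_
    conv_lhs => rw [← sum_coord_smul_basisVec v]
    conv_rhs => rw [← sum_coord_smul_basisVec v]
    simp only [map_sum, map_smul]
    refine Finset.sum_congr rfl fun w _ => ?_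
    congr 1
    rw [coord_fderiv_mapOf hyn (by rw [norm_zero]; exact h12), evalS_at_zero, coeff_pderiv, zero_add]
    have := hyo u (Finsupp.single w 1) (by simp [Finsupp.degree_single])
    rw [map_sub, sub_eq_zero] at this
    classical
    rw [this, coeff_index_single_X, coord_basisVec]
    simp [eq_comm]
  have hev : ∀ᶠ z in 𝓝 (0 : PhaseSpace n), ‖mapOf y z‖ < 1 := by
    have h := hΨan0.continuousAt.norm
    rw [ContinuousAt, hΨ0, norm_zero] at h
    exact h.eventually_lt_const one_pos
  obtain ⟨δ, hδ, hball⟩ := Metric.eventually_nhds_iff_ball.1 hev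
  lift δ to ℝ≥0 using hδ.le
  have hδ' : 0 < δ := by exact_mod_cast hδ
  have hscale : ∀ z : PhaseSpace n, ‖z‖ < σ * min (1 / 2) δ → ‖s⁻¹ • z‖ < min (1 / 2) δ := by
    intro z hz
    have hsn' : ‖s‖ = σ := by rw [← hsn]; rfl
    rw [norm_smul, norm_inv, hsn', inv_mul_lt_iff₀ (by exact_mod_cast hσ0)]
    exact hz
  have hder : ∀ z : PhaseSpace n, ‖s⁻¹ • z‖ < ((1 / 2 : ℝ≥0) : ℝ) →
      HasFDerivAt (fun z => s • mapOf y (s⁻¹ • z)) (fderiv ℂ (mapOf y) (s⁻¹ • z)) z := by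
    intro z hz
    have hA : HasFDerivAt (fun z : PhaseSpace n => s⁻¹ • z)
      (s⁻¹ • ContinuousLinearMap.id ℂ (PhaseSpace n)) z := (hasFDerivAt_id z).const_smul s⁻¹
    have hB := ((analyticAt_mapOf hyn hz).differentiableAt.hasFDerivAt.comp z hA).const_smul s
    refine hB.congr_fderiv ?_
    refine ContinuousLinearMap.ext fun v => ?_
    simp [smul_smul, hs0]
  set N₀ : FPS n := φ (formalH lam + P') - formalH lam with hN₀
  have hK : wnorm 1 (formalH lam + P') ≠ ⊤ :=
    wnorm_add_ne_top (wnorm_formalH_ne_top 1 lam) (ne_top_of_le_ne_top ENNReal.coe_ne_top hP'n)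
  have hN₀n : wnorm (1 / 2) N₀ ≠ ⊤ := wnorm_sub_ne_top (hfin _ hK) (wnorm_formalH_ne_top _ lam)
  refine ⟨σ * min (1 / 2) δ, fun z => s • mapOf y (s⁻¹ • z), s ^ 2 • dil σ⁻¹ N₀,
    by positivity, fun z hz => ?_, ?_, fun v => ?_, fun z hz u v => ?_, ?_, ?_, fun z hz => ?_⟩
  · have hz' := (hscale z (by exact_mod_cast hz)).trans_le (min_le_left _ _)
    have hA := (s⁻¹ • ContinuousLinearMap.id ℂ (PhaseSpace n)).analyticAt z
    have hB := AnalyticAt.fun_comp (analyticAt_mapOf hyn (z := s⁻¹ • z) (by exact_mod_cast hz')) hA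
    exact AnalyticAt.fun_comp ((s • ContinuousLinearMap.id ℂ (PhaseSpace n)).analyticAt _) hB
  · simp [hΨ0]
  · have := (hder 0 (by rw [smul_zero, norm_zero]; exact h12)).fderiv
    rw [this, smul_zero, hΨ'0]
  · have hz' : ‖s⁻¹ • z‖ < ((1 / 2 : ℝ≥0) : ℝ) := by
      have := (hscale z (by exact_mod_cast hz)).trans_le (min_le_left _ _)
      exact_mod_cast this
    rw [(hder z hz').fderiv]
    exact sympForm_fderiv_mapOf hyn hyb hz' u v
  · exact Submodule.smul_mem _ _ (dil_mem_weightGE hI _)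
  · refine wnorm_smul_ne_top _ ?_
    rw [wnorm_dil, inv_mul_cancel_left₀ hσ0.ne']
    exact ne_top_of_le_ne_top hN₀n (wnorm_mono (min_le_left _ _) _)
  · have hz' := hscale z (by exact_mod_cast hz)
    have hz1 : ‖s⁻¹ • z‖ ≤ ((1 / 2 : ℝ≥0) : ℝ) := by
      have := hz'.le.trans (min_le_left _ _)
      exact_mod_cast this
    have hz2 : ‖mapOf y (s⁻¹ • z)‖ ≤ ((1 : ℝ≥0) : ℝ) := by
      refine (hball _ ?_).le
      rw [mem_ball_zero_iff]
      exact hz'.trans_le (min_le_right _ _)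
    have key := evalS_map hmul h1 hnorm hz1 hz2 (fun u => coord_mapOf y u _) hK
    have e1 : φ (formalH lam + P') = formalH lam + N₀ := by rw [hN₀]; abel
    rw [e1, evalS_add hz1 (wnorm_formalH_ne_top _ lam) hN₀n, evalS_add hz2
      (wnorm_formalH_ne_top _ lam) (ne_top_of_le_ne_top ENNReal.coe_ne_top hP'n), evalS_formalH,
      evalS_formalH, hP', evalS_smul, evalS_dil, ← hs, quadFun_smul] at key
    have e2 : ((σ⁻¹ : ℝ≥0) : ℝ) = ((σ : ℝ))⁻¹ := NNReal.coe_inv σ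
    rw [evalS_smul, evalS_dil, e2, Complex.ofReal_inv, ← hs, quadFun_smul]
    have hs2 : s ^ 2 * (s ^ 2)⁻¹ = 1 := mul_inv_cancel₀ (pow_ne_zero 2 hs0)
    linear_combination -s ^ 2 * key + (quadFun lam z - evalS P (s • mapOf y (s⁻¹ • z))) * hs2

end FPS

end

noncomputable section

namespace FPS

open MvPowerSeries Finset.HasAntidiagonal
open scoped NNReal ENNReal

variable {n : ℕ}

/-! ### Symplectic linear algebra and Hamiltonian vector fields -/

theorem sympForm_sub_left (u u' v : PhaseSpace n) :
    sympForm (u - u') v = sympForm u v - sympForm u' v := by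
  simp only [sympForm, ← Finset.sum_sub_distrib, Prod.fst_sub, Prod.snd_sub, Pi.sub_apply]
  exact Finset.sum_congr rfl fun i _ => by ring

theorem eq_zero_of_sympForm {u : PhaseSpace n} (h : ∀ v, sympForm u v = 0) : u = 0 := by
  classical
  refine Prod.ext (funext fun i => ?_) (funext fun i => ?_)
  · simpa [sympForm, dp, Pi.single_apply] using h (dp i)
  · simpa [sympForm, dq, Pi.single_apply] using h (dq i)

/-- A linear map preserving the symplectic form is invertible. -/
def equivOfSymplectic (D : PhaseSpace n →L[ℂ] PhaseSpace n)
    (hD : ∀ u v, sympForm (D u) (D v) = sympForm u v) : PhaseSpace n ≃L[ℂ] PhaseSpace n :=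
  (LinearEquiv.ofInjectiveEndo D.toLinearMap ((injective_iff_map_eq_zero D.toLinearMap).2
    fun u hu => eq_zero_of_sympForm fun v => by
      have h0 : D u = 0 := hu
      rw [← hD, h0]; simp [sympForm])).toContinuousLinearEquiv

theorem coe_equivOfSymplectic (D : PhaseSpace n →L[ℂ] PhaseSpace n)
    (hD : ∀ u v, sympForm (D u) (D v) = sympForm u v) :
    (equivOfSymplectic D hD : PhaseSpace n →L[ℂ] PhaseSpace n) = D := by
  ext <;> rfl

theorem sympForm_hamField (F : PhaseSpace n → ℂ) (z v : PhaseSpace n) :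
    sympForm (hamField F z) v = fderiv ℂ F z v := by
  conv_rhs => rw [← sum_coord_smul_basisVec v]
  rw [map_sum, Fintype.sum_sum_type, ← Finset.sum_add_distrib]
  refine Finset.sum_congr rfl fun i _ => ?_
  simp only [map_smul, coord_inl, coord_inr, basisVec, Sum.elim_inl, Sum.elim_inr, hamField,
    smul_eq_mul]
  ring

/-- Hamiltonian fields are dual to differentials under the form, so by the chain rule both sides
have the same pairing with each vector DΦ v. These are all vectors, since a linear map preserving
the form is invertible. -/
theorem fderiv_hamField_comp {Φ : PhaseSpace n → PhaseSpace n} {F : PhaseSpace n → ℂ}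
    {z : PhaseSpace n} (hΦ : DifferentiableAt ℂ Φ z) (hF : DifferentiableAt ℂ F (Φ z))
    (hs : ∀ u v, sympForm (fderiv ℂ Φ z u) (fderiv ℂ Φ z v) = sympForm u v) :
    fderiv ℂ Φ z (hamField (fun y => F (Φ y)) z) = hamField F (Φ z) := by
  rw [← sub_eq_zero]
  refine eq_zero_of_sympForm fun w => ?_
  obtain ⟨v, rfl⟩ : ∃ v, fderiv ℂ Φ z v = w := by
    obtain ⟨v, hv⟩ := (equivOfSymplectic _ hs).surjective w
    exact ⟨v, by rw [← hv]; rfl⟩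
  rw [sympForm_sub_left, hs, sympForm_hamField, sympForm_hamField, fderiv_fun_comp z hF hΦ]
  simp

/-! ### Composition of germs with a map -/

/-- Composition with a holomorphic map that fixes the origin. -/
def compHom (Φ : PhaseSpace n → PhaseSpace n) (hΦ : AnalyticAt ℂ Φ 0) (h0 : Φ 0 = 0) :
    holGerm n →ₐ[ℂ] holGerm n where
  toFun g := ⟨g.1.compTendsto Φ (by have := hΦ.continuousAt.tendsto; rwa [h0] at this), by
    obtain ⟨_, f, hf, rfl⟩ := g
    exact ⟨fun z => f (Φ z), AnalyticAt.fun_comp (by rwa [h0]) hΦ, rfl⟩⟩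
  map_one' := rfl
  map_mul' := by rintro ⟨_, f, hf, rfl⟩ ⟨_, g, hg, rfl⟩; rfl
  map_zero' := rfl
  map_add' := by rintro ⟨_, f, hf, rfl⟩ ⟨_, g, hg, rfl⟩; rfl
  commutes' c := rfl

theorem exists_toGerm (g : holGerm n) : ∃ f, ∃ hf : AnalyticAt ℂ f 0, g = toGerm f hf := by
  obtain ⟨_, f, hf, rfl⟩ := g
  exact ⟨f, hf, rfl⟩

theorem coe_sum_eq_germOf {ι : Type*} (s : Finset ι) (g : ι → holGerm n) (f : ι → PhaseSpace n → ℂ)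
    (h : ∀ i ∈ s, (g i : Germ (𝓝 (0 : PhaseSpace n)) ℂ) = germOf (f i)) :
    ((∑ i ∈ s, g i : holGerm n) : Germ (𝓝 (0 : PhaseSpace n)) ℂ) =
      germOf fun z => ∑ i ∈ s, f i z := by
  classical
  induction s using Finset.induction_on with
  | empty => simp only [Finset.sum_empty]; rfl
  | insert i s hi ih =>
    rw [Finset.sum_insert hi, Subalgebra.coe_add, h i (Finset.mem_insert_self i s),
      ih fun j hj => h j (Finset.mem_insert_of_mem hj)]
    simp only [Finset.sum_insert hi]
    rfl

theorem coe_poisson {f g : PhaseSpace n → ℂ} (hf : AnalyticAt ℂ f 0) (hg : AnalyticAt ℂ g 0) :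
    (poisson (toGerm f hf) (toGerm g hg) : Germ (𝓝 (0 : PhaseSpace n)) ℂ) =
      germOf fun z => sympForm (hamField f z) (hamField g z) := by
  refine (coe_sum_eq_germOf _ _ (fun i z => fderiv ℂ f z (dq i) * fderiv ℂ g z (dp i) -
    fderiv ℂ f z (dp i) * fderiv ℂ g z (dq i)) fun i _ => rfl).trans ?_
  congr 1
  funext z
  exact Finset.sum_congr rfl fun i _ => by simp only [hamField]; ring

theorem coe_quadH (lam : Fin n → ℂ) :
    (quadH lam : Germ (𝓝 (0 : PhaseSpace n)) ℂ) = germOf (quadFun lam) :=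
  coe_sum_eq_germOf _ _ (fun i z => lam i * (z.1 i * z.2 i)) fun _ _ => rfl

theorem compHom_poisson {Φ : PhaseSpace n → PhaseSpace n} (hΦ : AnalyticAt ℂ Φ 0) (h0 : Φ 0 = 0)
    (hs : ∀ᶠ z in 𝓝 0, ∀ u v, sympForm (fderiv ℂ Φ z u) (fderiv ℂ Φ z v) = sympForm u v)
    (f g : holGerm n) :
    compHom Φ hΦ h0 (poisson f g) = poisson (compHom Φ hΦ h0 f) (compHom Φ hΦ h0 g) := by
  obtain ⟨f, hf, rfl⟩ := exists_toGerm f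
  obtain ⟨g, hg, rfl⟩ := exists_toGerm g
  have hf' : AnalyticAt ℂ f (Φ 0) := by rwa [h0]
  have hg' : AnalyticAt ℂ g (Φ 0) := by rwa [h0]
  have e1 : compHom Φ hΦ h0 (toGerm f hf) = toGerm (fun z => f (Φ z)) (hf'.fun_comp hΦ) := rfl
  have e2 : compHom Φ hΦ h0 (toGerm g hg) = toGerm (fun z => g (Φ z)) (hg'.fun_comp hΦ) := rfl
  refine Subtype.ext ?_
  rw [e1, e2, coe_poisson]
  have e3 : (compHom Φ hΦ h0 (poisson (toGerm f hf) (toGerm g hg)) :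
      Germ (𝓝 (0 : PhaseSpace n)) ℂ) =
      ((poisson (toGerm f hf) (toGerm g hg) : holGerm n) : Germ (𝓝 (0 : PhaseSpace n)) ℂ).compTendsto
        Φ (by have := hΦ.continuousAt.tendsto; rwa [h0] at this) := rfl
  rw [e3]
  simp only [coe_poisson]
  refine Germ.coe_eq.2 ?_
  filter_upwards [hs, hΦ.eventually_analyticAt, hΦ.continuousAt.eventually hf'.eventually_analyticAt,
    hΦ.continuousAt.eventually hg'.eventually_analyticAt] with z hz hΦz hfz hgz
  simp only [Function.comp_apply]
  rw [← fderiv_hamField_comp hΦz.differentiableAt hfz.differentiableAt hz,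
    ← fderiv_hamField_comp hΦz.differentiableAt hgz.differentiableAt hz, hz]

/-! ### The variety `q_i p_i = 0` -/

theorem mono_eq_zero {m : Expo n} (hm : 1 ≤ pairCount m) {z : PhaseSpace n}
    (hz : z ∈ qpVariety n) : mono m z = 0 := by
  obtain ⟨i, hi, -⟩ := exists_pairExpo_le hm
  rw [← add_tsub_cancel_of_le hi, mono_add, pairExpo, mono_add, mono_single, mono_single,
    coord_inl, coord_inr, hz i, zero_mul]

theorem evalS_eq_zero_of_mem_qpVariety {f : FPS n} (hf : f ∈ pairGE 1) {z : PhaseSpace n}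
    (hz : z ∈ qpVariety n) : evalS f z = 0 := by
  have : ∀ m, coeff m f * mono m z = 0 := fun m => by
    by_cases hm : pairCount m < 1
    · rw [hf m hm, zero_mul]
    · rw [mono_eq_zero (not_lt.1 hm) hz, mul_zero]
  simp [evalS, this]

theorem pairCount_add_single_le (m : Expo n) (u : Fin n ⊕ Fin n) :
    pairCount (m + Finsupp.single u 1) ≤ pairCount m + 1 := by
  rcases u with i | i
  · refine le_trans ?_ (pairCount_add_pair m i)
    exact le_self_add.trans (pairCount_add_le _ _)
  · refine le_trans ?_ (pairCount_add_pair m i)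
    rw [add_right_comm]
    exact le_self_add.trans (pairCount_add_le _ _)

/-- One derivative lowers the power of I by at most one, so the partial derivatives of `N` are still
in I. Hence adding `N` to H does not change the Hamiltonian field on V(I). -/
theorem fderiv_evalS_eq_zero {N : FPS n} (hN : N ∈ pairGE 2) {ρ : ℝ≥0} (hρ : wnorm ρ N ≠ ⊤)
    {z : PhaseSpace n} (hzρ : ‖z‖ < ρ) (hz : z ∈ qpVariety n) : fderiv ℂ (evalS N) z = 0 := by
  refine ContinuousLinearMap.ext fun v => ?_
  rw [← sum_coord_smul_basisVec v, map_sum]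
  refine Finset.sum_eq_zero fun u _ => ?_
  rw [map_smul, fderiv_evalS hρ hzρ, evalS_eq_zero_of_mem_qpVariety _ hz, smul_zero]
  intro m hm
  rw [coeff_pderiv, hN _ (by have := pairCount_add_single_le m u; omega), zero_mul]

/-- The vector field of the linear flow. -/
def linField (lam : Fin n → ℂ) (z : PhaseSpace n) : PhaseSpace n :=
  (fun i => lam i * z.1 i, fun i => -(lam i * z.2 i))

theorem hamField_quadFun (lam : Fin n → ℂ) (z : PhaseSpace n) :
    hamField (quadFun lam) z = linField lam z := by
  have he : quadFun lam = evalS (formalH lam) := funext fun z => (evalS_formalH lam z).symm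
  have hz : ‖z‖ < ((‖z‖₊ + 1 : ℝ≥0) : ℝ) := by push_cast; exact lt_add_one _
  have h1 : ∀ u, fderiv ℂ (quadFun lam) z (basisVec u) = evalS (pderiv ℂ u (formalH lam)) z :=
    fun u => by rw [he, fderiv_evalS (wnorm_formalH_ne_top _ lam) hz]
  refine Prod.ext (funext fun i => ?_) (funext fun i => ?_)
  · refine (h1 (.inr i)).trans ?_
    rw [pderiv_inr_formalH, evalS_smul, evalS_X]; rfl
  · refine (congrArg Neg.neg (h1 (.inl i))).trans ?_
    rw [pderiv_inl_formalH, evalS_smul, evalS_X]; rfl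

theorem analyticAt_quadFun (lam : Fin n → ℂ) (z : PhaseSpace n) : AnalyticAt ℂ (quadFun lam) z := by
  have he : quadFun lam = evalS (formalH lam) := funext fun z => (evalS_formalH lam z).symm
  rw [he]
  exact analyticAt_evalS (r := ‖z‖₊ + 1) (wnorm_formalH_ne_top _ lam)
    (by push_cast; exact lt_add_one _)

theorem linFlow_mem_qpVariety {lam : Fin n → ℂ} {z : PhaseSpace n} (hz : z ∈ qpVariety n) (t : ℂ) :
    linFlow lam t z ∈ qpVariety n := fun i => by
  simp only [linFlow]
  rw [mul_mul_mul_comm, hz i, mul_zero]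

theorem linFlow_zero (lam : Fin n → ℂ) (z : PhaseSpace n) : linFlow lam 0 z = z := by
  simp [linFlow]

theorem hasDerivAt_linFlow (lam : Fin n → ℂ) (z : PhaseSpace n) (t : ℂ) :
    HasDerivAt (fun t => linFlow lam t z) (linField lam (linFlow lam t z)) t := by
  refine HasDerivAt.prodMk (hasDerivAt_pi.2 fun i => ?_) (hasDerivAt_pi.2 fun i => ?_)
  · have := (((hasDerivAt_id t).mul_const (lam i)).cexp).mul_const (z.1 i)
    refine this.congr_deriv ?_
    simp only [linFlow, id]; ring
  · have := ((((hasDerivAt_id t).mul_const (lam i)).neg).cexp).mul_const (z.2 i)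
    refine this.congr_deriv ?_
    simp only [linFlow, id, Pi.neg_apply]; ring

theorem mem_image_iff_symm {Φ : OpenPartialHomeomorph (PhaseSpace n) (PhaseSpace n)}
    {S : Set (PhaseSpace n)} {z : PhaseSpace n} (hz : z ∈ Φ.target) :
    z ∈ Φ '' (S ∩ Φ.source) ↔ Φ.symm z ∈ S := by
  constructor
  · rintro ⟨y, ⟨hy, hys⟩, rfl⟩
    rwa [Φ.left_inv hys]
  · exact fun h => ⟨Φ.symm z, ⟨h, Φ.map_target hz⟩, Φ.right_inv hz⟩

theorem sympForm_fderiv_symm {Φ : OpenPartialHomeomorph (PhaseSpace n) (PhaseSpace n)}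
    (hΦ : IsSymplectomorphism Φ) {z : PhaseSpace n} (hz : z ∈ Φ.target) (u v : PhaseSpace n) :
    sympForm (fderiv ℂ Φ.symm z u) (fderiv ℂ Φ.symm z v) = sympForm u v := by
  have hs := Φ.map_target hz
  have h1 : fderiv ℂ (fun y => Φ (Φ.symm y)) z = ContinuousLinearMap.id ℂ _ := by
    have he : (fun y => Φ (Φ.symm y)) =ᶠ[𝓝 z] id := by
      filter_upwards [Φ.open_target.mem_nhds hz] with y hy using Φ.right_inv hy
    rw [he.fderiv_eq, fderiv_id]
  rw [fderiv_fun_comp z (hΦ.1 _ hs).differentiableAt (hΦ.2.1 _ hz).differentiableAt] at h1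
  rw [← hΦ.2.2 _ hs]
  have h2 : ∀ w, fderiv ℂ Φ (Φ.symm z) (fderiv ℂ Φ.symm z w) = w := fun w =>
    DFunLike.congr_fun h1 w
  rw [h2, h2]

/-- Here `c` selects the vanishing coordinate of each pair. Its partner stays non-zero nearby, so
V(I) is locally the plane where all selected coordinates vanish. On this plane every product in the
symplectic form contains a vanishing factor. -/
theorem isLagrangianAt_image {Φ : OpenPartialHomeomorph (PhaseSpace n) (PhaseSpace n)}
    (hΦ : IsSymplectomorphism Φ) {y : PhaseSpace n} (hy : y ∈ Φ.source) {c : Fin n → Fin n ⊕ Fin n}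
    (hc : ∀ i, c i = .inl i ∨ c i = .inr i) (h0 : ∀ i, coord (c i) y = 0)
    (h1 : ∀ i, coord (c i).swap y ≠ 0) :
    IsLagrangianAt (Φ '' (qpVariety n ∩ Φ.source)) (Φ y) := by
  have hprod : ∀ (i : Fin n) (w : PhaseSpace n), w.1 i * w.2 i = coord (c i) w * coord (c i).swap w := by
    intro i w
    rcases hc i with h | h <;> rw [h] <;> simp [mul_comm]
  have hyV : y ∈ qpVariety n := fun i => by rw [hprod, h0, zero_mul]
  have hyt := Φ.map_source hy
  refine ⟨⟨y, ⟨hyV, hy⟩, rfl⟩, fun z i => coord (c i) (Φ.symm z), ?_, ?_, ?_⟩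
  · exact analyticAt_pi_iff.2 fun i => ((coord (c i)).analyticAt _).fun_comp (hΦ.2.1 _ hyt)
  all_goals
    have hder : ∀ z ∈ Φ.target, ∀ w i, fderiv ℂ (fun z i => coord (c i) (Φ.symm z)) z w i =
        coord (c i) (fderiv ℂ Φ.symm z w) := by
      intro z hz w i
      have h : HasFDerivAt (fun z (i : Fin n) => coord (c i) (Φ.symm z))
          (ContinuousLinearMap.pi fun i => (coord (c i)).comp (fderiv ℂ Φ.symm z)) z :=
        hasFDerivAt_pi.2 fun i =>
          (coord (c i)).hasFDerivAt.comp z (hΦ.2.1 _ hz).differentiableAt.hasFDerivAt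
      rw [h.fderiv]; rfl
  · intro w
    classical
    obtain ⟨v, hv⟩ := (equivOfSymplectic _ (sympForm_fderiv_symm hΦ hyt)).surjective
      (∑ i, w i • basisVec (c i))
    refine ⟨v, funext fun i => ?_⟩
    have hv' : fderiv ℂ Φ.symm (Φ y) v = ∑ i, w i • basisVec (c i) := by
      rw [← hv]; rfl
    have hinj : ∀ i j, c i = c j ↔ i = j := by
      intro i j
      refine ⟨fun h => ?_, fun h => by rw [h]⟩
      rcases hc i with hi | hi <;> rcases hc j with hj | hj <;> rw [hi, hj] at h <;>
        simp_all
    rw [hder _ hyt, hv', map_sum]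
    simp [coord_basisVec, hinj]
  · have hcont : ContinuousAt Φ.symm (Φ y) := Φ.continuousAt_symm hyt
    have hne : ∀ᶠ z in 𝓝 (Φ y), ∀ i, coord (c i).swap (Φ.symm z) ≠ 0 := by
      refine eventually_all.2 fun i => ?_
      have : ContinuousAt (fun z => coord (c i).swap (Φ.symm z)) (Φ y) :=
        (coord (c i).swap).continuous.continuousAt.comp hcont
      refine this.eventually_ne ?_
      rw [Φ.left_inv hy]
      exact h1 i
    filter_upwards [Φ.open_target.mem_nhds hyt, hne] with z hz hzne
    refine ⟨?_, fun _ u v hu hv => ?_⟩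
    · rw [mem_image_iff_symm hz]
      constructor
      · intro h
        funext i
        have := h i
        rw [hprod] at this
        exact (mul_eq_zero.1 this).resolve_right (hzne i)
      · intro h i
        rw [hprod, show coord (c i) (Φ.symm z) = 0 from congrFun h i, zero_mul]
    · rw [← sympForm_fderiv_symm hΦ hz]
      have hu' : ∀ i, coord (c i) (fderiv ℂ Φ.symm z u) = 0 := fun i => by
        rw [← hder z hz, hu]; rfl
      have hv' : ∀ i, coord (c i) (fderiv ℂ Φ.symm z v) = 0 := fun i => by
        rw [← hder z hz, hv]; rfl
      refine Finset.sum_eq_zero fun i _ => ?_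
      have a := hu' i
      have b := hv' i
      rcases hc i with h | h <;> rw [h] at a b <;>
        simp only [coord_inl, coord_inr] at a b <;> rw [a, b] <;> ring

theorem isLagrangianVariety_image {Φ : OpenPartialHomeomorph (PhaseSpace n) (PhaseSpace n)}
    (hΦ : IsSymplectomorphism Φ) :
    IsLagrangianVariety Φ.target (Φ '' (qpVariety n ∩ Φ.source)) := by
  refine ⟨⟨?_, fun a ha => ⟨n, fun z i => (Φ.symm z).1 i * (Φ.symm z).2 i, ?_, ?_⟩⟩, ?_⟩
  · rintro _ ⟨y, ⟨-, hy⟩, rfl⟩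
    exact Φ.map_source hy
  · refine analyticAt_pi_iff.2 fun i => ?_
    exact (((coord (.inl i)).analyticAt _).fun_comp (hΦ.2.1 _ ha)).mul
      (((coord (.inr i)).analyticAt _).fun_comp (hΦ.2.1 _ ha))
  · filter_upwards [Φ.open_target.mem_nhds ha] with z hz
    rw [mem_image_iff_symm hz]
    exact ⟨fun h => funext h, fun h i => congrFun h i⟩
  · rintro _ ⟨y, ⟨hyV, hy⟩, rfl⟩
    classical
    -- Where both coordinates of a pair vanish, q_i is moved to t. For t ≠ 0 exactly one coordinate
    -- of each pair is zero, so y is a limit of regular points of V(I).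
    set p : ℂ → PhaseSpace n := fun t =>
      (fun i => if y.1 i = 0 ∧ y.2 i = 0 then t else y.1 i, y.2) with hp
    have hpc : Continuous p := by
      refine Continuous.prodMk (continuous_pi fun i => ?_) continuous_const
      split_ifs
      · exact continuous_id
      · exact continuous_const
    have hp0 : p 0 = y := by
      refine Prod.ext (funext fun i => ?_) rfl
      simp only [hp]
      split_ifs with h
      · exact h.1.symm
      · rfl
    have hev : ∀ᶠ t in 𝓝 (0 : ℂ), p t ∈ Φ.source :=
      hpc.continuousAt.eventually (by rw [hp0]; exact Φ.open_source.mem_nhds hy)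
    have hlim : Tendsto (fun t => Φ (p t)) (𝓝[≠] 0) (𝓝 (Φ y)) := by
      have : ContinuousAt (fun t => Φ (p t)) 0 :=
        ContinuousAt.comp (by rw [hp0]; exact Φ.continuousAt hy) hpc.continuousAt
      rw [ContinuousAt, hp0] at this
      exact this.mono_left nhdsWithin_le_nhds
    refine mem_closure_of_tendsto hlim ?_
    filter_upwards [nhdsWithin_le_nhds hev, self_mem_nhdsWithin] with t ht ht0
    refine isLagrangianAt_image hΦ ht (c := fun i => if y.2 i = 0 then .inr i else .inl i)
      (fun i => ?_) (fun i => ?_) fun i => ?_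
    · split_ifs
      · exact .inr rfl
      · exact .inl rfl
    · split_ifs with h
      · exact h
      · have := (mul_eq_zero.1 (hyV i)).resolve_right h
        simp [hp, h, this]
    · split_ifs with h
      · simp only [Sum.swap_inr, coord_inl, hp]
        split_ifs with h'
        · exact ht0
        · exact fun h0 => h' ⟨h0, h⟩
      · exact h

/-! ### Flows -/

/-- On the real segment from t₀ to t both curves solve the equation of the field (t - t₀) X, which
is Lipschitz near the common initial value; real uniqueness applies. -/
theorem eventuallyEq_of_ode {E : Type*} [NormedAddCommGroup E] [NormedSpace ℂ E]
    {X : E → E} {γ₁ γ₂ : ℂ → E} {t₀ : ℂ} (hX : ContDiffAt ℂ 1 X (γ₁ t₀))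
    (h₁ : ∀ᶠ t in 𝓝 t₀, HasDerivAt γ₁ (X (γ₁ t)) t) (h₂ : ∀ᶠ t in 𝓝 t₀, HasDerivAt γ₂ (X (γ₂ t)) t)
    (h0 : γ₁ t₀ = γ₂ t₀) : γ₁ =ᶠ[𝓝 t₀] γ₂ := by
  let : NormedSpace ℝ E := NormedSpace.restrictScalars ℝ ℂ E
  obtain ⟨K, s, hs, hK⟩ := hX.exists_lipschitzOnWith
  have e₁ := h₁.self_of_nhds.continuousAt.eventually hs
  have e₂ := h₂.self_of_nhds.continuousAt.eventually (h0 ▸ hs)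
  obtain ⟨ε, hε, hb⟩ := Metric.eventually_nhds_iff_ball.1 ((h₁.and h₂).and (e₁.and e₂))
  filter_upwards [Metric.ball_mem_nhds t₀ hε] with t ht
  have hl : ∀ τ ∈ Set.Icc (0 : ℝ) 1, t₀ + (τ : ℂ) * (t - t₀) ∈ Metric.ball t₀ ε := by
    intro τ hτ
    rw [mem_ball_iff_norm] at ht ⊢
    rw [add_sub_cancel_left, norm_mul, Complex.norm_real, Real.norm_of_nonneg hτ.1]
    exact (mul_le_of_le_one_left (norm_nonneg _) hτ.2).trans_lt ht
  have hline : ∀ τ : ℝ, HasDerivAt (fun τ : ℝ => t₀ + (τ : ℂ) * (t - t₀)) (t - t₀) τ := by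
    intro τ
    have := ((hasDerivAt_id τ).ofReal_comp.mul_const (t - t₀)).const_add t₀
    simpa using this
  have hd : ∀ γ : ℂ → E, (∀ w ∈ Metric.ball t₀ ε, HasDerivAt γ (X (γ w)) w) →
      ∀ τ ∈ Set.Icc (0 : ℝ) 1, HasDerivAt (fun τ : ℝ => γ (t₀ + (τ : ℂ) * (t - t₀)))
        ((t - t₀) • X (γ (t₀ + (τ : ℂ) * (t - t₀)))) τ := fun γ hγ τ hτ =>
    HasDerivAt.scomp τ (hγ _ (hl τ hτ)) (hline τ)
  have d₁ := hd γ₁ fun w hw => (hb w hw).1.1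
  have d₂ := hd γ₂ fun w hw => (hb w hw).1.2
  have key := ODE_solution_unique_of_mem_Icc_right (v := fun _ x => (t - t₀) • X x)
    (s := fun _ => s) (K := ‖t - t₀‖₊ * K) (a := 0) (b := 1)
    (f := fun τ : ℝ => γ₁ (t₀ + (τ : ℂ) * (t - t₀))) (g := fun τ : ℝ => γ₂ (t₀ + (τ : ℂ) * (t - t₀)))
    (fun _ _ => LipschitzOnWith.of_dist_le_mul fun x hx y hy => by
      rw [dist_smul₀, NNReal.coe_mul, mul_assoc]
      exact mul_le_mul_of_nonneg_left (hK.dist_le_mul x hx y hy) (norm_nonneg _))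
    (fun τ hτ => (d₁ τ hτ).continuousAt.continuousWithinAt)
    (fun τ hτ => (d₁ τ (Set.Ico_subset_Icc_self hτ)).hasDerivWithinAt)
    (fun τ hτ => (hb _ (hl τ (Set.Ico_subset_Icc_self hτ))).2.1)
    (fun τ hτ => (d₂ τ hτ).continuousAt.continuousWithinAt)
    (fun τ hτ => (d₂ τ (Set.Ico_subset_Icc_self hτ)).hasDerivWithinAt)
    (fun τ hτ => (hb _ (hl τ (Set.Ico_subset_Icc_self hτ))).2.2)
    (by simpa using h0)
  have := key (Set.right_mem_Icc.2 zero_le_one)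
  simpa using this

theorem analyticAt_hamField {F : PhaseSpace n → ℂ} {z : PhaseSpace n} (hF : AnalyticAt ℂ F z) :
    AnalyticAt ℂ (hamField F) z := by
  have h : ∀ v, AnalyticAt ℂ (fun z => fderiv ℂ F z v) z := fun v =>
    ((ContinuousLinearMap.apply ℂ ℂ v).analyticAt _).fun_comp hF.fderiv
  exact AnalyticAt.prod (analyticAt_pi_iff.2 fun i => h _) (analyticAt_pi_iff.2 fun i => (h _).neg)

/-- The times at which γ agrees with the image of the linear flow form an open set by uniqueness. It
is closed in `D` because γ stays in the target: at a limit time, continuity of `Φ.symm ∘ γ` forces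
the linear flow to be still in the source. -/
theorem conjugatesFlow {Φ : OpenPartialHomeomorph (PhaseSpace n) (PhaseSpace n)}
    (hΦ : AnalyticOnNhd ℂ Φ Φ.source) {X : PhaseSpace n → PhaseSpace n}
    (hX : ∀ w ∈ Φ.target, AnalyticAt ℂ X w) {lam : Fin n → ℂ}
    (h : ∀ y ∈ qpVariety n ∩ Φ.source, fderiv ℂ Φ y (linField lam y) = X (Φ y)) :
    ConjugatesFlow Φ (qpVariety n) X (linFlow lam) := by
  rintro z ⟨hzV, hz⟩ D hD hDc h0 γ hγ0
  have hflow : Continuous fun t => linFlow lam t z :=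
    continuous_iff_continuousAt.2 fun t => (hasDerivAt_linFlow lam z t).continuousAt
  have hsol : ∀ t, linFlow lam t z ∈ Φ.source →
      HasDerivAt (fun t => Φ (linFlow lam t z)) (X (Φ (linFlow lam t z))) t := by
    intro t ht
    rw [← h _ ⟨linFlow_mem_qpVariety hzV t, ht⟩]
    exact HasFDerivAt.comp_hasDerivAt (f := fun t => linFlow lam t z) t
      (hΦ _ ht).differentiableAt.hasFDerivAt (hasDerivAt_linFlow lam z t)
  constructor
  · intro hγ
    set A : Set ℂ := {t | t ∈ D ∧ linFlow lam t z ∈ Φ.source ∧ γ t = Φ (linFlow lam t z)} with hA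
    have hAopen : IsOpen A := by
      refine isOpen_iff_mem_nhds.2 fun t ht => ?_
      have hDt := hD.mem_nhds ht.1
      have hUt : ∀ᶠ s in 𝓝 t, linFlow lam s z ∈ Φ.source :=
        hflow.continuousAt.eventually (Φ.open_source.mem_nhds ht.2.1)
      have heq := eventuallyEq_of_ode (X := X) (γ₁ := γ) (γ₂ := fun t => Φ (linFlow lam t z))
        (t₀ := t) ((hX _ (hγ t ht.1).1).contDiffAt) (by filter_upwards [hDt] with s hs using (hγ s hs).2)
        (by filter_upwards [hUt] with s hs using hsol s hs) ht.2.2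
      filter_upwards [hDt, hUt, heq] with s h1 h2 h3 using ⟨h1, h2, h3⟩
    have hAcl : closure A ∩ D ⊆ A := by
      rintro t ⟨htA, htD⟩
      have ht := hγ t htD
      have hne : (𝓝[A] t).NeBot := mem_closure_iff_nhdsWithin_neBot.1 htA
      have hη : Tendsto (fun s => Φ.symm (γ s)) (𝓝[A] t) (𝓝 (Φ.symm (γ t))) :=
        (((Φ.continuousAt_symm ht.1).comp ht.2.continuousAt).tendsto).mono_left nhdsWithin_le_nhds
      have hψ : Tendsto (fun s => linFlow lam s z) (𝓝[A] t) (𝓝 (linFlow lam t z)) :=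
        hflow.continuousAt.tendsto.mono_left nhdsWithin_le_nhds
      have he : Φ.symm (γ t) = linFlow lam t z := by
        refine tendsto_nhds_unique_of_eventuallyEq hη hψ ?_
        filter_upwards [self_mem_nhdsWithin] with s hs
        rw [hs.2.2, Φ.left_inv hs.2.1]
      exact ⟨htD, he ▸ Φ.map_target ht.1, by rw [← he, Φ.right_inv ht.1]⟩
    have hsub := hDc.subset_of_closure_inter_subset hAopen
      ⟨0, h0, h0, by rwa [linFlow_zero], by rw [linFlow_zero, hγ0]⟩ hAcl
    exact fun t ht => (hsub ht).2
  · intro hγ t ht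
    have h1 := hγ t ht
    refine ⟨h1.2 ▸ Φ.map_source h1.1, ?_⟩
    rw [h1.2]
    refine (hsol t h1.1).congr_of_eventuallyEq ?_
    filter_upwards [hD.mem_nhds ht] with s hs using (hγ s hs).2

end FPS

end

noncomputable section

namespace FPS

open MvPowerSeries Finset.HasAntidiagonal
open scoped NNReal ENNReal

variable {n : ℕ}

/-! ### Conclusion -/

/-- A holomorphic symplectic map tangent to the identity restricts to a symplectomorphism. -/
theorem exists_isSymplectomorphism {Φ : PhaseSpace n → PhaseSpace n} {ρ : ℝ≥0} (hρ : 0 < ρ)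
    (hΦ : ∀ z, ‖z‖ < ρ → AnalyticAt ℂ Φ z) (h1 : ∀ v, fderiv ℂ Φ 0 v = v)
    (hs : ∀ z, ‖z‖ < ρ → ∀ u v, sympForm (fderiv ℂ Φ z u) (fderiv ℂ Φ z v) = sympForm u v) :
    ∃ e : OpenPartialHomeomorph (PhaseSpace n) (PhaseSpace n), (e : PhaseSpace n → PhaseSpace n) = Φ ∧
      0 ∈ e.source ∧ (∀ z ∈ e.source, ‖z‖ < ρ) ∧ IsSymplectomorphism e := by
  have hρ0 : ‖(0 : PhaseSpace n)‖ < ρ := by rw [norm_zero]; exact_mod_cast hρ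
  have hd : HasStrictFDerivAt Φ
      ((ContinuousLinearEquiv.refl ℂ (PhaseSpace n) : PhaseSpace n ≃L[ℂ] PhaseSpace n) :
        PhaseSpace n →L[ℂ] PhaseSpace n) 0 := by
    refine (hΦ 0 hρ0).hasStrictFDerivAt.congr_fderiv ?_
    exact ContinuousLinearMap.ext h1
  set e := (hd.toOpenPartialHomeomorph Φ).restrOpen (Metric.ball 0 ρ) Metric.isOpen_ball with he
  have hsrc : ∀ z ∈ e.source, ‖z‖ < ρ := fun z hz => mem_ball_zero_iff.1 hz.2
  refine ⟨e, rfl, ⟨hd.mem_toOpenPartialHomeomorph_source, mem_ball_zero_iff.2 hρ0⟩, hsrc,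
    fun z hz => hΦ z (hsrc z hz), fun w hw => ?_, fun z hz => hs z (hsrc z hz)⟩
  have hz := e.map_target hw
  -- The derivative preserves the form, so it is invertible at every point of the source, and the
  -- inverse is analytic on the whole target.
  have := e.analyticAt_symm' (i := equivOfSymplectic _ (hs _ (hsrc _ hz))) hz (hΦ _ (hsrc _ hz))
    (coe_equivOfSymplectic _ _).symm
  rwa [e.right_inv hw] at this

theorem isSymplectomorphism_restrOpen {e : OpenPartialHomeomorph (PhaseSpace n) (PhaseSpace n)}
    (he : IsSymplectomorphism e) {s : Set (PhaseSpace n)} (hs : IsOpen s) :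
    IsSymplectomorphism (e.restrOpen s hs) :=
  ⟨fun z hz => he.1 z hz.1, fun w hw => he.2.1 w hw.1, fun z hz => he.2.2 z hz.1⟩

/-- The automorphism of the algebra of germs given by composition with a local biholomorphism. -/
theorem exists_represents {e : OpenPartialHomeomorph (PhaseSpace n) (PhaseSpace n)}
    (he : IsSymplectomorphism e) (h0 : 0 ∈ e.source) (he0 : e 0 = 0) :
    ∃ φ : holGerm n ≃ₐ[ℂ] holGerm n, IsSymplecticAut φ ∧ Represents e φ := by
  have ht : (0 : PhaseSpace n) ∈ e.target := he0 ▸ e.map_source h0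
  have he0' : e.symm 0 = 0 := by
    have := e.left_inv h0
    rwa [he0] at this
  refine ⟨AlgEquiv.ofAlgHom (compHom e (he.1 0 h0) he0) (compHom e.symm (he.2.1 0 ht) he0') ?_ ?_,
    ?_, h0, he0, fun f hf => rfl⟩
  · refine AlgHom.ext fun g => ?_
    obtain ⟨f, hf, rfl⟩ := exists_toGerm g
    refine Subtype.ext (Germ.coe_eq.2 ?_)
    filter_upwards [e.open_source.mem_nhds h0] with z hz
    exact congrArg f (e.left_inv hz)
  · refine AlgHom.ext fun g => ?_
    obtain ⟨f, hf, rfl⟩ := exists_toGerm g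
    refine Subtype.ext (Germ.coe_eq.2 ?_)
    filter_upwards [e.open_target.mem_nhds ht] with z hz
    exact congrArg f (e.right_inv hz)
  · refine compHom_poisson (he.1 0 h0) he0 ?_
    filter_upwards [e.open_source.mem_nhds h0] with z hz using he.2.2 z hz

theorem wnorm_monomial_ne_top (r : ℝ≥0) (m : Expo n) (c : ℂ) :
    wnorm r (monomial m c : FPS n) ≠ ⊤ := by
  rw [← MvPolynomial.coe_monomial]
  exact wnorm_coe_ne_top r _

/-- The factorization with convergent quotients turns the condition on exponents into membership in
an ideal of germs. -/
theorem mem_qpIdeal_sq {N : FPS n} (hN : N ∈ pairGE 2) {ρ : ℝ≥0} (hρ : 0 < ρ)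
    (hNρ : wnorm ρ N ≠ ⊤) {g : holGerm n}
    (hg : (g : Germ (𝓝 (0 : PhaseSpace n)) ℂ) = germOf (evalS N)) : g ∈ qpIdeal n ^ 2 := by
  obtain ⟨Q, hQ, hNQ⟩ := exists_factor hN hρ hNρ
  have hpair : ∀ i : Fin n, qGerm i * pGerm i ∈ qpIdeal n := fun i =>
    Ideal.subset_span ⟨i, rfl⟩
  have hsum : g = ∑ p : Fin n × Fin n, qGerm p.1 * pGerm p.1 * (qGerm p.2 * pGerm p.2) *
      toGerm (evalS (Q p)) (analyticAt_evalS_zero hρ (hQ p)) := by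
    refine Subtype.ext ?_
    rw [coe_sum_eq_germOf _ _ (fun p z => z.1 p.1 * z.2 p.1 * (z.1 p.2 * z.2 p.2) *
      evalS (Q p) z) fun p _ => rfl, hg]
    refine Germ.coe_eq.2 ?_
    filter_upwards [eventually_norm_le hρ] with z hz
    rw [hNQ, evalS_sum hz fun p _ => wnorm_mul_ne_top (wnorm_monomial_ne_top _ _ _) (hQ p)]
    refine Finset.sum_congr rfl fun p _ => ?_
    rw [evalS_mul hz (wnorm_monomial_ne_top _ _ _) (hQ p), evalS_monomial, mono_add, pairExpo,
      pairExpo, mono_add, mono_add, mono_single, mono_single, mono_single, mono_single, one_mul]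
    rfl
  rw [hsum]
  refine Ideal.sum_mem _ fun p _ => Ideal.mul_mem_right _ _ ?_
  rw [pow_two]
  exact Ideal.mul_mem_mul (hpair _) (hpair _)

end FPS

end

open FPS in
theorem mainTheorem5 (n : ℕ) (lam : Fin n → ℂ) (hlam : IsDiophantine lam)
    (R : holGerm n) (hR : R ∈ maxIdeal n ^ 3) :
    ∃ φ : holGerm n ≃ₐ[ℂ] holGerm n,
      IsSymplecticAut φ ∧
      φ (quadH lam + R) - quadH lam ∈ qpIdeal n ^ 2 ∧
      ∀ (F : PhaseSpace n → ℂ) (hF : AnalyticAt ℂ F 0), toGerm F hF = quadH lam + R →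
        ∃ Φ : OpenPartialHomeomorph (PhaseSpace n) (PhaseSpace n),
          Represents Φ φ ∧
          IsSymplectomorphism Φ ∧
          AnalyticOnNhd ℂ F Φ.target ∧
          IsLagrangianVariety Φ.target (Φ '' (qpVariety n ∩ Φ.source)) ∧
          ConjugatesFlow Φ (qpVariety n) (hamField F) (linFlow lam) := by
  obtain ⟨P, r, hr, hPr, hP, hRP⟩ := hasSeries_of_mem_maxIdeal_pow hR
  obtain ⟨ρ, Φ, N, hρ, hΦ, hΦ0, hΦ1, hs, hN, hNρ, hconj⟩ :=
    exists_analytic_normal_form hlam hP hr hPr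
  obtain ⟨e, rfl, he0, hsrc, he⟩ := exists_isSymplectomorphism hρ hΦ hΦ1 hs
  obtain ⟨φ, hφ, hrep⟩ := exists_represents he he0 hΦ0
  have hHP : AnalyticAt ℂ (fun z => quadFun lam z + evalS P z) 0 :=
    (analyticAt_quadFun lam 0).add (analyticAt_evalS_zero hr hPr)
  have hHR : quadH lam + R = toGerm _ hHP := by
    refine Subtype.ext ?_
    rw [Subalgebra.coe_add, coe_quadH, hRP]
    rfl
  refine ⟨φ, hφ, mem_qpIdeal_sq hN hρ hNρ ?_, fun F hF hFR => ?_⟩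
  · rw [Subalgebra.coe_sub, hHR, hrep.2.2, coe_quadH]
    refine Germ.coe_eq.2 ?_
    filter_upwards [e.open_source.mem_nhds he0] with z hz
    simp [hconj z (hsrc z hz)]
  · have hFP : ∀ᶠ w in 𝓝 0, AnalyticAt ℂ F w ∧ F w = quadFun lam w + evalS P w :=
      hF.eventually_analyticAt.and (Germ.coe_eq.1 (congrArg Subtype.val (hFR.trans hHR)))
    -- As φ is chosen before `F`, only the domain may depend on `F`: it is shrunk so that its image
    -- lies in `W`, which does not affect the germ of the map.
    obtain ⟨W, hW, hWo, h0W⟩ := eventually_nhds_iff.1 hFP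
    have hEo := e.isOpen_inter_preimage hWo
    set E := e.restrOpen _ hEo with hE
    have hEs : IsSymplectomorphism E := isSymplectomorphism_restrOpen he hEo
    have hEW : ∀ z ∈ E.source, e z ∈ W := fun z hz => hz.2.2
    have hFt : AnalyticOnNhd ℂ F E.target := fun w hw => by
      have := hEW _ (E.map_target hw)
      rw [← E.right_inv hw]
      exact (hW _ this).1
    refine ⟨E, ⟨⟨he0, he0, by rwa [Set.mem_preimage, hΦ0]⟩, hΦ0, hrep.2.2⟩, hEs, hFt,
      isLagrangianVariety_image hEs,
      conjugatesFlow hEs.1 (fun w hw => analyticAt_hamField (hFt w hw)) ?_⟩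
    rintro y ⟨hyV, hy⟩
    have hyρ := hsrc y hy.1
    rw [← fderiv_hamField_comp (hEs.1 y hy).differentiableAt
      (hFt _ (E.map_source hy)).differentiableAt (hEs.2.2 y hy)]
    have hloc : (fun z => F (E z)) =ᶠ[𝓝 y] fun z => quadFun lam z + evalS N z := by
      filter_upwards [E.open_source.mem_nhds hy] with z hz
      exact ((hW _ (hEW z hz)).2).trans (hconj z (hsrc z hz.1))
    have hder : fderiv ℂ (fun z => F (E z)) y = fderiv ℂ (quadFun lam) y := by
      rw [hloc.fderiv_eq, fderiv_fun_add (analyticAt_quadFun lam y).differentiableAt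
        (analyticAt_evalS hNρ hyρ).differentiableAt, fderiv_evalS_eq_zero hN hNρ hyρ hyV, add_zero]
    rw [← hamField_quadFun]
    simp only [hamField, hder]
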